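/- **Setting.** Let $G$ be a directed acyclic graph on $n\ge 2$ nodes that is a polytree (its underlying undirected graph has no cycle; it need not be connected). Let $p_i$ be the number of parents of node $i$, let $d\ge 1$ satisfy $p_i\le d$ for all $i$, let $d_{avg}=\frac1n\sum_i p_i$ and $D=\max\{1,d_{avg}\}$. (If $G$ is connected, then $\frac12\le d_{avg}<1$, so that $D\le 2d_{avg}$ and $D$ may be replaced by $d_{avg}$ in the bounds below.) A Gaussian Bayesian network $\mathcal P$ over $G$ is the law of $(X_1,\dots,X_n)$, where $X_i=\eta_i+\sum_{j\text{ parent of }i}a_{i\leftarrow j}X_j$ with independent $\eta_i\sim N(0,\sigma_i^2)$, for arbitrary real coefficients $a_{i\leftarrow j}$ and variances $\sigma_i^2>0$. **Algorithm.** From the first $m_1$ samples, CauchyEstTree treats every node $Y$ with $p\ge1$ parents as follows. It cuts the samples into $\lfloor m_1/p\rfloor$ batches of $p$ samples. In each batch it solves the $p\times p$ linear system $X\widetilde A=(Y^{(1)},\dots,Y^{(p)})^\top$, where the rows of $X$ are the values of the parents of $Y$ in the $p$ samples (on singular systems, which have probability $0$, it may return anything). The coefficient estimates $\widehat A$ are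 the coordinatewise medians of the batch solutions. From the last $m_2$ samples it then estimates the variance at every node $Y$ (with or without parents) by the mean of $(Y-X\widehat A)^2$, where $X$ is the row vector of the values of the parents. The estimated parameters define a Gaussian Bayesian network $\mathcal Q$ over $G$. **Theorem.** There are an absolute constant $C$ and constants $K_\omega$, depending only on $\omega$, such that for all such $n,G,d$ and all $\varepsilon,\delta\in(0,1)$ there are sample sizes $m_1,m_2$ with $$m_1+m_2\;\le\; C\,\frac{nDd}{\varepsilon^2}\log\frac{n}{\varepsilon\delta}$$ for which the following holds. 1. For every Gaussian Bayesian network $\mathcal P$ over $G$, if the algorithm is run with $m_1$ and $m_2$ independent samples from $\mathcal P$ (or with larger numbers of samples), then with probability at least $1-\delta$ it returns $\mathcal Q$ with $d_{TV}(\mathcal P,\mathcal Q)\le\varepsilon$. Moreover, for every node $y$, every parent $j$ of $y$ and every batch, the $j$-th coordinate of the batch error $\widetilde A-A$, where $A=(a_{y\leftarrow j})_j$, has the distribution $\frac{\sigma_y}{\sqrt{\operatorname{Var}X_j}}\cdot\mathrm{Cauchy}(0,1)$. 2. For every $\omega\ge2$ such that real $p\times p$ matrices can be multiplied in $O(p^\omega)$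 steps, the algorithm with sample sizes $m_1,m_2$ (and a suitable method for nonsingular linear systems) can be carried out in at most $$K_\omega\,\frac{n^2D^2d^{\,\omega-1}}{\varepsilon^2}\log\frac n\delta$$ steps. Here a step is an arithmetic operation, a comparison, or the loading of a rational constant, in an algebraic computation tree over the reals, and the count is for the worst case. -/

import Mathlib

open MeasureTheory ProbabilityTheory

noncomputable section

/-! ### Polytrees -/

namespace PolyBN

variable {n : ℕ}

/-- A directed graph without directed cycles (in particular without loops). -/
def IsDAG (G : Digraph (Fin n)) : Prop :=
  ∀ v, ¬ Relation.TransGen G.Adj v v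

/-- A polytree: a DAG whose underlying undirected graph has no cycle (it need not be connected). -/
def IsPolytree (G : Digraph (Fin n)) : Prop :=
  IsDAG G ∧ G.toSimpleGraphInclusive.IsAcyclic

open Classical in
/-- The set of parents of `i`: all `j` with an edge from `j` to `i`. -/
def parents (G : Digraph (Fin n)) (i : Fin n) : Finset (Fin n) :=
  Finset.univ.filter fun j => G.Adj j i

/-- The number of parents of `i`. -/
def inDeg (G : Digraph (Fin n)) (i : Fin n) : ℕ := (parents G i).card

/-- The parents of `i`, enumerated as `parent G i 0, …, parent G i (inDeg G i - 1)`. -/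
def parent (G : Digraph (Fin n)) (i : Fin n) (r : Fin (inDeg G i)) : Fin n :=
  (parents G i).orderEmbOfFin rfl r

theorem adj_parent (G : Digraph (Fin n)) (i : Fin n) (r : Fin (inDeg G i)) :
    G.Adj (parent G i r) i := by
  have h : parent G i r ∈ parents G i := Finset.orderEmbOfFin_mem _ _ _
  simpa [parents] using h

/-- The average in-degree. -/
def avgInDeg (G : Digraph (Fin n)) : ℝ := (∑ i, (inDeg G i : ℝ)) / n

/-- The average in-degree, replaced by `1` if it is smaller than `1`. -/
def avgInDegOne (G : Digraph (Fin n)) : ℝ := max 1 (avgInDeg G)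

/-! ### Gaussian Bayesian networks -/

/-- Parameters of a Gaussian Bayesian network over `G`: the coefficient of every parent of every
node, and the variance of the noise at every node. -/
structure Params (G : Digraph (Fin n)) where
  coef : (i : Fin n) → Fin (inDeg G i) → ℝ
  noiseVar : Fin n → ℝ

namespace Params

variable {G : Digraph (Fin n)}

/-- The matrix of the coefficients: its `(i, j)` entry is the coefficient of `X_j` in the equation
of `X_i`, which is zero if `j` is not a parent of `i`. -/
def coefMatrix (θ : Params G) : Matrix (Fin n) (Fin n) ℝ :=
  Matrix.of fun i j => ∑ r, if parent G i r = j then θ.coef i r else 0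

/-- The values of the variables, as a function of the values `η` of the noises. On a DAG this is the
unique solution of the structural equations, see `structural_equation` and
`structural_equation_unique`. -/
def solution (θ : Params G) (η : Fin n → ℝ) : Fin n → ℝ :=
  (1 - θ.coefMatrix)⁻¹.mulVec η

/-- The joint distribution of `(X_1, …, X_n)`, where `X_i = η_i + ∑ a_{i ← j} X_j` (sum over the
parents `j` of `i`) with independent `η_i ∼ N(0, σ_i²)`. -/
def law (θ : Params G) : Measure (Fin n → ℝ) :=
  (Measure.pi fun i => gaussianReal 0 (θ.noiseVar i).toNNReal).map θ.solution

theorem coefMatrix_mulVec (θ : Params G) (x : Fin n → ℝ) (i : Fin n) :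
    θ.coefMatrix.mulVec x i = ∑ r, θ.coef i r * x (parent G i r) := by
  simp only [Matrix.mulVec, dotProduct, coefMatrix, Matrix.of_apply, Finset.sum_mul]
  rw [Finset.sum_comm]
  refine Finset.sum_congr rfl fun r _ => ?_
  simp

theorem eq_zero_of_homogeneous (hG : IsDAG G) (θ : Params G) (x : Fin n → ℝ)
    (hx : ∀ i, x i = ∑ r, θ.coef i r * x (parent G i r)) : x = 0 := by
  have hirr : Std.Irrefl (Relation.TransGen G.Adj) := ⟨hG⟩
  have hwf : WellFounded (Relation.TransGen G.Adj) := Finite.wellFounded_of_trans_of_irrefl _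
  funext i
  induction i using hwf.induction with
  | _ i ih =>
    rw [hx i]
    refine Finset.sum_eq_zero fun r _ => ?_
    rw [ih _ (Relation.TransGen.single (adj_parent G i r))]
    simp

theorem isUnit_det (hG : IsDAG G) (θ : Params G) : IsUnit (1 - θ.coefMatrix).det := by
  rw [isUnit_iff_ne_zero]
  intro h
  obtain ⟨v, hv, hv0⟩ := Matrix.exists_mulVec_eq_zero_iff.2 h
  refine hv (eq_zero_of_homogeneous hG θ v fun i => ?_)
  have := congrFun hv0 i
  rw [Matrix.sub_mulVec, Matrix.one_mulVec, Pi.sub_apply, coefMatrix_mulVec] at this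
  simpa [sub_eq_zero] using this

theorem structural_equation (hG : IsDAG G) (θ : Params G) (η : Fin n → ℝ) (i : Fin n) :
    θ.solution η i = η i + ∑ r, θ.coef i r * θ.solution η (parent G i r) := by
  have h : (1 - θ.coefMatrix).mulVec (θ.solution η) = η := by
    rw [solution, Matrix.mulVec_mulVec, Matrix.mul_nonsing_inv _ (isUnit_det hG θ),
      Matrix.one_mulVec]
  have := congrFun h i
  rw [Matrix.sub_mulVec, Matrix.one_mulVec, Pi.sub_apply, coefMatrix_mulVec] at this
  linarith

theorem structural_equation_unique (hG : IsDAG G) (θ : Params G) (η x : Fin n → ℝ)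
    (hx : ∀ i, x i = η i + ∑ r, θ.coef i r * x (parent G i r)) : x = θ.solution η := by
  rw [← sub_eq_zero]
  refine eq_zero_of_homogeneous hG θ _ fun i => ?_
  simp only [Pi.sub_apply, mul_sub, Finset.sum_sub_distrib]
  linarith [hx i, structural_equation hG θ η i]

end Params

/-- The total variation distance `sup_A |P(A) - Q(A)|` of two probability measures. -/
def tvDist {Ω : Type*} [MeasurableSpace Ω] (P Q : Measure Ω) : ℝ :=
  ⨆ A : {A : Set Ω // MeasurableSet A}, |P.real A - Q.real A|

/-! ### The algorithm -/

/-- The sample median: the middle value, or the mean of the two middle values. -/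
def median {k : ℕ} (v : Fin k → ℝ) : ℝ :=
  if h : 0 < k then
    (v (Tuple.sort v ⟨(k - 1) / 2, by omega⟩) + v (Tuple.sort v ⟨k / 2, by omega⟩)) / 2
  else 0

/-- A method for square linear systems. -/
abbrev LinSolver := (p : ℕ) → Matrix (Fin p) (Fin p) ℝ → (Fin p → ℝ) → Fin p → ℝ

/-- The method returns the solution of every nonsingular system; on singular systems, which occur
with probability zero here, it may return anything. -/
def LinSolver.IsCorrect (S : LinSolver) : Prop :=
  ∀ (p : ℕ) (X : Matrix (Fin p) (Fin p) ℝ) (b : Fin p → ℝ),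
    IsUnit X.det → X.mulVec (S p X b) = b

/-- The index of the `r`-th sample of the `s`-th batch, when `m` samples are cut into `m / p` batches
of `p` consecutive samples each. -/
def batchIdx {m p : ℕ} (s : Fin (m / p)) (r : Fin p) : Fin m :=
  ⟨s * p + r, by
    have h1 : (s : ℕ) + 1 ≤ m / p := s.2
    have h2 : m / p * p ≤ m := Nat.div_mul_le_self m p
    have h3 : ((s : ℕ) + 1) * p ≤ m / p * p := Nat.mul_le_mul_right p h1
    have h4 := r.2
    rw [Nat.add_mul, Nat.one_mul] at h3
    omega⟩

variable (S : LinSolver) (G : Digraph (Fin n))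

/-- The batch estimate of the coefficients of the node `y` with `p` parents: the solution of the
`p × p` system whose rows are the values of the parents in the `p` samples of the batch `s`, and
whose right hand side holds the values of `y`. -/
def batchEstimate {m : ℕ} (x : Fin m → Fin n → ℝ) (y : Fin n) (s : Fin (m / inDeg G y)) :
    Fin (inDeg G y) → ℝ :=
  S (inDeg G y) (Matrix.of fun r c => x (batchIdx s r) (parent G y c))
    (fun r => x (batchIdx s r) y)

/-- `CauchyEstTree`: the coordinatewise medians of the batch estimates. -/
def cauchyEstTree {m : ℕ} (x : Fin m → Fin n → ℝ) (y : Fin n) : Fin (inDeg G y) → ℝ :=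
  fun c => median fun s => batchEstimate S G x y s c

/-- `VarianceRecovery`: the mean of the squares `(Y - X Â)²` over the samples. -/
def varianceRecovery {m : ℕ} (Ahat : (i : Fin n) → Fin (inDeg G i) → ℝ) (x : Fin m → Fin n → ℝ)
    (y : Fin n) : ℝ :=
  (∑ s, (x s y - ∑ c, x s (parent G y c) * Ahat y c) ^ 2) / m

/-- The two-phased algorithm: the coefficients from the first `m₁` samples by `CauchyEstTree`, and
then the variances from the last `m₂` samples. -/
def twoPhase {m₁ m₂ : ℕ} (x : Fin (m₁ + m₂) → Fin n → ℝ) : Params G where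
  coef := cauchyEstTree S G fun s => x (Fin.castAdd m₂ s)
  noiseVar := varianceRecovery G (cauchyEstTree S G fun s => x (Fin.castAdd m₂ s))
    fun s => x (Fin.natAdd m₁ s)

end PolyBN

/-! ### Running time: algebraic computation trees -/

/-- The arithmetic operations. -/
inductive ArithOp
  | add | sub | mul | div

/-- The value of an arithmetic operation. -/
def ArithOp.apply : ArithOp → ℝ → ℝ → ℝ
  | .add, a, b => a + b
  | .sub, a, b => a - b
  | .mul, a, b => a * b
  | .div, a, b => a / b

/-- Algebraic computation trees over the reals. A tree in `CompTree κ ι` starts with one real number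
in each register `i : ι`. It can load a rational constant into a new register, apply an arithmetic
operation to two registers and put the result into a new register, branch on a comparison of two
registers, or stop and return for each `k : κ` the content of a register. The new register is always
`none : Option ι`. -/
inductive CompTree (κ : Type) : Type → Type 1
  | ret {ι : Type} (out : κ → ι) : CompTree κ ι
  | const {ι : Type} (q : ℚ) (t : CompTree κ (Option ι)) : CompTree κ ι
  | arith {ι : Type} (o : ArithOp) (a b : ι) (t : CompTree κ (Option ι)) : CompTree κ ι
  | branch {ι : Type} (a b : ι) (t e : CompTree κ ι) : CompTree κ ι

namespace CompTree

variable {κ : Type}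

/-- The output of a computation tree, given the contents `v` of the registers. -/
def eval : {ι : Type} → CompTree κ ι → (ι → ℝ) → κ → ℝ
  | _, ret out, v => fun k => v (out k)
  | _, const q t, v => t.eval fun i => i.elim (q : ℝ) v
  | _, arith o a b t, v => t.eval fun i => i.elim (o.apply (v a) (v b)) v
  | _, branch a b t e, v => open Classical in if v a ≤ v b then t.eval v else e.eval v

/-- The number of steps in the worst case: the largest number of constants, arithmetic operations
and comparisons on a path. -/
def cost : {ι : Type} → CompTree κ ι → ℕ
  | _, ret _ => 0
  | _, const _ t => t.cost + 1
  | _, arith _ _ _ t => t.cost + 1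
  | _, branch _ _ t e => max t.cost e.cost + 1

end CompTree

/-- Real `p × p` matrices can be multiplied in `O(p ^ ω)` steps, for all `p`. -/
def MatMulInTime (ω : ℝ) : Prop :=
  ∃ c : ℝ, ∀ p : ℕ, ∃ t : CompTree (Fin p × Fin p) ((Fin p × Fin p) ⊕ (Fin p × Fin p)),
    (∀ A B : Matrix (Fin p) (Fin p) ℝ,
      t.eval (Sum.elim (fun q => A q.1 q.2) (fun q => B q.1 q.2)) = fun q => (A * B) q.1 q.2) ∧
    (t.cost : ℝ) ≤ c * (p : ℝ) ^ ω

/-- The tree `t` gets `m₁ + m₂` samples of `n` variables as its input and returns all coefficients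
and variances that the two-phased algorithm with the linear solver `S` returns on these samples. -/
def ComputesTwoPhase {n m₁ m₂ : ℕ} (S : PolyBN.LinSolver) (G : Digraph (Fin n))
    (t : CompTree ((Σ i : Fin n, Fin (PolyBN.inDeg G i)) ⊕ Fin n) (Fin (m₁ + m₂) × Fin n)) : Prop :=
  ∀ x : Fin (m₁ + m₂) → Fin n → ℝ,
    t.eval (fun q => x q.1 q.2) =
      Sum.elim (fun e => (PolyBN.twoPhase S G x).coef e.1 e.2)
        (fun i => (PolyBN.twoPhase S G x).noiseVar i)

end

/-!
In a polytree, two parents of a node `y` have no common ancestor, since otherwise an edge into `y`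
would lie on an undirected cycle (`IsPolytree.not_common_ancestor`). So the values of the parents of
`y` and the noise at `y` are independent centered Gaussian variables (`Params.map_family_law`), and
the error of a batch solves a linear system with independent Gaussian entries. By Cramer's rule, its
coordinate `j` is a quotient of two linear forms, in the noises and in the column of the parent `j`,
with the same coefficients: the cofactors, which depend on the other columns only. Given those, the
quotient has the distribution `σ_y / sqrt (Var X_j) · Cauchy(0, 1)`, whatever the cofactors are
(`map_cramerSol`).

A Cauchy variable has no expectation, but medians of independent ones concentrate: by Hoeffding's
inequality, the median of `k` batches has an error of at most `t σ_y / sqrt (Var X_j)`, except with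
probability `2 exp (-k t² / 32)` (`measure_median_cauchy_le`). Given the estimated coefficients, the
residuals at `y` in the last samples are independent centered Gaussian variables with some variance
`τ²`, and the estimated variance is `τ²` up to a relative error `u`, except with probability
`2 exp (-m₂ u² / 8)` (`measure_mean_sq_gaussianReal_le`). The density of a network is the product of
the densities of its residuals, as `det (1 - A) = 1` for the matrix `A` of coefficients. The
Kullback-Leibler divergence between the two networks is therefore a sum over the nodes, of terms at
most `u² + p t² / 2` for `p` parents (`Params.IsAccurate.integral_logRatio_le`). With `t² = ε² / (n D)`
and `u² = ε² / (4 n)`, the sum is below `2 ε²`, and Pinsker's inequality bounds the total variation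
distance by `ε`. The sample sizes result from a union bound over at most `n²` coefficients and `n`
variances (`Params.measure_not_isAccurate_le`).

For the running time, linear systems are solved in `O(p ^ ω)` steps by the normal equations: these
have a positive definite matrix, which is inverted by recursion with Schur complements
(`exists_solver`). Medians are found in linear time by the median of medians of groups of five
(`finds_isRank`). A node with `p` parents then costs a multiple of `p d ^ (ω - 2) m₁`, and the sum of
`p` over all nodes is at most `n D` (`exists_tree_twoPhase_cost_le`).
-/

open scoped NNReal ENNReal

noncomputable section

/-! ### Composing computation trees -/

namespace CompTree

variable {κ κ' ι ι' : Type}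

/-- Renaming the input registers of a tree. -/
def reindex : {ι ι' : Type} → (ι → ι') → CompTree κ ι → CompTree κ ι'
  | _, _, g, ret out => ret (g ∘ out)
  | _, _, g, const q t => const q (t.reindex (Option.map g))
  | _, _, g, arith o a b t => arith o (g a) (g b) (t.reindex (Option.map g))
  | _, _, g, branch a b t e => branch (g a) (g b) (t.reindex g) (e.reindex g)

/-- Running `s` after `t`. The registers of `s` are some registers `emb i` of `t`, and the outputs
of `t`. -/
def bind {ι₀ : Type} (s : CompTree κ' (ι₀ ⊕ κ)) :
    {ι : Type} → CompTree κ ι → (ι₀ → ι) → CompTree κ' ι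
  | _, ret out, emb => s.reindex (Sum.elim emb out)
  | _, const q t, emb => const q (bind s t (some ∘ emb))
  | _, arith o a b t, emb => arith o a b (bind s t (some ∘ emb))
  | _, branch a b t e, emb => branch a b (bind s t emb) (bind s e emb)

theorem eval_reindex {ι : Type} (t : CompTree κ ι) :
    ∀ {ι' : Type} (g : ι → ι') (v : ι' → ℝ), (t.reindex g).eval v = t.eval (v ∘ g) := by
  induction t with
  | ret out => intros; rfl
  | const q t ih =>
    intro ι' g v
    simp only [reindex, eval, ih]
    congr 1; funext i; cases i <;> rfl
  | arith o a b t ih =>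
    intro ι' g v
    simp only [reindex, eval, ih]
    congr 1; funext i; cases i <;> rfl
  | branch a b t e iht ihe =>
    intro ι' g v
    simp only [reindex, eval, iht, ihe, Function.comp]

theorem cost_reindex {ι : Type} (t : CompTree κ ι) :
    ∀ {ι' : Type} (g : ι → ι'), (t.reindex g).cost = t.cost := by
  induction t with
  | ret out => intros; rfl
  | const q t ih => intros; simp only [reindex, cost, ih]
  | arith o a b t ih => intros; simp only [reindex, cost, ih]
  | branch a b t e iht ihe => intros; simp only [reindex, cost, iht, ihe]

theorem eval_bind {ι₀ ι : Type} (s : CompTree κ' (ι₀ ⊕ κ)) (t : CompTree κ ι) :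
    ∀ (emb : ι₀ → ι) (v : ι → ℝ),
      (bind s t emb).eval v = s.eval (Sum.elim (v ∘ emb) (t.eval v)) := by
  induction t with
  | ret out =>
    intro emb v
    simp only [bind, eval_reindex]
    congr 1; funext i; cases i <;> rfl
  | const q t ih => intro emb v; simp only [bind, eval, ih]; rfl
  | arith o a b t ih => intro emb v; simp only [bind, eval, ih]; rfl
  | branch a b t e iht ihe =>
    intro emb v
    simp only [bind, eval, iht, ihe]
    split_ifs <;> rfl

theorem cost_bind {ι₀ ι : Type} (s : CompTree κ' (ι₀ ⊕ κ)) (t : CompTree κ ι) :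
    ∀ emb : ι₀ → ι, (bind s t emb).cost = t.cost + s.cost := by
  induction t with
  | ret out => intro emb; simp [bind, cost, cost_reindex]
  | const q t ih => intro emb; simp only [bind, cost, ih]; omega
  | arith o a b t ih => intro emb; simp only [bind, cost, ih]; omega
  | branch a b t e iht ihe => intro emb; simp only [bind, cost, iht, ihe]; omega

end CompTree

/-- The function `f` can be computed by a computation tree in at most `c` steps. -/
def Computes {κ ι : Type} (f : (ι → ℝ) → κ → ℝ) (c : ℕ) : Prop :=
  ∃ t : CompTree κ ι, (∀ v, t.eval v = f v) ∧ t.cost ≤ c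

/-- The real-valued function `f` can be computed by a computation tree in at most `c` steps. -/
def ComputesVal {ι : Type} (f : (ι → ℝ) → ℝ) (c : ℕ) : Prop :=
  Computes (fun v (_ : Unit) => f v) c

namespace Computes

variable {κ κ' ι ι' : Type}

theorem mono {f : (ι → ℝ) → κ → ℝ} {c c' : ℕ} (h : Computes f c) (hc : c ≤ c') :
    Computes f c' := by
  obtain ⟨t, ht, htc⟩ := h
  exact ⟨t, ht, htc.trans hc⟩

theorem congr {f g : (ι → ℝ) → κ → ℝ} {c : ℕ} (h : Computes f c) (hfg : ∀ v k, f v k = g v k) :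
    Computes g c := by
  obtain ⟨t, ht, htc⟩ := h
  exact ⟨t, fun v => (ht v).trans (funext (hfg v)), htc⟩

theorem proj (out : κ → ι) : Computes (fun v k => v (out k)) 0 :=
  ⟨.ret out, fun _ => rfl, le_rfl⟩

theorem of_isEmpty [IsEmpty κ] (f : (ι → ℝ) → κ → ℝ) (c : ℕ) : Computes f c :=
  ⟨.ret isEmptyElim, fun _ => funext isEmptyElim, Nat.zero_le _⟩

/-- Composition, where the second function may use the original input as well. -/
theorem bind {f : (ι → ℝ) → κ → ℝ} {g : (ι ⊕ κ → ℝ) → κ' → ℝ} {c c' : ℕ}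
    (hf : Computes f c) (hg : Computes g c') :
    Computes (fun v => g (Sum.elim v (f v))) (c + c') := by
  obtain ⟨t, ht, htc⟩ := hf
  obtain ⟨s, hs, hsc⟩ := hg
  refine ⟨CompTree.bind s t id, fun v => ?_, ?_⟩
  · rw [CompTree.eval_bind, hs, ht]; rfl
  · rw [CompTree.cost_bind]; exact Nat.add_le_add htc hsc

theorem reindexIn {f : (ι → ℝ) → κ → ℝ} {c : ℕ} (hf : Computes f c) (g : ι → ι') :
    Computes (fun v => f (v ∘ g)) c := by
  obtain ⟨t, ht, htc⟩ := hf
  exact ⟨t.reindex g, fun v => by rw [CompTree.eval_reindex, ht], by rwa [CompTree.cost_reindex]⟩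

theorem comp {f : (ι → ℝ) → κ → ℝ} {g : (κ → ℝ) → κ' → ℝ} {c c' : ℕ}
    (hg : Computes g c') (hf : Computes f c) : Computes (fun v => g (f v)) (c + c') :=
  hf.bind (hg.reindexIn Sum.inr)

theorem reindexOut {f : (ι → ℝ) → κ → ℝ} {c : ℕ} (hf : Computes f c) (g : κ' → κ) :
    Computes (fun v k => f v (g k)) c :=
  (proj g).comp hf

theorem pair {f : (ι → ℝ) → κ → ℝ} {g : (ι → ℝ) → κ' → ℝ} {c c' : ℕ}
    (hf : Computes f c) (hg : Computes g c') :
    Computes (fun v => Sum.elim (f v) (g v)) (c + c') := by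
  refine (hf.bind ((hg.reindexIn (ι' := ι ⊕ κ) Sum.inl).bind
    (proj (Sum.elim (fun k => Sum.inl (Sum.inr k)) (fun k => Sum.inr k))))).congr ?_
  rintro v (k | k) <;> rfl

/-- Finitely many computations on the same input, one after the other. -/
theorem sigma {J : Type} [Fintype J] :
    ∀ {κ : J → Type} {f : (j : J) → (ι → ℝ) → κ j → ℝ} {c : J → ℕ},
      (∀ j, Computes (f j) (c j)) → Computes (fun v (q : Σ j, κ j) => f q.1 v q.2) (∑ j, c j) := by
  refine Fintype.induction_empty_option (P := fun J _ => ∀ {κ : J → Type}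
    {f : (j : J) → (ι → ℝ) → κ j → ℝ} {c : J → ℕ}, (∀ j, Computes (f j) (c j)) →
      Computes (fun v (q : Σ j, κ j) => f q.1 v q.2) (∑ j, c j)) ?_ ?_ ?_ J
  · intro J J' _ e ih κ f c h
    have hsurj : ∀ q : Σ j, κ j, ∃ q' : Σ j, κ (e j), (⟨e q'.1, q'.2⟩ : Σ j, κ j) = q := by
      rintro ⟨j, k⟩
      obtain ⟨j, rfl⟩ := e.surjective j
      exact ⟨⟨j, k⟩, rfl⟩
    choose g hg using hsurj
    let _ : Fintype J := Fintype.ofEquiv J' e.symm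
    refine (((ih (κ := fun j => κ (e j)) (fun j => h (e j))).reindexOut g).congr ?_).mono ?_
    · intro v q
      conv_rhs => rw [← hg q]
    · exact (Equiv.sum_comp e c).le
  · intro κ f c _
    exact of_isEmpty _ _
  · intro J _ ih κ f c h
    have := ((h none).pair (ih (κ := fun j => κ (some j)) (fun j => h (some j)))).reindexOut
      (fun q : Σ j, κ j => match q with
        | ⟨none, k⟩ => Sum.inl k
        | ⟨some j, k⟩ => Sum.inr ⟨j, k⟩)
    refine (this.congr ?_).mono ?_
    · rintro v ⟨_ | j, k⟩ <;> rfl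
    · rw [Fintype.sum_option]

theorem pi_val [Fintype κ] {f : (ι → ℝ) → κ → ℝ} {c : κ → ℕ}
    (h : ∀ k, ComputesVal (fun v => f v k) (c k)) : Computes f (∑ k, c k) :=
  (sigma h).reindexOut fun k => ⟨k, ()⟩

end Computes

namespace ComputesVal

variable {ι : Type}

theorem var (i : ι) : ComputesVal (fun v => v i) 0 :=
  Computes.proj fun _ => i

theorem const (q : ℚ) : ComputesVal (fun _ : ι → ℝ => (q : ℝ)) 1 :=
  ⟨.const q (.ret fun _ => none), fun _ => rfl, by simp [CompTree.cost]⟩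

theorem arith (o : ArithOp) {f g : (ι → ℝ) → ℝ} {c c' : ℕ} (hf : ComputesVal f c)
    (hg : ComputesVal g c') : ComputesVal (fun v => o.apply (f v) (g v)) (c + c' + 1) := by
  refine (Computes.comp (κ := Unit ⊕ Unit) (g := fun v (_ : Unit) =>
    o.apply (v (Sum.inl ())) (v (Sum.inr ()))) ?_ (Computes.pair hf hg))
  exact ⟨.arith o (Sum.inl ()) (Sum.inr ()) (.ret fun _ => none), fun _ => rfl,
    by simp [CompTree.cost]⟩

theorem add {f g : (ι → ℝ) → ℝ} {c c' : ℕ} (hf : ComputesVal f c)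
    (hg : ComputesVal g c') : ComputesVal (fun v => f v + g v) (c + c' + 1) := arith .add hf hg

theorem sub {f g : (ι → ℝ) → ℝ} {c c' : ℕ} (hf : ComputesVal f c)
    (hg : ComputesVal g c') : ComputesVal (fun v => f v - g v) (c + c' + 1) := arith .sub hf hg

theorem mul {f g : (ι → ℝ) → ℝ} {c c' : ℕ} (hf : ComputesVal f c)
    (hg : ComputesVal g c') : ComputesVal (fun v => f v * g v) (c + c' + 1) := arith .mul hf hg

theorem div {f g : (ι → ℝ) → ℝ} {c c' : ℕ} (hf : ComputesVal f c)
    (hg : ComputesVal g c') : ComputesVal (fun v => f v / g v) (c + c' + 1) := arith .div hf hg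

theorem mono {f : (ι → ℝ) → ℝ} {c c' : ℕ} (h : ComputesVal f c) (hc : c ≤ c') :
    ComputesVal f c' :=
  Computes.mono h hc

theorem congr {f g : (ι → ℝ) → ℝ} {c : ℕ} (h : ComputesVal f c) (hfg : ∀ v, f v = g v) :
    ComputesVal g c :=
  Computes.congr h fun v _ => hfg v

/-- The sum starts with a constant `0`, which costs one step more. -/
theorem sum {J : Type} (s : Finset J) {f : J → (ι → ℝ) → ℝ} {c : ℕ}
    (h : ∀ j ∈ s, ComputesVal (f j) c) :
    ComputesVal (fun v => ∑ j ∈ s, f j v) (s.card * (c + 1) + 1) := by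
  classical
  induction s using Finset.induction_on with
  | empty => simpa using const (ι := ι) 0
  | insert j s hj ih =>
    refine (((h j (Finset.mem_insert_self j s)).add
      (ih fun k hk => h k (Finset.mem_insert_of_mem hk))).congr fun v => ?_).mono ?_
    · rw [Finset.sum_insert hj]
    · rw [Finset.card_insert_of_notMem hj, Nat.add_mul]; omega

end ComputesVal

/-! ### Inverting matrices with fast matrix multiplication -/

/-- The matrix-valued function `A` can be computed in at most `c` steps. -/
def ComputesMat {J J' ι : Type} (A : (ι → ℝ) → Matrix J J' ℝ) (c : ℕ) : Prop :=
  Computes (fun v (q : J × J') => A v q.1 q.2) c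

/-- Real `q × q` matrices can be multiplied in at most `μ` steps. -/
def MulCost (q μ : ℕ) : Prop :=
  ComputesMat (fun v : (Fin q × Fin q) ⊕ (Fin q × Fin q) → ℝ =>
    (Matrix.of fun i j => v (Sum.inl (i, j))) * (Matrix.of fun i j => v (Sum.inr (i, j)))) μ

namespace ComputesMat

variable {ι J : Type} {q : ℕ}

theorem var (a : J → J → ι) : ComputesMat (fun v : ι → ℝ => Matrix.of fun i j => v (a i j)) 0 :=
  Computes.proj fun q : J × J => a q.1 q.2

theorem mul {A B : (ι → ℝ) → Matrix (Fin q) (Fin q) ℝ} {a b μ : ℕ} (hμ : MulCost q μ)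
    (hA : ComputesMat A a) (hB : ComputesMat B b) :
    ComputesMat (fun v => A v * B v) (a + b + μ) :=
  Computes.comp hμ (Computes.pair hA hB)

theorem comp {J' J'' : Type} {F : Matrix J' J'' ℝ → Matrix J J ℝ} {A : (ι → ℝ) → Matrix J' J'' ℝ}
    {a b : ℕ} (hF : ComputesMat (fun v : J' × J'' → ℝ => F (Matrix.of fun i j => v (i, j))) b)
    (hA : ComputesMat A a) : ComputesMat (fun v => F (A v)) (a + b) :=
  Computes.comp hF hA

theorem sub {A B : (ι → ℝ) → Matrix (Fin q) (Fin q) ℝ} {a b : ℕ}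
    (hA : ComputesMat A a) (hB : ComputesMat B b) :
    ComputesMat (fun v => A v - B v) (a + b + q ^ 2) := by
  refine Computes.mono (Computes.comp (g := fun (w : (Fin q × Fin q) ⊕ (Fin q × Fin q) → ℝ) k =>
    w (Sum.inl k) - w (Sum.inr k)) (c' := q ^ 2) ?_ (Computes.pair hA hB)) le_rfl
  refine (Computes.pi_val fun k => (ComputesVal.var _).sub (ComputesVal.var _)).mono ?_
  simp [sq]

theorem add {A B : (ι → ℝ) → Matrix (Fin q) (Fin q) ℝ} {a b : ℕ}
    (hA : ComputesMat A a) (hB : ComputesMat B b) :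
    ComputesMat (fun v => A v + B v) (a + b + q ^ 2) := by
  refine Computes.mono (Computes.comp (g := fun (w : (Fin q × Fin q) ⊕ (Fin q × Fin q) → ℝ) k =>
    w (Sum.inl k) + w (Sum.inr k)) (c' := q ^ 2) ?_ (Computes.pair hA hB)) le_rfl
  refine (Computes.pi_val fun k => (ComputesVal.var _).add (ComputesVal.var _)).mono ?_
  simp [sq]

theorem neg {A : (ι → ℝ) → Matrix (Fin q) (Fin q) ℝ} {a : ℕ} (hA : ComputesMat A a) :
    ComputesMat (fun v => -A v) (a + 2 * q ^ 2) := by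
  refine Computes.mono (Computes.comp (g := fun (w : (Fin q × Fin q) → ℝ) k => - w k)
    (c' := 2 * q ^ 2) ?_ hA) le_rfl
  refine (Computes.pi_val fun k => (((ComputesVal.const 0).sub (ComputesVal.var k)).congr
    (g := fun v => - v k) ?_)).mono ?_
  · intro v; simp
  · simp [sq, mul_comm]

theorem fromBlocks {A B C D : (ι → ℝ) → Matrix (Fin q) (Fin q) ℝ} {a b c d : ℕ}
    (hA : ComputesMat A a) (hB : ComputesMat B b) (hC : ComputesMat C c) (hD : ComputesMat D d) :
    ComputesMat (fun v => Matrix.fromBlocks (A v) (B v) (C v) (D v)) (a + b + (c + d)) := by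
  refine ((Computes.pair (Computes.pair hA hB) (Computes.pair hC hD)).reindexOut
    (fun k : (Fin q ⊕ Fin q) × (Fin q ⊕ Fin q) => match k with
      | (.inl i, .inl j) => .inl (.inl (i, j))
      | (.inl i, .inr j) => .inl (.inr (i, j))
      | (.inr i, .inl j) => .inr (.inl (i, j))
      | (.inr i, .inr j) => .inr (.inr (i, j)))).congr ?_
  rintro v ⟨i | i, j | j⟩ <;> rfl

end ComputesMat

/-- Positive definite matrices with indices in `J` can be inverted in at most `c` steps. On other
matrices, the computation may return anything. -/
def InvCost (J : Type) [Fintype J] [DecidableEq J] (c : ℕ) : Prop :=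
  ∃ F : Matrix J J ℝ → Matrix J J ℝ, (∀ M, M.PosDef → F M = M⁻¹) ∧
    ComputesMat (fun v : J × J → ℝ => F (Matrix.of fun i j => v (i, j))) c

theorem InvCost.of_equiv {J J' : Type} [Fintype J] [DecidableEq J] [Fintype J'] [DecidableEq J']
    {c : ℕ} (h : InvCost J c) (e : J ≃ J') : InvCost J' c := by
  obtain ⟨F, hF, hFc⟩ := h
  refine ⟨fun M => (F (M.submatrix e e)).submatrix e.symm e.symm, fun M hM => ?_, ?_⟩
  · simp [hF _ (hM.submatrix e.injective), Matrix.inv_submatrix_equiv]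
  · exact (hFc.reindexIn (fun q : J × J => (e q.1, e q.2))).reindexOut
      fun q : J' × J' => (e.symm q.1, e.symm q.2)

theorem Matrix.PosDef.toBlocks₂₁_eq {q : Type} {M : Matrix (q ⊕ q) (q ⊕ q) ℝ} (hM : M.PosDef) :
    M.toBlocks₂₁ = M.toBlocks₁₂.conjTranspose := by
  ext i j
  exact (hM.1.apply (Sum.inr i) (Sum.inl j)).symm

/-- The Schur complement of the upper left block of a positive definite matrix is positive
definite. -/
theorem Matrix.PosDef.schur {q : Type} [Fintype q] [DecidableEq q] {M : Matrix (q ⊕ q) (q ⊕ q) ℝ}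
    (hM : M.PosDef) :
    (M.toBlocks₂₂ - M.toBlocks₂₁ * M.toBlocks₁₁⁻¹ * M.toBlocks₁₂).PosDef := by
  have hA : M.toBlocks₁₁.PosDef := hM.submatrix Sum.inl_injective
  let _ : Invertible M.toBlocks₁₁ := hA.isUnit.invertible
  have hM' := hM.det_pos
  rw [← Matrix.fromBlocks_toBlocks M, Matrix.det_fromBlocks₁₁, Matrix.invOf_eq_nonsing_inv] at hM'
  refine (Matrix.PosSemidef.posDef_iff_det_ne_zero ?_).2 (right_ne_zero_of_mul hM'.ne')
  have := hM.posSemidef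
  rw [← Matrix.fromBlocks_toBlocks M, hM.toBlocks₂₁_eq, Matrix.PosDef.fromBlocks₁₁ _ _ hA] at this
  rwa [hM.toBlocks₂₁_eq]

theorem Matrix.PosDef.inv_eq_fromBlocks {q : Type} [Fintype q] [DecidableEq q]
    {M : Matrix (q ⊕ q) (q ⊕ q) ℝ} (hM : M.PosDef) {P R : Matrix q q ℝ}
    (hP : P = M.toBlocks₁₁⁻¹) (hR : R = (M.toBlocks₂₂ - M.toBlocks₂₁ * P * M.toBlocks₁₂)⁻¹) :
    M⁻¹ = Matrix.fromBlocks (P + P * M.toBlocks₁₂ * R * M.toBlocks₂₁ * P)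
      (-(P * M.toBlocks₁₂ * R)) (-(R * M.toBlocks₂₁ * P)) R := by
  subst hP
  have hA : M.toBlocks₁₁.PosDef := hM.submatrix Sum.inl_injective
  let _ : Invertible M.toBlocks₁₁ := hA.isUnit.invertible
  have hM' := hM.isUnit
  rw [← Matrix.fromBlocks_toBlocks M] at hM'
  let _ := hM'.invertible
  let _ : Invertible (M.toBlocks₂₂ - M.toBlocks₂₁ * ⅟M.toBlocks₁₁ * M.toBlocks₁₂) :=
    (by rw [Matrix.invOf_eq_nonsing_inv]; exact hM.schur.isUnit : IsUnit _).invertible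
  have := Matrix.invOf_fromBlocks₁₁_eq M.toBlocks₁₁ M.toBlocks₁₂ M.toBlocks₂₁ M.toBlocks₂₂
  simp only [Matrix.invOf_eq_nonsing_inv, Matrix.fromBlocks_toBlocks] at this
  rw [hR]
  exact this

/-- One step of the recursion: two inversions of half the size, of the upper left block and of its
Schur complement. -/
theorem InvCost.double {q c μ : ℕ} (hμ : MulCost q μ) (h : InvCost (Fin q) c) :
    InvCost (Fin q ⊕ Fin q) (2 * c + 10 * μ + 10 * q ^ 2) := by
  obtain ⟨F, hF, hFc⟩ := h
  let P : Matrix (Fin q ⊕ Fin q) (Fin q ⊕ Fin q) ℝ → Matrix (Fin q) (Fin q) ℝ :=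
    fun M => F M.toBlocks₁₁
  let R : Matrix (Fin q ⊕ Fin q) (Fin q ⊕ Fin q) ℝ → Matrix (Fin q) (Fin q) ℝ :=
    fun M => F (M.toBlocks₂₂ - M.toBlocks₂₁ * P M * M.toBlocks₁₂)
  refine ⟨fun M => Matrix.fromBlocks (P M + P M * M.toBlocks₁₂ * R M * M.toBlocks₂₁ * P M)
      (-(P M * M.toBlocks₁₂ * R M)) (-(R M * M.toBlocks₂₁ * P M)) (R M), fun M hM => ?_, ?_⟩
  · have hP : P M = M.toBlocks₁₁⁻¹ := hF _ (hM.submatrix Sum.inl_injective)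
    have hR : R M = (M.toBlocks₂₂ - M.toBlocks₂₁ * P M * M.toBlocks₁₂)⁻¹ :=
      hF _ (by rw [hP]; exact hM.schur)
    exact (hM.inv_eq_fromBlocks hP hR).symm
  · -- the registers: the input matrix, its inverted upper left block, the inverted Schur complement
    let I₀ : Type := (Fin q ⊕ Fin q) × (Fin q ⊕ Fin q)
    let I₁ : Type := I₀ ⊕ (Fin q × Fin q)
    let I₂ : Type := I₁ ⊕ (Fin q × Fin q)
    have h₁ : ComputesMat (fun v : I₀ → ℝ =>
        F (Matrix.of fun i j => v (Sum.inl i, Sum.inl j))) (0 + c) :=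
      hFc.comp (ComputesMat.var fun i j => (Sum.inl i, Sum.inl j))
    have hv₁ := fun a b : Fin q → Fin q ⊕ Fin q => ComputesMat.var fun (i j : Fin q) =>
        (Sum.inl (a i, b j) : I₁)
    have h₂ := hFc.comp ((hv₁ .inr .inr).sub (((hv₁ .inr .inl).mul hμ
      (ComputesMat.var fun (i j : Fin q) => (Sum.inr (i, j) : I₁))).mul hμ (hv₁ .inl .inr)))
    have hv₂ := fun a b : Fin q → Fin q ⊕ Fin q => ComputesMat.var fun (i j : Fin q) =>
        (Sum.inl (Sum.inl (a i, b j)) : I₂)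
    have hP := ComputesMat.var fun (i j : Fin q) => (Sum.inl (Sum.inr (i, j)) : I₂)
    have hR := ComputesMat.var fun (i j : Fin q) => (Sum.inr (i, j) : I₂)
    have hPB := ((hP.mul hμ (hv₂ .inl .inr)).mul hμ hR)
    have h₃ := (hP.add ((hPB.mul hμ (hv₂ .inr .inl)).mul hμ hP)).fromBlocks hPB.neg
      ((hR.mul hμ (hv₂ .inr .inl)).mul hμ hP).neg hR
    exact (Computes.mono (Computes.bind h₁ (Computes.bind h₂ h₃)) (by ring_nf; omega))

theorem InvCost.unit : InvCost (Fin 1) 2 := by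
  refine ⟨fun M => Matrix.of fun i j => 1 / M i j, fun M hM => ?_, ?_⟩
  · have h : M 0 0 ≠ 0 := by simpa using hM.det_pos.ne'
    refine (Matrix.inv_eq_right_inv ?_).symm
    ext i j
    fin_cases i; fin_cases j
    simp [Matrix.mul_apply, h]
  · refine (Computes.pi_val (c := fun _ => 2) fun k => ?_).mono (by simp)
    exact ((ComputesVal.const 1).div (ComputesVal.var k)).congr fun v => by simp

/-- The recursion `T(2q) ≤ 2 T(q) + O(q ^ ω)` leads to `T(q) = O(q ^ ω)`, because `2 ^ ω ≥ 4`
exceeds the number of recursive calls. -/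
theorem exists_invCost {ω c : ℝ} (hω : 2 ≤ ω) (hc : 0 ≤ c)
    (hμ : ∀ q : ℕ, ∃ μ : ℕ, MulCost q μ ∧ (μ : ℝ) ≤ c * (q : ℝ) ^ ω) (k : ℕ) :
    ∃ a : ℕ, InvCost (Fin (2 ^ k)) a ∧ (a : ℝ) ≤ (5 * c + 5) * ((2 ^ k : ℕ) : ℝ) ^ ω := by
  induction k with
  | zero => exact ⟨2, InvCost.unit, by simp; linarith⟩
  | succ k ih =>
    obtain ⟨a, ha, hab⟩ := ih
    obtain ⟨μ, hμ, hμb⟩ := hμ (2 ^ k)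
    refine ⟨_, (ha.double hμ).of_equiv (finSumFinEquiv.trans (finCongr (by ring))), ?_⟩
    have h2 : (4 : ℝ) ≤ 2 ^ ω := by
      calc (4 : ℝ) = 2 ^ (2 : ℝ) := by norm_num
        _ ≤ 2 ^ ω := Real.rpow_le_rpow_of_exponent_le one_le_two hω
    have hq : (((2 ^ k : ℕ) : ℝ)) ^ 2 ≤ ((2 ^ k : ℕ) : ℝ) ^ ω := by
      rw [← Real.rpow_natCast]
      exact Real.rpow_le_rpow_of_exponent_le (by exact_mod_cast Nat.one_le_two_pow)
        (by exact_mod_cast hω)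
    have hpow : ((2 ^ (k + 1) : ℕ) : ℝ) ^ ω = 2 ^ ω * ((2 ^ k : ℕ) : ℝ) ^ ω := by
      rw [← Real.mul_rpow (by norm_num) (by positivity)]
      congr 1
      push_cast; ring
    have hpos : 0 ≤ ((2 ^ k : ℕ) : ℝ) ^ ω := by positivity
    rw [hpow]
    set x := ((2 ^ k : ℕ) : ℝ) ^ ω
    rw [Nat.cast_add, Nat.cast_add, Nat.cast_mul, Nat.cast_mul, Nat.cast_mul,
      Nat.cast_pow (2 ^ k) 2]
    have : (5 * c + 5) * (4 * x) ≤ (5 * c + 5) * (2 ^ ω * x) := by gcongr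
    push_cast at hab hμb hq this ⊢
    nlinarith

/-- Linear systems `X z = b` via the normal equations `XᵀX z = Xᵀb`, after padding `X` with an
identity matrix to a size that is a power of two. The normal equations make the matrix to be
inverted positive definite, so that no pivoting is necessary. -/
theorem exists_solver_of_size {ω c : ℝ} (hω : 2 ≤ ω) (hc : 0 ≤ c)
    (hμ : ∀ q : ℕ, ∃ μ : ℕ, MulCost q μ ∧ (μ : ℝ) ≤ c * (q : ℝ) ^ ω) (p : ℕ) :
    ∃ S : Matrix (Fin p) (Fin p) ℝ → (Fin p → ℝ) → Fin p → ℝ,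
      (∀ (X : Matrix (Fin p) (Fin p) ℝ) (b : Fin p → ℝ), IsUnit X.det → X.mulVec (S X b) = b) ∧
      ∃ a : ℕ, Computes (fun v : (Fin p × Fin p) ⊕ Fin p → ℝ =>
          S (Matrix.of fun i j => v (Sum.inl (i, j))) (fun i => v (Sum.inr i))) a ∧
        (a : ℝ) ≤ ((8 * c + 9) * 2 ^ ω) * (p : ℝ) ^ ω := by
  rcases Nat.eq_zero_or_pos p with rfl | hp
  · exact ⟨fun _ _ => 0, fun X b _ => Subsingleton.elim _ _, 0, Computes.of_isEmpty _ _, by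
      simpa using by positivity⟩
  set k := Nat.clog 2 p
  obtain ⟨a, ⟨F, hF, hFc⟩, hab⟩ := exists_invCost hω hc hμ k
  obtain ⟨μ, hμ, hμb⟩ := hμ (2 ^ k)
  have hpq : p ≤ 2 ^ k := Nat.le_pow_clog one_lt_two p
  have hqp : 2 ^ k ≤ 2 * p := by
    rcases Nat.lt_or_ge p 2 with h | h
    · have : k = 0 := Nat.clog_of_right_le_one (by omega) 2
      rw [this]; omega
    · have := Nat.pow_pred_clog_lt_self one_lt_two h
      have hk : 0 < k := Nat.clog_pos one_lt_two h
      obtain ⟨l, hl⟩ : ∃ l, k = l + 1 := ⟨k - 1, by omega⟩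
      rw [show Nat.clog 2 p = l + 1 from hl] at this
      rw [hl, pow_succ]
      simp at this
      omega
  generalize hq : 2 ^ k = q at *
  have hq0 : 0 < q := hp.trans_le hpq
  let e : Fin p ⊕ Fin (q - p) ≃ Fin q := finSumFinEquiv.trans (finCongr (by omega))
  let pad : Matrix (Fin p) (Fin p) ℝ → Matrix (Fin q) (Fin q) ℝ := fun X =>
    (Matrix.fromBlocks X 0 0 1).submatrix e.symm e.symm
  let rhs : (Fin p → ℝ) → Matrix (Fin q) (Fin q) ℝ := fun b =>
    Matrix.of fun i _ => (Sum.elim b 0 : _ → ℝ) (e.symm i)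
  refine ⟨fun X b i => (F ((pad X).transpose * pad X) * (pad X).transpose * rhs b)
    (e (Sum.inl i)) ⟨0, hq0⟩, fun X b hX => ?_, ?_⟩
  · have hdet : (pad X).det = X.det := by
      rw [Matrix.det_submatrix_equiv_self, Matrix.det_fromBlocks_zero₂₁]
      simp
    have hu : IsUnit (pad X).det := hdet ▸ hX
    have hpd : ((pad X).transpose * pad X).PosDef := by
      rw [← Matrix.conjTranspose_eq_transpose_of_trivial]
      exact Matrix.PosDef.conjTranspose_mul_self _
        (Matrix.mulVec_injective_of_isUnit ((Matrix.isUnit_iff_isUnit_det _).2 hu))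
    have hsol : pad X * (F ((pad X).transpose * pad X) * (pad X).transpose * rhs b) = rhs b := by
      rw [hF _ hpd, Matrix.mul_inv_rev, ← Matrix.mul_assoc, ← Matrix.mul_assoc, ← Matrix.mul_assoc,
        Matrix.mul_nonsing_inv _ hu, Matrix.one_mul,
        Matrix.nonsing_inv_mul _ (by rwa [Matrix.det_transpose]), Matrix.one_mul]
    set Z := F ((pad X).transpose * pad X) * (pad X).transpose * rhs b
    funext i
    have := congrFun (congrFun hsol (e (Sum.inl i))) ⟨0, hq0⟩
    rw [Matrix.mul_apply, ← e.sum_comp, Fintype.sum_sum_type] at this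
    simp only [pad, rhs, Matrix.submatrix_apply, Equiv.symm_apply_apply, Matrix.fromBlocks_apply₁₁,
      Matrix.fromBlocks_apply₁₂, Matrix.zero_apply, zero_mul, Finset.sum_const_zero, add_zero,
      Matrix.of_apply, Sum.elim_inl] at this
    exact this
  · have hpad : ComputesMat (fun v : (Fin p × Fin p) ⊕ Fin p → ℝ =>
        pad (Matrix.of fun i j => v (Sum.inl (i, j)))) (q ^ 2) := by
      refine (Computes.pi_val (c := fun _ => 1) fun k => ?_).mono (by simp [sq])
      obtain ⟨i, j⟩ := k
      obtain ⟨i, rfl⟩ := e.surjective i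
      obtain ⟨j, rfl⟩ := e.surjective j
      rcases i with i | i <;> rcases j with j | j
      · exact ((ComputesVal.var (Sum.inl (i, j))).mono zero_le_one).congr fun v => by simp [pad]
      · exact (ComputesVal.const 0).congr fun v => by simp [pad]
      · exact (ComputesVal.const 0).congr fun v => by simp [pad]
      · exact (ComputesVal.const (if i = j then 1 else 0)).congr fun v => by
          simp only [pad, Matrix.submatrix_apply, Equiv.symm_apply_apply,
            Matrix.fromBlocks_apply₂₂, Matrix.one_apply]
          split_ifs <;> simp
    have hpadT : ComputesMat (fun v : (Fin p × Fin p) ⊕ Fin p → ℝ =>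
        (pad (Matrix.of fun i j => v (Sum.inl (i, j)))).transpose) (q ^ 2) :=
      hpad.reindexOut fun k : Fin q × Fin q => (k.2, k.1)
    have hrhs : ComputesMat (fun v : (Fin p × Fin p) ⊕ Fin p → ℝ =>
        rhs (fun i => v (Sum.inr i))) (q ^ 2) := by
      refine (Computes.pi_val (c := fun _ => 1) fun k => ?_).mono (by simp [sq])
      obtain ⟨i, j⟩ := k
      obtain ⟨i, rfl⟩ := e.surjective i
      rcases i with i | i
      · exact ((ComputesVal.var (Sum.inr i)).mono zero_le_one).congr fun v => by simp [rhs]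
      · exact (ComputesVal.const 0).congr fun v => by simp [rhs]
    refine ⟨_, (((hFc.comp (hpadT.mul hμ hpad)).mul hμ hpadT).mul hμ hrhs).reindexOut
      fun i => (e (Sum.inl i), ⟨0, hq0⟩), ?_⟩
    have h1 : (1 : ℝ) ≤ q := by exact_mod_cast hq0
    have h2 : (q : ℝ) ^ 2 ≤ (q : ℝ) ^ ω := by
      rw [← Real.rpow_natCast]
      exact Real.rpow_le_rpow_of_exponent_le h1 (by exact_mod_cast hω)
    have h3 : (q : ℝ) ^ ω ≤ 2 ^ ω * (p : ℝ) ^ ω := by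
      rw [← Real.mul_rpow (by norm_num) (by positivity)]
      exact Real.rpow_le_rpow (by positivity) (by exact_mod_cast hqp) (by linarith)
    calc _ ≤ (8 * c + 9) * (q : ℝ) ^ ω := by push_cast; linarith
      _ ≤ _ := by rw [mul_assoc]; gcongr

/-- If matrices can be multiplied in `O(p ^ ω)` steps, linear systems can be solved in `O(p ^ ω)`
steps. -/
theorem exists_solver {ω : ℝ} (hω : 2 ≤ ω) (h : MatMulInTime ω) :
    ∃ K : ℝ, 0 ≤ K ∧ ∃ S : PolyBN.LinSolver, S.IsCorrect ∧ ∀ p : ℕ, ∃ a : ℕ,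
      Computes (fun v : (Fin p × Fin p) ⊕ Fin p → ℝ =>
          S p (Matrix.of fun i j => v (Sum.inl (i, j))) (fun i => v (Sum.inr i))) a ∧
        (a : ℝ) ≤ K * (p : ℝ) ^ ω := by
  obtain ⟨c, hc⟩ := h
  have hμ : ∀ q : ℕ, ∃ μ : ℕ, MulCost q μ ∧ (μ : ℝ) ≤ max c 0 * (q : ℝ) ^ ω := by
    intro q
    obtain ⟨t, ht, htc⟩ := hc q
    refine ⟨t.cost, ⟨t, fun v => ?_, le_rfl⟩, htc.trans (by gcongr; exact le_max_left _ _)⟩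
    refine Eq.trans ?_ (ht (Matrix.of fun i j => v (Sum.inl (i, j)))
      (Matrix.of fun i j => v (Sum.inr (i, j))))
    congr 1
    funext k
    rcases k with k | k <;> rfl
  choose S hS hcost using exists_solver_of_size hω (le_max_right c 0) hμ
  exact ⟨_, by positivity, S, hS, hcost⟩

/-! ### Selection in linear time -/

/-- Comparison trees: they compare real numbers `v i`, `v j` with indices `i j : ι` and return an
element of `α`. -/
inductive CmpTree (ι α : Type) : Type
  | leaf (a : α) : CmpTree ι α
  | node (i j : ι) (t e : CmpTree ι α) : CmpTree ι α

namespace CmpTree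

variable {ι α β : Type}

open Classical in
/-- The result of a comparison tree on the numbers `v`. -/
def run (v : ι → ℝ) : CmpTree ι α → α
  | leaf a => a
  | node i j t e => if v i ≤ v j then t.run v else e.run v

/-- The largest number of comparisons on a path. -/
def depth : CmpTree ι α → ℕ
  | leaf _ => 0
  | node _ _ t e => max t.depth e.depth + 1

/-- Continuing with a comparison tree that depends on the result. -/
def bind (f : α → CmpTree ι β) : CmpTree ι α → CmpTree ι β
  | leaf a => f a
  | node i j t e => node i j (t.bind f) (e.bind f)

theorem run_bind (f : α → CmpTree ι β) (v : ι → ℝ) (t : CmpTree ι α) :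
    (t.bind f).run v = (f (t.run v)).run v := by
  induction t with
  | leaf a => rfl
  | node i j t e iht ihe => simp only [bind, run, iht, ihe]; split_ifs <;> rfl

theorem depth_bind_le (f : α → CmpTree ι β) (c : ℕ) (hf : ∀ a, (f a).depth ≤ c)
    (t : CmpTree ι α) : (t.bind f).depth ≤ t.depth + c := by
  induction t with
  | leaf a => simpa [bind, depth] using hf a
  | node i j t e iht ihe => simp only [bind, depth]; omega

/-- The computation tree that returns the number whose index a comparison tree finds. -/
def toCompTree : CmpTree ι ι → CompTree Unit ι
  | leaf a => .ret fun _ => a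
  | node i j t e => .branch i j t.toCompTree e.toCompTree

theorem eval_toCompTree (t : CmpTree ι ι) (v : ι → ℝ) :
    t.toCompTree.eval v = fun _ => v (t.run v) := by
  induction t with
  | leaf a => rfl
  | node i j t e iht ihe =>
    simp only [toCompTree, CompTree.eval, run, iht, ihe]
    split_ifs <;> rfl

theorem cost_toCompTree (t : CmpTree ι ι) : t.toCompTree.cost = t.depth := by
  induction t with
  | leaf a => rfl
  | node i j t e iht ihe => simp only [toCompTree, CompTree.cost, depth, iht, ihe]

end CmpTree

/-- At most `c` comparisons suffice to find, for all numbers `v`, some `a` with `P v a`. -/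
def Finds {ι α : Type} (c : ℕ) (P : (ι → ℝ) → α → Prop) : Prop :=
  ∃ t : CmpTree ι α, t.depth ≤ c ∧ ∀ v, P v (t.run v)

namespace Finds

variable {ι α β : Type}

theorem pure {P : (ι → ℝ) → α → Prop} (a : α) (h : ∀ v, P v a) : Finds 0 P :=
  ⟨.leaf a, le_rfl, h⟩

theorem mono {P Q : (ι → ℝ) → α → Prop} {c c' : ℕ} (h : Finds c P) (hc : c ≤ c')
    (hPQ : ∀ v a, P v a → Q v a) : Finds c' Q := by
  obtain ⟨t, htc, ht⟩ := h
  exact ⟨t, htc.trans hc, fun v => hPQ _ _ (ht v)⟩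

/-- The second search may assume that the first one was successful. -/
theorem bind {P : (ι → ℝ) → α → Prop} {Q : (ι → ℝ) → β → Prop} {c c' : ℕ} (hP : Finds c P)
    (hQ : ∀ a, (∃ v, P v a) → Finds c' (fun v b => P v a → Q v b)) : Finds (c + c') Q := by
  classical
  obtain ⟨t, htc, ht⟩ := hP
  obtain ⟨b⟩ : Nonempty β := by
    obtain ⟨s, -, -⟩ := hQ _ ⟨0, ht 0⟩
    exact ⟨s.run 0⟩
  have : ∀ a, ∃ s : CmpTree ι β, s.depth ≤ c' ∧ ∀ v, P v a → Q v (s.run v) := fun a => by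
    by_cases h : ∃ v, P v a
    · exact hQ a h
    · exact ⟨.leaf b, Nat.zero_le _, fun v hv => absurd ⟨v, hv⟩ h⟩
  choose f hfc hf using this
  exact ⟨t.bind f, (CmpTree.depth_bind_le f c' hfc t).trans (Nat.add_le_add_right htc _),
    fun v => by rw [CmpTree.run_bind]; exact hf _ _ (ht v)⟩

theorem map {P : (ι → ℝ) → α → Prop} {Q : (ι → ℝ) → β → Prop} {c : ℕ} (hP : Finds c P) (g : α → β)
    (h : ∀ v a, P v a → Q v (g a)) : Finds c Q :=
  hP.bind fun a _ => pure (g a) fun v => h v a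

theorem compare (i j : ι) : Finds 1 (fun v (b : Prop) => b ↔ v i ≤ v j) :=
  ⟨.node i j (.leaf True) (.leaf False), le_rfl, fun v => by
    by_cases h : v i ≤ v j <;> simp [CmpTree.run, h]⟩

theorem family {J : Type} [Nonempty α] (s : Finset J) {P : J → (ι → ℝ) → α → Prop} {c : ℕ}
    (h : ∀ j ∈ s, Finds c (P j)) :
    Finds (s.card * c) (fun v (f : J → α) => ∀ j ∈ s, P j v (f j)) := by
  classical
  induction s using Finset.induction_on with
  | empty =>
    refine (pure (P := fun (_ : ι → ℝ) (_ : J → α) => True) (fun _ => Classical.arbitrary α)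
      fun _ => trivial).mono (Nat.zero_le _) (by simp)
  | insert j s hj ih =>
    refine ((ih fun k hk => h k (Finset.mem_insert_of_mem hk)).bind (c' := c) fun f _ =>
      (h j (Finset.mem_insert_self j s)).map (Function.update f j) ?_).mono ?_ fun _ _ h => h
    · intro v a ha hf k hk
      rcases eq_or_ne k j with rfl | hkj
      · simpa using ha
      · simpa [hkj] using hf k (Finset.mem_of_mem_insert_of_ne hk hkj)
    · rw [Finset.card_insert_of_notMem hj, Nat.add_mul, Nat.one_mul]

/-- Comparing all pairs finds everything that depends on the order of the numbers only. -/
theorem of_order_invariant (s : Finset ι) {Q : (ι → ℝ) → α → Prop} (hQ : ∀ v, ∃ a, Q v a)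
    (hinv : ∀ v w, (∀ i ∈ s, ∀ j ∈ s, v i ≤ v j ↔ w i ≤ w j) → ∀ a, Q v a → Q w a) :
    Finds (s.card ^ 2) Q := by
  classical
  have := family (s ×ˢ s) (fun q _ => compare q.1 q.2)
  choose g hg using hQ
  refine (this.map (fun f => if h : ∃ v : ι → ℝ, ∀ q ∈ s ×ˢ s, f q ↔ v q.1 ≤ v q.2
    then g h.choose else g 0) ?_).mono (by rw [Finset.card_product]; simp [sq]) fun _ _ h => h
  intro v f hf
  have hex : ∃ v : ι → ℝ, ∀ q ∈ s ×ˢ s, f q ↔ v q.1 ≤ v q.2 := ⟨v, hf⟩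
  rw [dif_pos hex]
  refine hinv _ _ (fun i hi j hj => ?_) _ (hg _)
  rw [← hf (i, j) (Finset.mk_mem_product hi hj),
      hex.choose_spec (i, j) (Finset.mk_mem_product hi hj)]

end Finds

section OrderStatistics

variable {ι : Type}

open Classical in
/-- In the numbers with indices in `s`, sorted in increasing order, `v a` stands at position `i`
(counted from `0`; with ties, at one of its positions). -/
def IsRank (s : Finset ι) (i : ℕ) (v : ι → ℝ) (a : ι) : Prop :=
  a ∈ s ∧ (s.filter fun j => v j < v a).card ≤ i ∧ i < (s.filter fun j => v j ≤ v a).card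

theorem exists_isRank {s : Finset ι} {i : ℕ} (hi : i < s.card) (v : ι → ℝ) :
    ∃ a, IsRank s i v a := by
  classical
  obtain ⟨m, hm, hmax⟩ := s.exists_max_image v (Finset.card_pos.1 (by omega))
  have hne : (s.filter fun a => i < (s.filter fun j => v j ≤ v a).card).Nonempty :=
    ⟨m, Finset.mem_filter.2 ⟨hm, by rwa [Finset.filter_true_of_mem hmax]⟩⟩
  obtain ⟨a, ha, hmin⟩ := Finset.exists_min_image _ v hne
  rw [Finset.mem_filter] at ha
  refine ⟨a, ha.1, ?_, ha.2⟩
  by_contra! hlt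
  obtain ⟨b, hb, hbmax⟩ := Finset.exists_max_image (s.filter fun j => v j < v a) v
    (Finset.card_pos.1 (by omega))
  rw [Finset.mem_filter] at hb
  refine (hmin b (Finset.mem_filter.2 ⟨hb.1, hlt.trans_le (Finset.card_le_card fun j hj =>
      ?_)⟩)).not_gt
    hb.2
  exact Finset.mem_filter.2 ⟨(Finset.mem_filter.1 hj).1, hbmax j hj⟩

theorem finds_isRank_sq {s : Finset ι} {i : ℕ} (hi : i < s.card) :
    Finds (s.card ^ 2) (IsRank s i) := by
  classical
  refine Finds.of_order_invariant s (exists_isRank hi) fun v w hvw a ha => ?_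
  obtain ⟨h1, h2, h3⟩ := ha
  refine ⟨h1, ?_, ?_⟩
  · rwa [← Finset.filter_congr (p := fun j => v j < v a) fun j hj => by
      rw [← not_le, ← not_le, hvw a h1 j hj]]
  · rwa [← Finset.filter_congr (p := fun j => v j ≤ v a) fun j hj => hvw j hj a h1]

/-- A rank among the elements below `x` is a rank among all elements. -/
theorem IsRank.of_subset {s L : Finset ι} {i : ℕ} {v : ι → ℝ} {a x : ι}
    (hL : ∀ j, j ∈ L ↔ j ∈ s ∧ v j < v x) (ha : IsRank L i v a) : IsRank s i v a := by
  classical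
  obtain ⟨h1, h2, h3⟩ := ha
  have hax := (hL a).1 h1
  refine ⟨hax.1, h2.trans' (Finset.card_le_card fun j hj => ?_),
    h3.trans_le (Finset.card_le_card fun j hj => ?_)⟩
  · rw [Finset.mem_filter] at hj ⊢
    exact ⟨(hL j).2 ⟨hj.1, hj.2.trans hax.2⟩, hj.2⟩
  · rw [Finset.mem_filter] at hj ⊢
    exact ⟨((hL j).1 hj.1).1, hj.2⟩

/-- A rank among the elements above `x` is a rank among all elements, shifted by the number of the
other elements. -/
theorem IsRank.of_upper {s U : Finset ι} {i : ℕ} {v : ι → ℝ} {a x : ι}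
    (hU : ∀ j, j ∈ U ↔ j ∈ s ∧ v x < v j) (hi : s.card - U.card ≤ i)
    (ha : IsRank U (i - (s.card - U.card)) v a) : IsRank s i v a := by
  classical
  obtain ⟨h1, h2, h3⟩ := ha
  have hax := (hU a).1 h1
  have hUs : U ⊆ s := fun j hj => ((hU j).1 hj).1
  have hc : (s \ U).card = s.card - U.card := Finset.card_sdiff_of_subset hUs
  have key : ∀ p : ι → Prop, (∀ j ∈ s, j ∉ U → p j) →
      (s.filter p).card = (s.card - U.card) + (U.filter p).card := by
    intro p hp
    rw [← hc, ← Finset.card_union_of_disjoint]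
    · congr 1
      ext j
      simp only [Finset.mem_filter, Finset.mem_union, Finset.mem_sdiff]
      by_cases hj : j ∈ U
      · simp [hj, hUs hj]
      · simp only [hj, not_false_eq_true, and_true, false_and, or_false]
        exact and_iff_left_of_imp fun hjs => hp j hjs hj
    · exact Finset.disjoint_left.2 fun j hj hj' =>
        (Finset.mem_sdiff.1 hj).2 (Finset.mem_filter.1 hj').1
  have hlt : ∀ j ∈ s, j ∉ U → v j < v a := fun j hj hjU =>
    (not_lt.1 fun h => hjU ((hU j).2 ⟨hj, h⟩)).trans_lt hax.2
  refine ⟨hax.1, ?_, ?_⟩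
  · rw [key _ hlt]; omega
  · rw [key _ fun j hj hjU => (hlt j hj hjU).le]; omega

/-- Disjoint groups of `k` elements each; the remaining elements belong to no group. -/
theorem exists_groups (k : ℕ) : ∀ (G : ℕ) (s : Finset ι), k * G ≤ s.card → 0 < k →
    ∃ 𝒢 : Finset (Finset ι), 𝒢.card = G ∧ (∀ g ∈ 𝒢, g ⊆ s ∧ g.card = k) ∧
      (𝒢 : Set (Finset ι)).PairwiseDisjoint id := by
  classical
  intro G
  induction G with
  | zero => intro s _ _; exact ⟨∅, rfl, by simp, by simp⟩
  | succ G ih =>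
    intro s hs hk
    rw [Nat.mul_add, Nat.mul_one] at hs
    obtain ⟨t, hts, htc⟩ := Finset.exists_subset_card_eq (show k ≤ s.card by omega)
    obtain ⟨𝒢, h1, h2, h3⟩ := ih (s \ t) (by rw [Finset.card_sdiff_of_subset hts]; omega) hk
    have hdisj : ∀ g ∈ 𝒢, Disjoint t g := fun g hg =>
      Finset.disjoint_left.2 fun j hj hjg => (Finset.mem_sdiff.1 ((h2 g hg).1 hjg)).2 hj
    have ht : t ∉ 𝒢 := fun h => by
      have := Finset.disjoint_self_iff_empty t |>.1 (hdisj t h)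
      rw [this] at htc
      simp at htc
      omega
    refine ⟨insert t 𝒢, by rw [Finset.card_insert_of_notMem ht, h1], ?_, ?_⟩
    · intro g hg
      rcases Finset.mem_insert.1 hg with rfl | hg
      · exact ⟨hts, htc⟩
      · exact ⟨(h2 g hg).1.trans Finset.sdiff_subset, (h2 g hg).2⟩
    · rw [Finset.coe_insert]
      exact h3.insert fun g hg _ => hdisj g hg

/-- If `x` is a median of the medians of disjoint groups of five, then a constant fraction of all
elements is on either side. -/
theorem card_le_of_median_of_medians {s : Finset ι} {𝒢 𝒢' : Finset (Finset ι)} {f : Finset ι → ι}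
    (h𝒢 : ∀ g ∈ 𝒢, g ⊆ s) (hd : (𝒢 : Set (Finset ι)).PairwiseDisjoint id)
    {r : ι → ι → Prop} (hr : ∀ i j k, r i j → r j k → r i k) [DecidableRel r]
    {x : ι} (hsub : 𝒢' ⊆ 𝒢) (hx : ∀ g ∈ 𝒢', r (f g) x)
    (h3 : ∀ g ∈ 𝒢, 3 ≤ (g.filter fun j => r j (f g)).card) :
    3 * 𝒢'.card ≤ (s.filter fun j => r j x).card := by
  classical
  calc 3 * 𝒢'.card = ∑ g ∈ 𝒢', 3 := by simp [mul_comm]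
    _ ≤ ∑ g ∈ 𝒢', (g.filter fun j => r j (f g)).card := Finset.sum_le_sum fun g hg => h3 g (hsub hg)
    _ = (𝒢'.biUnion fun g => g.filter fun j => r j (f g)).card := by
      refine (Finset.card_biUnion fun g hg g' hg' hne => ?_).symm
      exact (hd (hsub hg) (hsub hg') hne).mono (Finset.filter_subset _ _) (Finset.filter_subset _ _)
    _ ≤ _ := Finset.card_le_card fun j hj => by
      obtain ⟨g, hg, hj⟩ := Finset.mem_biUnion.1 hj
      rw [Finset.mem_filter] at hj ⊢
      exact ⟨h𝒢 g (hsub hg) hj.1, hr _ _ _ hj.2 (hx g hg)⟩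

/-- Selection by the median of medians of groups of five. Finding the medians of the groups takes
`25 ⌊N / 5⌋` comparisons, and comparing all elements with the median `x` of these medians takes
`2 N` more. The recursive calls are for `⌊N / 5⌋` elements and for the elements on one side of `x`,
at most `N - 3 ⌊N / 5⌋ / 2`, so that a linear bound is reproduced. -/
theorem finds_isRank : ∀ (N : ℕ) (s : Finset ι), s.card = N → ∀ i < N,
    Finds (84 * N) (IsRank s i) := by
  classical
  intro N
  induction N using Nat.strong_induction_on with
  | _ N ih =>
  intro s hs i hi
  rcases Nat.lt_or_ge N 25 with hN | hN
  · exact (finds_isRank_sq (hs.symm ▸ hi)).mono (by rw [hs]; nlinarith) fun _ _ h => h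
  obtain ⟨𝒢, h𝒢c, h𝒢, hd⟩ := exists_groups 5 (N / 5) s (by omega) (by omega)
  set G := N / 5
  have hG : 14 * N ≤ 84 * G := by omega
  have : Nonempty ι := by
    obtain ⟨a, -⟩ := Finset.card_pos.1 (show 0 < s.card by omega)
    exact ⟨a⟩
  -- the medians of the groups
  have h1 := Finds.family (α := ι) 𝒢 fun g hg => (finds_isRank_sq (s := g) (i := 2)
    (by rw [(h𝒢 g hg).2]; norm_num)).mono (by rw [(h𝒢 g hg).2]) fun _ _ h => h
  refine (h1.bind (c' := 84 * G + (2 * N + 42 * (2 * N - 3 * G))) fun f hf => ?_).mono ?_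
    fun _ _ h => h
  swap
  · rw [h𝒢c]; omega
  have hfmem : ∀ g ∈ 𝒢, f g ∈ g := fun g hg => (hf.choose_spec g hg).1
  have hinj : Set.InjOn f 𝒢 := fun g hg g' hg' he => by
    by_contra hne
    exact Finset.disjoint_left.1 (hd hg hg' hne) (hfmem g hg) (he ▸ hfmem g' hg')
  have hMc : (𝒢.image f).card = G := by rw [Finset.card_image_of_injOn hinj, h𝒢c]
  -- their median
  refine (ih G (by omega) _ hMc (G / 2) (by omega)).bind fun x _ => ?_
  -- comparing everything with it
  have h2 := Finds.family (α := Prop × Prop) (P := fun j v b => (b.1 ↔ v j ≤ v x) ∧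
      (b.2 ↔ v x ≤ v j))
    (c := 2) s fun j _ => (Finds.compare j x).bind (c' := 1) fun a _ =>
      (Finds.compare x j).map (fun b => (a, b)) fun v b hb ha => ⟨ha, hb⟩
  refine (h2.bind (c' := 42 * (2 * N - 3 * G)) fun b hb => ?_).mono (by rw [hs]; omega)
    fun _ _ h => h
  set L := s.filter fun j => ¬ (b j).2 with hL
  set U := s.filter fun j => ¬ (b j).1 with hU
  have hL' : ∀ v : ι → ℝ, (∀ j ∈ s, ((b j).1 ↔ v j ≤ v x) ∧ ((b j).2 ↔ v x ≤ v j)) →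
      ∀ j, j ∈ L ↔ j ∈ s ∧ v j < v x := fun v hv j => by
    rw [hL, Finset.mem_filter]
    exact and_congr_right fun hj => by rw [(hv j hj).2, not_le]
  have hU' : ∀ v : ι → ℝ, (∀ j ∈ s, ((b j).1 ↔ v j ≤ v x) ∧ ((b j).2 ↔ v x ≤ v j)) →
      ∀ j, j ∈ U ↔ j ∈ s ∧ v x < v j := fun v hv j => by
    rw [hU, Finset.mem_filter]
    exact and_congr_right fun hj => by rw [(hv j hj).1, not_le]
  have hUs : U.card ≤ s.card := Finset.card_le_card (Finset.filter_subset _ _)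
  -- the recursion stops if the outcome of the comparisons was impossible
  by_cases hv : ∃ v : ι → ℝ, (∀ j ∈ s, ((b j).1 ↔ v j ≤ v x) ∧ ((b j).2 ↔ v x ≤ v j)) ∧
      IsRank (𝒢.image f) (G / 2) v x ∧ ∀ g ∈ 𝒢, IsRank g 2 v (f g)
  swap
  · exact (Finds.pure x fun v h3 h4 h5 => absurd ⟨v, h3, h4, h5⟩ hv).mono (Nat.zero_le _)
      fun _ _ h => h
  obtain ⟨v, hv1, ⟨hvx, hv2, hv3⟩, hv4⟩ := hv
  have hLc : 2 * L.card ≤ 2 * N - 3 * G := by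
    have h := card_le_of_median_of_medians (s := s) (𝒢' := 𝒢.filter fun g => v x ≤ v (f g)) (f := f)
      (fun g hg => (h𝒢 g hg).1) hd (r := fun i j => v j ≤ v i) (fun _ _ _ h h' => h'.trans h)
      (Finset.filter_subset _ _) (x := x) (fun g hg => (Finset.mem_filter.1 hg).2) fun g hg => by
        have := (hv4 g hg).2.1
        have h5 := Finset.card_filter_add_card_filter_not (s := g) (fun j => v j < v (f g))
        simp only [not_lt] at h5
        rw [(h𝒢 g hg).2] at h5
        omega
    have h5 := Finset.card_filter_add_card_filter_not (s := s) (fun j => v j < v x)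
    have h6 := Finset.card_filter_add_card_filter_not (s := 𝒢) (fun g => v (f g) < v x)
    simp only [not_lt] at h5 h6
    have h7 : (𝒢.filter fun g => v (f g) < v x).card ≤ G / 2 := by
      refine le_trans (le_of_eq ?_) hv2
      rw [Finset.filter_image, Finset.card_image_of_injOn
          (hinj.mono (Finset.coe_subset.2 (Finset.filter_subset _ _)))]
    have h8 : L = s.filter fun j => v j < v x := by
      ext j; rw [hL' v hv1, Finset.mem_filter]
    rw [← h8] at h5
    omega
  have hUc : 2 * U.card ≤ 2 * N - 3 * G := by
    have h := card_le_of_median_of_medians (s := s) (𝒢' := 𝒢.filter fun g => v (f g) ≤ v x) (f := f)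
      (fun g hg => (h𝒢 g hg).1) hd (r := fun i j => v i ≤ v j) (fun _ _ _ h h' => h.trans h')
      (Finset.filter_subset _ _) (x := x) (fun g hg => (Finset.mem_filter.1 hg).2)
      fun g hg => (hv4 g hg).2.2
    have h5 := Finset.card_filter_add_card_filter_not (s := s) (fun j => v j ≤ v x)
    simp only [not_le] at h5
    have h7 : G / 2 < (𝒢.filter fun g => v (f g) ≤ v x).card := by
      refine hv3.trans_le (le_of_eq ?_)
      rw [Finset.filter_image, Finset.card_image_of_injOn
          (hinj.mono (Finset.coe_subset.2 (Finset.filter_subset _ _)))]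
    have h8 : U = s.filter fun j => v x < v j := by
      ext j; rw [hU' v hv1, Finset.mem_filter]
    rw [← h8] at h5
    omega
  have hxs : x ∈ s := by
    obtain ⟨g, hg, rfl⟩ := Finset.mem_image.1 hvx
    exact (h𝒢 g hg).1 (hfmem g hg)
  by_cases hiL : i < L.card
  · refine (ih L.card (by omega) L rfl i hiL).mono (by omega) fun w a ha h3 _ _ => ?_
    exact ha.of_subset (hL' w h3)
  by_cases hiU : i < s.card - U.card
  · refine (Finds.pure x fun w h3 _ _ => ⟨hxs, ?_, ?_⟩).mono (Nat.zero_le _) fun _ _ h => h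
    · have : s.filter (fun j => w j < w x) = L := by
        ext j; rw [hL' w h3, Finset.mem_filter]
      rw [this]; omega
    · have h5 := Finset.card_filter_add_card_filter_not (s := s) (fun j => w j ≤ w x)
      simp only [not_le] at h5
      have : s.filter (fun j => w x < w j) = U := by
        ext j; rw [hU' w h3, Finset.mem_filter]
      rw [this] at h5; omega
  · refine (ih U.card (by omega) U rfl (i - (s.card - U.card)) (by omega)).mono (by omega)
      fun w a ha h3 _ _ => ?_
    exact ha.of_upper (hU' w h3) (not_lt.1 hiU)

end OrderStatistics

namespace PolyBN

theorem sort_apply_le_iff {k : ℕ} (v : Fin k → ℝ) (i : Fin k) (a : ℝ) :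
    v (Tuple.sort v i) ≤ a ↔ (i : ℕ) < (Finset.univ.filter fun j => v j ≤ a).card := by
  have h := Tuple.lt_card_le_iff_apply_le_of_monotone (j := i) (a := a) (Tuple.monotone_sort v)
  rw [Function.comp_apply] at h
  rw [← h]
  exact iff_of_eq (congrArg _ (Finset.card_equiv (Tuple.sort v) (by simp)))

theorem sort_apply_lt_iff {k : ℕ} (v : Fin k → ℝ) (i : Fin k) (a : ℝ) :
    v (Tuple.sort v i) < a ↔ (i : ℕ) < (Finset.univ.filter fun j => v j < a).card := by
  have h := Tuple.lt_card_lt_iff_apply_lt_of_monotone (j := i) (a := a) (Tuple.monotone_sort v)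
  rw [Function.comp_apply] at h
  rw [← h]
  exact iff_of_eq (congrArg _ (Finset.card_equiv (Tuple.sort v) (by simp)))

end PolyBN

theorem IsRank.apply_eq_sort {k : ℕ} {v : Fin k → ℝ} {i a : Fin k}
    (h : IsRank Finset.univ i v a) : v a = v (Tuple.sort v i) := by
  classical
  obtain ⟨-, h2, h3⟩ := h
  exact le_antisymm (not_lt.1 fun h => ((PolyBN.sort_apply_lt_iff v i (v a)).1 h).not_ge
      (by convert h2))
    ((PolyBN.sort_apply_le_iff v i (v a)).2 (by convert h3))

theorem computesVal_sort {k : ℕ} (i : Fin k) :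
    ComputesVal (fun v : Fin k → ℝ => v (Tuple.sort v i)) (84 * k) := by
  obtain ⟨t, htc, ht⟩ := finds_isRank k (Finset.univ : Finset (Fin k)) (by simp) i i.2
  exact ⟨t.toCompTree, fun v => by rw [t.eval_toCompTree, (ht v).apply_eq_sort],
    by rwa [t.cost_toCompTree]⟩

theorem computesVal_median (k : ℕ) :
    ComputesVal (fun v : Fin k → ℝ => PolyBN.median v) (168 * k + 3) := by
  rcases Nat.eq_zero_or_pos k with rfl | hk
  · exact ((ComputesVal.const 0).mono (by norm_num)).congr fun v => by simp [PolyBN.median]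
  · refine ((((computesVal_sort ⟨(k - 1) / 2, by omega⟩).add
      (computesVal_sort ⟨k / 2, by omega⟩)).div (ComputesVal.const 2)).mono (by omega)).congr
      fun v => ?_
    simp [PolyBN.median, hk]

/-! ### The running time of the two-phased algorithm -/

namespace PolyBN

variable {n : ℕ}

/-- The medians take `168 k + 3` steps each, for `k` batches. -/
theorem computes_cauchyEstTree (S : LinSolver) (G : Digraph (Fin n)) (m : ℕ) {a : ℕ → ℕ}
    (hS : ∀ p, Computes (fun v : (Fin p × Fin p) ⊕ Fin p → ℝ =>
      S p (Matrix.of fun i j => v (Sum.inl (i, j))) (fun i => v (Sum.inr i))) (a p)) :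
    Computes (fun (x : Fin m × Fin n → ℝ) (e : Σ i : Fin n, Fin (inDeg G i)) =>
      cauchyEstTree S G (fun s i => x (s, i)) e.1 e.2)
      (∑ y, (m / inDeg G y * a (inDeg G y) +
        inDeg G y * (168 * (m / inDeg G y) + 3))) := by
  refine Computes.sigma (f := fun y (x : Fin m × Fin n → ℝ) (c : Fin (inDeg G y)) =>
    cauchyEstTree S G (fun s i => x (s, i)) y c) fun y => ?_
  have h1 : Computes (fun (x : Fin m × Fin n → ℝ) (q : Σ _ : Fin (m / inDeg G y),
      Fin (inDeg G y)) =>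
      batchEstimate S G (fun s i => x (s, i)) y q.1 q.2) (m / inDeg G y * a (inDeg G y)) :=
    (Computes.sigma fun s => (hS (inDeg G y)).reindexIn (Sum.elim
      (fun q => (batchIdx s q.1, parent G y q.2)) (fun r => (batchIdx s r, y)))).mono (by simp)
  have h2 : Computes (fun (w : (Σ _ : Fin (m / inDeg G y), Fin (inDeg G y)) → ℝ)
      (c : Fin (inDeg G y)) => median fun s => w ⟨s, c⟩)
      (inDeg G y * (168 * (m / inDeg G y) + 3)) :=
    (Computes.pi_val (c := fun _ => 168 * (m / inDeg G y) + 3) fun c =>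
      Computes.reindexIn (computesVal_median _)
        fun s => (⟨s, c⟩ : Σ _ : Fin (m / inDeg G y), Fin (inDeg G y))).mono (by simp)
  exact h2.comp h1

theorem computes_varianceRecovery (G : Digraph (Fin n)) (m : ℕ) :
    Computes (fun (w : (Fin m × Fin n) ⊕ (Σ i : Fin n, Fin (inDeg G i)) → ℝ) (y : Fin n) =>
      varianceRecovery G (fun i c => w (Sum.inr ⟨i, c⟩)) (fun s i => w (Sum.inl (s, i))) y)
      (∑ y, (m * (4 * inDeg G y + 6) + 3)) := by
  refine Computes.pi_val fun y => ?_
  have h1 : ∀ s : Fin m, ComputesVal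
      (fun w : (Fin m × Fin n) ⊕ (Σ i : Fin n, Fin (inDeg G i)) → ℝ =>
        w (Sum.inl (s, y)) - ∑ c, w (Sum.inl (s, parent G y c)) * w (Sum.inr ⟨y, c⟩))
      (2 * inDeg G y + 2) := fun s =>
    ((ComputesVal.var _).sub (ComputesVal.sum Finset.univ fun c _ =>
      (ComputesVal.var _).mul (ComputesVal.var _))).mono (by simp; omega)
  refine ((((ComputesVal.sum Finset.univ fun s _ => (h1 s).mul (h1 s)).div
    (ComputesVal.const m))).mono (by simp; ring_nf; omega)).congr fun w => ?_
  simp [varianceRecovery, sq]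

theorem exists_tree_twoPhase (S : LinSolver) (G : Digraph (Fin n)) (m₁ m₂ : ℕ) {a : ℕ → ℕ}
    (hS : ∀ p, Computes (fun v : (Fin p × Fin p) ⊕ Fin p → ℝ =>
      S p (Matrix.of fun i j => v (Sum.inl (i, j))) (fun i => v (Sum.inr i))) (a p)) :
    ∃ t : CompTree ((Σ i : Fin n, Fin (inDeg G i)) ⊕ Fin n) (Fin (m₁ + m₂) × Fin n),
      ComputesTwoPhase S G t ∧
      t.cost ≤ ∑ y, (m₁ / inDeg G y * a (inDeg G y) +
        inDeg G y * (168 * (m₁ / inDeg G y) + 3)) + ∑ y, (m₂ * (4 * inDeg G y + 6) + 3) := by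
  have h1 := (computes_cauchyEstTree S G m₁ hS).reindexIn
    fun q : Fin m₁ × Fin n => (Fin.castAdd m₂ q.1, q.2)
  have h2 := (computes_varianceRecovery G m₂).reindexIn
    (Sum.map (fun q : Fin m₂ × Fin n => (Fin.natAdd m₁ q.1, q.2)) id)
  have h3 := h1.bind (((Computes.proj (fun e : Σ i : Fin n, Fin (inDeg G i) =>
    (Sum.inr e : (Fin (m₁ + m₂) × Fin n) ⊕ _))).pair h2))
  rw [Nat.zero_add] at h3
  obtain ⟨t, ht, htc⟩ := h3
  refine ⟨t, fun x => ?_, htc⟩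
  rw [ht]
  funext k
  rcases k with k | k <;> rfl

theorem sum_inDeg_le (G : Digraph (Fin n)) : ∑ y, (inDeg G y : ℝ) ≤ n * avgInDegOne G := by
  rcases Nat.eq_zero_or_pos n with rfl | hn
  · simp
  · have hn' : (0 : ℝ) < n := by exact_mod_cast hn
    calc ∑ y, (inDeg G y : ℝ) = n * avgInDeg G := by rw [avgInDeg]; field_simp
      _ ≤ _ := by gcongr; exact le_max_right _ _

theorem one_le_avgInDegOne (G : Digraph (Fin n)) : 1 ≤ avgInDegOne G := le_max_left _ _

/-- A node with `p` parents costs `m₁ / p` systems at `K p ^ ω ≤ K p ^ 2 d ^ (ω - 2)` steps, and `p`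
medians of `m₁ / p` numbers. Both are at most proportional to `p`, and the sum of `p` over all nodes
is at most `n D`. -/
theorem exists_tree_twoPhase_cost_le {ω K : ℝ} (hω : 2 ≤ ω) (hK : 0 ≤ K) {S : LinSolver}
    (hS : ∀ p : ℕ, ∃ a : ℕ, Computes (fun v : (Fin p × Fin p) ⊕ Fin p → ℝ =>
      S p (Matrix.of fun i j => v (Sum.inl (i, j))) (fun i => v (Sum.inr i))) a ∧
        (a : ℝ) ≤ K * (p : ℝ) ^ ω)
    (G : Digraph (Fin n)) {d : ℕ} (hd : 1 ≤ d) (hG : ∀ i, inDeg G i ≤ d) (m₁ m₂ : ℕ) :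
    ∃ t : CompTree ((Σ i : Fin n, Fin (inDeg G i)) ⊕ Fin n) (Fin (m₁ + m₂) × Fin n),
      ComputesTwoPhase S G t ∧
      (t.cost : ℝ) ≤ n * avgInDegOne G * ((K + 168) * (d : ℝ) ^ (ω - 2) * m₁ + 10 * m₂ + 6) := by
  choose a ha haK using hS
  obtain ⟨t, ht, htc⟩ := exists_tree_twoPhase S G m₁ m₂ ha
  refine ⟨t, ht, (Nat.cast_le.2 htc).trans ?_⟩
  rw [← Finset.sum_add_distrib, Nat.cast_sum]
  have hd1 : (1 : ℝ) ≤ d := by exact_mod_cast hd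
  have hdω : 1 ≤ (d : ℝ) ^ (ω - 2) := Real.one_le_rpow hd1 (by linarith)
  set B := (K + 168) * (d : ℝ) ^ (ω - 2) * m₁ + 4 * m₂ + 3 with hB
  have key : ∀ y, (((m₁ / inDeg G y * a (inDeg G y) + inDeg G y * (168 * (m₁ / inDeg G y) + 3)) +
      (m₂ * (4 * inDeg G y + 6) + 3) : ℕ) : ℝ) ≤ inDeg G y * B + (6 * m₂ + 3) := by
    intro y
    rcases Nat.eq_zero_or_pos (inDeg G y) with hp | hp
    · simp [hp]; linarith
    generalize hpe : inDeg G y = p at *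
    have hp1 : (1 : ℝ) ≤ p := by exact_mod_cast hp
    have hp0 : (0 : ℝ) < p := by linarith
    have hNp : ((m₁ / p : ℕ) : ℝ) * p ≤ m₁ := by exact_mod_cast Nat.div_mul_le_self m₁ p
    have hpd : (p : ℝ) ^ ω ≤ p * (p * (d : ℝ) ^ (ω - 2)) := by
      have : (p : ℝ) ^ ω = p * (p * (p : ℝ) ^ (ω - 2)) := by
        rw [← mul_assoc, ← sq, ← Real.rpow_natCast, ← Real.rpow_add hp0]
        congr 1; push_cast; ring
      rw [this]
      have : p ≤ d := hpe ▸ hG y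
      gcongr
    have h1 : ((m₁ / p : ℕ) : ℝ) * a p ≤ p * (K * (d : ℝ) ^ (ω - 2) * m₁) := by
      calc ((m₁ / p : ℕ) : ℝ) * a p ≤ (m₁ / p : ℕ) * (K * (p * (p * (d : ℝ) ^ (ω - 2)))) := by
            gcongr; exact (haK p).trans (by gcongr)
        _ = ((m₁ / p : ℕ) * p) * (p * (K * (d : ℝ) ^ (ω - 2))) := by ring
        _ ≤ m₁ * (p * (K * (d : ℝ) ^ (ω - 2))) := by gcongr
        _ = _ := by ring
    have h2 : (168 : ℝ) * (((m₁ / p : ℕ) : ℝ) * p) ≤ p * (168 * (d : ℝ) ^ (ω - 2) * m₁) := by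
      calc (168 : ℝ) * (((m₁ / p : ℕ) : ℝ) * p) ≤ 168 * (1 * 1 * m₁) := by linarith
        _ ≤ 168 * (p * (d : ℝ) ^ (ω - 2) * m₁) := by gcongr
        _ = _ := by ring
    rw [hB]
    simp only [Nat.cast_add, Nat.cast_mul, Nat.cast_ofNat]
    linarith
  refine (Finset.sum_le_sum fun y _ => key y).trans ?_
  rw [Finset.sum_add_distrib, ← Finset.sum_mul]
  have hs := sum_inDeg_le G
  have hB0 : 0 ≤ B := by positivity
  have hD := one_le_avgInDegOne G
  calc (∑ i, (inDeg G i : ℝ)) * B + ∑ _i : Fin n, (6 * (m₂ : ℝ) + 3)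
      ≤ (n * avgInDegOne G) * B + (n * 1) * (6 * m₂ + 3) := by
        simp only [Finset.sum_const, Finset.card_univ, Fintype.card_fin, nsmul_eq_mul, mul_one]
        gcongr
    _ ≤ (n * avgInDegOne G) * B + (n * avgInDegOne G) * (6 * m₂ + 3) := by gcongr
    _ = _ := by rw [hB]; ring

end PolyBN

/-! ### Linear images of independent Gaussian variables -/

section Gaussian

variable {ι J : Type*} [Fintype ι] [Fintype J]

theorem map_linearForm_pi_gaussianReal (v : ι → ℝ≥0) (b : ι → ℝ) :
    (Measure.pi fun k => gaussianReal 0 (v k)).map (fun η => ∑ k, b k * η k) =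
      gaussianReal 0 (∑ k, b k ^ 2 * (v k : ℝ)).toNNReal := by
  have hm : ∀ k, AEMeasurable (fun x : ℝ => b k * x) (gaussianReal 0 (v k)) := fun k => by fun_prop
  have hind := iIndepFun_pi hm
  have hlaw : ∀ k, (Measure.pi fun k => gaussianReal 0 (v k)).map (fun η => b k * η k) =
      gaussianReal 0 (.mk (b k ^ 2) (sq_nonneg _) * v k) := fun k => by
    have := (measurePreserving_eval (fun k => gaussianReal 0 (v k)) k).map_eq
    have h2 := gaussianReal_map_const_mul (μ := 0) (v := v k) (b k)
    rw [mul_zero, ← this, Measure.map_map (by fun_prop) (by fun_prop)] at h2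
    exact h2
  have : IsProbabilityMeasure ((Measure.pi fun k => gaussianReal 0 (v k)).map
      (fun η => ∑ k, b k * η k)) := Measure.isProbabilityMeasure_map
          (Measurable.aemeasurable (by fun_prop))
  refine Measure.ext_of_charFun ?_
  rw [hind.charFun_map_fun_sum_eq_prod (fun k => Measurable.aemeasurable (by fun_prop))]
  ext t
  simp only [Finset.prod_apply, hlaw, charFun_gaussianReal]
  rw [← Complex.exp_sum, Real.coe_toNNReal _ (Finset.sum_nonneg fun k _ => by positivity)]
  congr 1
  push_cast
  simp only [mul_zero, zero_mul, zero_sub, Finset.sum_neg_distrib, Finset.sum_mul, Finset.sum_div]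

/-- Linear forms in independent centered Gaussian variables that are pairwise uncorrelated are
independent: both joint laws give the same law to every linear form. -/
theorem map_linear_pi_gaussianReal (v : ι → ℝ≥0) (T : J → ι → ℝ)
    (hT : ∀ j j', j ≠ j' → ∑ k, T j k * T j' k * (v k : ℝ) = 0) :
    (Measure.pi fun k => gaussianReal 0 (v k)).map (fun η j => ∑ k, T j k * η k) =
      Measure.pi fun j => gaussianReal 0 (∑ k, T j k ^ 2 * (v k : ℝ)).toNNReal := by
  classical
  have : IsProbabilityMeasure ((Measure.pi fun k => gaussianReal 0 (v k)).map
      (fun η j => ∑ k, T j k * η k)) := Measure.isProbabilityMeasure_map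
          (Measurable.aemeasurable (by fun_prop))
  refine Measure.ext_of_charFunDual (funext fun L => ?_)
  have hL : ∀ x : J → ℝ, L x = ∑ j, L (Pi.single j 1) * x j := fun x => by
    conv_lhs => rw [pi_eq_sum_univ' x]
    rw [map_sum]
    refine Finset.sum_congr rfl fun j _ => ?_
    rw [map_smul, smul_eq_mul, mul_comm]
  rw [charFunDual_eq_charFun_map_one, charFunDual_eq_charFun_map_one]
  congr 1
  have hL' : (L : (J → ℝ) → ℝ) = fun x => ∑ j, L (Pi.single j 1) * x j := funext hL
  rw [Measure.map_map (by fun_prop) (by fun_prop), hL', map_linearForm_pi_gaussianReal]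
  have : (fun x : J → ℝ => ∑ j, L (Pi.single j 1) * x j) ∘ (fun (η : ι → ℝ) j => ∑ k, T j k * η k) =
      fun η => ∑ k, (∑ j, L (Pi.single j 1) * T j k) * η k := by
    funext η
    simp only [Function.comp, Finset.mul_sum, Finset.sum_mul]
    rw [Finset.sum_comm]
    simp only [mul_assoc]
  rw [this, map_linearForm_pi_gaussianReal]
  congr 2
  set l : J → ℝ := fun j => L (Pi.single j 1)
  have hnn : ∀ j, ((∑ k, T j k ^ 2 * (v k : ℝ)).toNNReal : ℝ) = ∑ k, T j k ^ 2 * (v k : ℝ) :=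
    fun j => Real.coe_toNNReal _ (Finset.sum_nonneg fun k _ => by positivity)
  simp only [hnn]
  calc ∑ k, (∑ j, l j * T j k) ^ 2 * (v k : ℝ)
      = ∑ j, ∑ j', l j * l j' * ∑ k, T j k * T j' k * (v k : ℝ) := by
        simp only [sq, Finset.sum_mul, Finset.mul_sum]
        rw [Finset.sum_comm]
        refine Finset.sum_congr rfl fun j _ => ?_
        rw [Finset.sum_comm]
        refine Finset.sum_congr rfl fun j' _ => Finset.sum_congr rfl fun k _ => ?_
        ring
    _ = ∑ j, l j * l j * ∑ k, T j k * T j k * (v k : ℝ) :=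
        Finset.sum_congr rfl fun j _ => Finset.sum_eq_single j
          (fun j' _ hj' => by rw [hT j j' hj'.symm, mul_zero]) (by simp)
    _ = _ := by simp only [sq, l]

end Gaussian

/-! ### Parents in a polytree -/

namespace PolyBN

variable {n : ℕ} {G : Digraph (Fin n)}

theorem IsDAG.reachable_deleteEdges (hG : IsDAG G) {j j₀ k y : Fin n}
    (hjy : G.Adj j y) (hk : Relation.ReflTransGen G.Adj k j) :
    (G.toSimpleGraphInclusive.deleteEdges {s(j₀, y)}).Reachable k j := by
  induction hk using Relation.ReflTransGen.head_induction_on with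
  | refl => exact SimpleGraph.Reachable.refl _
  | @head a b hab hbj ih =>
    have hb : Relation.TransGen G.Adj b y := Relation.TransGen.tail' hbj hjy
    have hby : b ≠ y := fun h => hG y (h ▸ hb)
    have hay : a ≠ y := fun h => hG a (Relation.TransGen.head hab (h ▸ hb))
    have hne : a ≠ b := fun h => hG a (Relation.TransGen.single (by rwa [← h] at hab))
    refine SimpleGraph.Reachable.trans (SimpleGraph.Adj.reachable ?_) ih
    rw [SimpleGraph.deleteEdges_adj]
    refine ⟨⟨hne, Or.inl hab⟩, ?_⟩
    simp only [Set.mem_singleton_iff, Sym2.eq_iff, not_or, not_and]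
    exact ⟨fun _ h => hby h, fun h => absurd h hay⟩

/-- Different parents of a node in a polytree have no common ancestors: otherwise one of the two
edges into the node would lie on a cycle, that is, it would not be a bridge. -/
theorem IsPolytree.not_common_ancestor (hG : IsPolytree G) {j j' k y : Fin n} (hj : G.Adj j y)
    (hj' : G.Adj j' y) (hne : j ≠ j') (hk : Relation.ReflTransGen G.Adj k j)
    (hk' : Relation.ReflTransGen G.Adj k j') : False := by
  have hjy : j ≠ y := fun h => hG.1 y (Relation.TransGen.single (by rwa [h] at hj))
  have hjy' : j' ≠ y := fun h => hG.1 y (Relation.TransGen.single (by rwa [h] at hj'))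
  have hb : G.toSimpleGraphInclusive.IsBridge s(j, y) :=
    SimpleGraph.isAcyclic_iff_forall_adj_isBridge.1 hG.2 ⟨hjy, Or.inl hj⟩
  refine SimpleGraph.isBridge_iff.1 hb ?_
  refine (hG.1.reachable_deleteEdges hj hk).symm.trans
    ((hG.1.reachable_deleteEdges hj' hk').trans (SimpleGraph.Adj.reachable ?_))
  rw [SimpleGraph.deleteEdges_adj]
  refine ⟨⟨hjy', Or.inl hj'⟩, ?_⟩
  simp only [Set.mem_singleton_iff, Sym2.eq_iff, not_or, not_and]
  exact ⟨fun h => absurd h.symm hne, fun h => absurd h hjy'⟩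

theorem parent_injective (G : Digraph (Fin n)) (y : Fin n) : Function.Injective (parent G y) :=
  ((parents G y).orderEmbOfFin rfl).injective

namespace Params

variable (θ : Params G)

/-- The matrix that maps the noises to the values of the variables. -/
def solMatrix : Matrix (Fin n) (Fin n) ℝ := (1 - θ.coefMatrix)⁻¹

theorem solution_apply (η : Fin n → ℝ) (j : Fin n) :
    θ.solution η j = ∑ k, θ.solMatrix j k * η k := rfl

theorem solMatrix_eq (hG : IsDAG G) (j k : Fin n) :
    θ.solMatrix j k = (if k = j then 1 else 0) +
      ∑ r, θ.coef j r * θ.solMatrix (parent G j r) k := by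
  have h := θ.structural_equation hG (Pi.single k 1) j
  have h1 : ∀ i, θ.solution (Pi.single k 1) i = θ.solMatrix i k := fun i => by
    simp [solution_apply, Pi.single_apply]
  simp only [h1, Pi.single_apply, eq_comm (a := j)] at h
  exact h

/-- A variable depends on the noises of its ancestors only. -/
theorem reflTransGen_of_solMatrix_ne_zero (hG : IsDAG G) {j k : Fin n}
    (h : θ.solMatrix j k ≠ 0) : Relation.ReflTransGen G.Adj k j := by
  have hirr : Std.Irrefl (Relation.TransGen G.Adj) := ⟨hG⟩
  have hwf : WellFounded (Relation.TransGen G.Adj) := Finite.wellFounded_of_trans_of_irrefl _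
  induction j using hwf.induction with
  | _ j ih =>
    rw [θ.solMatrix_eq hG] at h
    by_cases hkj : k = j
    · rw [hkj]
    rw [if_neg hkj, zero_add] at h
    obtain ⟨r, -, hr⟩ := Finset.exists_ne_zero_of_sum_ne_zero h
    have hadj := adj_parent G j r
    exact (ih _ (Relation.TransGen.single hadj) (right_ne_zero_of_mul hr)).tail hadj

theorem solMatrix_parent_self (hG : IsDAG G) (y : Fin n) (c : Fin (inDeg G y)) :
    θ.solMatrix (parent G y c) y = 0 := by
  by_contra h
  exact hG y (Relation.TransGen.tail' (θ.reflTransGen_of_solMatrix_ne_zero hG h) (adj_parent G y c))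

theorem solMatrix_self (hG : IsDAG G) (y : Fin n) : θ.solMatrix y y = 1 := by
  rw [θ.solMatrix_eq hG, if_pos rfl]
  simp [θ.solMatrix_parent_self hG]

/-- Different parents of a node depend on disjoint sets of noises: they have no common ancestors. -/
theorem solMatrix_parent_mul_eq_zero (hG : IsPolytree G) {y : Fin n} {c c' : Fin (inDeg G y)}
    (hc : c ≠ c') (k : Fin n) :
    θ.solMatrix (parent G y c) k * θ.solMatrix (parent G y c') k = 0 := by
  by_contra h
  exact hG.not_common_ancestor (adj_parent G y c) (adj_parent G y c')
    (fun h => hc (parent_injective G y h))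
    (θ.reflTransGen_of_solMatrix_ne_zero hG.1 (left_ne_zero_of_mul h))
    (θ.reflTransGen_of_solMatrix_ne_zero hG.1 (right_ne_zero_of_mul h))

/-- The variance of the variable `X_j`. -/
def nodeVar (j : Fin n) : ℝ := ∑ k, θ.solMatrix j k ^ 2 * ((θ.noiseVar k).toNNReal : ℝ)

theorem measurable_solution : Measurable θ.solution := by
  have : θ.solution = fun η j => ∑ k, θ.solMatrix j k * η k := by
    funext η j; exact θ.solution_apply η j
  rw [this]
  fun_prop

instance : IsProbabilityMeasure θ.law :=
  Measure.isProbabilityMeasure_map θ.measurable_solution.aemeasurable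

theorem map_eval_law (j : Fin n) :
    θ.law.map (fun x => x j) = gaussianReal 0 (θ.nodeVar j).toNNReal := by
  rw [law, Measure.map_map (by fun_prop) θ.measurable_solution]
  exact map_linearForm_pi_gaussianReal _ _

theorem nodeVar_nonneg (j : Fin n) : 0 ≤ θ.nodeVar j :=
  Finset.sum_nonneg fun k _ => by positivity

theorem variance_law (j : Fin n) : variance (fun x => x j) θ.law = θ.nodeVar j := by
  have h : variance id (θ.law.map fun x => x j) = variance (fun x => x j) θ.law :=
    variance_map aemeasurable_id (measurable_pi_apply j).aemeasurable
  rw [← h, map_eval_law, variance_id_gaussianReal, Real.coe_toNNReal _ (θ.nodeVar_nonneg j)]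

theorem nodeVar_pos (hG : IsDAG G) (hθ : ∀ i, 0 < θ.noiseVar i) (j : Fin n) : 0 < θ.nodeVar j := by
  refine Finset.sum_pos' (fun k _ => by positivity) ⟨j, Finset.mem_univ j, ?_⟩
  rw [θ.solMatrix_self hG]
  simpa using hθ j

/-- The noise at `y`, as a function of the sample, with index `none`, and the values of the
parents of `y`. -/
def family (y : Fin n) (x : Fin n → ℝ) : Option (Fin (inDeg G y)) → ℝ
  | none => x y - ∑ c, θ.coef y c * x (parent G y c)
  | some c => x (parent G y c)

/-- The variances of the noise at `y` and of the parents of `y`. -/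
def familyVar (y : Fin n) : Option (Fin (inDeg G y)) → ℝ
  | none => θ.noiseVar y
  | some c => θ.nodeVar (parent G y c)

theorem familyVar_pos (hG : IsDAG G) (hθ : ∀ i, 0 < θ.noiseVar i) (y : Fin n)
    (o : Option (Fin (inDeg G y))) : 0 < θ.familyVar y o := by
  cases o
  · exact hθ y
  · exact θ.nodeVar_pos hG hθ _

theorem measurable_family (y : Fin n) : Measurable (θ.family y) := by
  refine measurable_pi_lambda _ fun o => ?_
  cases o <;> simp only [family] <;> fun_prop

/-- In a polytree, the noise at a node and the values of its parents are independent. -/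
theorem map_family_law (hG : IsPolytree G) (hθ : ∀ i, 0 < θ.noiseVar i) (y : Fin n) :
    θ.law.map (θ.family y) = Measure.pi fun o => gaussianReal 0 (θ.familyVar y o).toNNReal := by
  classical
  let T : Option (Fin (inDeg G y)) → Fin n → ℝ
    | none => fun k => if k = y then 1 else 0
    | some c => θ.solMatrix (parent G y c)
  have hT : θ.family y ∘ θ.solution = fun η o => ∑ k, T o k * η k := by
    funext η o
    cases o with
    | none =>
      simp only [Function.comp, family, T]
      rw [θ.structural_equation hG.1]
      simp
    | some c => rfl
  rw [law, Measure.map_map (θ.measurable_family y) θ.measurable_solution, hT,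
    map_linear_pi_gaussianReal]
  · congr
    funext o
    cases o with
    | none => simp [T, familyVar, (hθ y).le]
    | some c => rfl
  · rintro (_ | c) (_ | c') hne
    · exact absurd rfl hne
    · simp [T, θ.solMatrix_parent_self hG.1]
    · simp [T, θ.solMatrix_parent_self hG.1]
    · exact Finset.sum_eq_zero fun k _ => by
        rw [show T (some c) k * T (some c') k = 0 from
          θ.solMatrix_parent_mul_eq_zero hG (fun h => hne (congrArg some h)) k, zero_mul]

/-- The variance of the residual `X_y - ∑ a_c X_c`, for arbitrary coefficients `a_c` of the
parents. -/
def residualVar (y : Fin n) (a : Fin (inDeg G y) → ℝ) : ℝ :=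
  θ.noiseVar y + ∑ c, (θ.coef y c - a c) ^ 2 * θ.nodeVar (parent G y c)

theorem map_residual_law (hG : IsPolytree G) (hθ : ∀ i, 0 < θ.noiseVar i) (y : Fin n)
    (a : Fin (inDeg G y) → ℝ) :
    θ.law.map (fun x => x y - ∑ c, x (parent G y c) * a c) =
      gaussianReal 0 (θ.residualVar y a).toNNReal := by
  let b : Option (Fin (inDeg G y)) → ℝ
    | none => 1
    | some c => θ.coef y c - a c
  have hb : (fun x : Fin n → ℝ => x y - ∑ c, x (parent G y c) * a c) =
      (fun z => ∑ o, b o * z o) ∘ θ.family y := by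
    funext x
    simp only [Function.comp, Fintype.sum_option, b, family, sub_mul,
        Finset.sum_sub_distrib, one_mul]
    simp only [mul_comm]
    ring
  rw [hb, ← Measure.map_map (by fun_prop) (θ.measurable_family y), θ.map_family_law hG hθ,
    map_linearForm_pi_gaussianReal]
  congr 2
  rw [Fintype.sum_option]
  simp only [b, residualVar, familyVar, one_pow, one_mul, Real.coe_toNNReal _ (hθ y).le,
    Real.coe_toNNReal _ (θ.nodeVar_nonneg _)]

end Params

end PolyBN

/-! ### Product measures -/

namespace MeasureTheory

theorem lintegral_fin_nat_prod_eq_prod {n : ℕ} {E : Fin n → Type*}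
    {mE : ∀ i, MeasurableSpace (E i)} {μ : (i : Fin n) → Measure (E i)} [∀ i, SigmaFinite (μ i)]
    {f : (i : Fin n) → E i → ℝ≥0∞} (hf : ∀ i, Measurable (f i)) :
    ∫⁻ x : (i : Fin n) → E i, ∏ i, f i (x i) ∂(Measure.pi μ) = ∏ i, ∫⁻ x, f i x ∂(μ i) := by
  induction n with
  | zero => simp
  | succ n ih =>
    have h := ((measurePreserving_piFinSuccAbove μ 0).symm).lintegral_comp
      (f := fun x => ∏ i, f i (x i))
      (Finset.measurable_prod _ fun i _ => (hf i).comp (measurable_pi_apply i))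
    rw [Fin.prod_univ_succ, ← ih fun i => hf i.succ, ← lintegral_prod_mul (hf 0).aemeasurable
      (Finset.measurable_prod _ fun i _ => (hf i.succ).comp (measurable_pi_apply i)).aemeasurable,
      ← h]
    refine lintegral_congr fun x => ?_
    rw [Fin.prod_univ_succ]
    rfl

variable {ι : Type*} [Fintype ι] {E : ι → Type*} {mE : ∀ i, MeasurableSpace (E i)}
  {μ ν : (i : ι) → Measure (E i)}

theorem lintegral_fintype_prod_eq_prod [∀ i, SigmaFinite (μ i)] {f : (i : ι) → E i → ℝ≥0∞}
    (hf : ∀ i, Measurable (f i)) :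
    ∫⁻ x : (i : ι) → E i, ∏ i, f i (x i) ∂(Measure.pi μ) = ∏ i, ∫⁻ x, f i x ∂(μ i) := by
  let e := (Fintype.equivFin ι).symm
  rw [← (measurePreserving_piCongrLeft μ e).lintegral_comp (f := fun x => ∏ i, f i (x i))
    (Finset.measurable_prod _ fun i _ => (hf i).comp (measurable_pi_apply i))]
  simp_rw [← e.prod_comp, MeasurableEquiv.coe_piCongrLeft, Equiv.piCongrLeft_apply_apply]
  exact lintegral_fin_nat_prod_eq_prod fun i => hf (e i)

theorem pi_withDensity [∀ i, SigmaFinite (μ i)] {f : (i : ι) → E i → ℝ≥0∞}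
    (hf : ∀ i, Measurable (f i)) [∀ i, SigmaFinite ((μ i).withDensity (f i))] :
    Measure.pi (fun i => (μ i).withDensity (f i)) =
      (Measure.pi μ).withDensity fun x => ∏ i, f i (x i) := by
  refine (Measure.pi_eq fun s hs => ?_)
  rw [withDensity_apply _ (MeasurableSet.univ_pi hs),
      ← lintegral_indicator (MeasurableSet.univ_pi hs)]
  have : ∀ x : (i : ι) → E i, (Set.univ.pi s).indicator (fun x => ∏ i, f i (x i)) x =
      ∏ i, (s i).indicator (f i) (x i) := by
    intro x
    by_cases hx : x ∈ Set.univ.pi s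
    · rw [Set.indicator_of_mem hx]
      exact Finset.prod_congr rfl fun i _ => (Set.indicator_of_mem (hx i trivial) _).symm
    · rw [Set.indicator_of_notMem hx]
      simp only [Set.mem_pi, not_forall] at hx
      obtain ⟨i, -, hi⟩ := hx
      exact (Finset.prod_eq_zero (Finset.mem_univ i) (Set.indicator_of_notMem hi _)).symm
  simp_rw [this]
  rw [lintegral_fintype_prod_eq_prod fun i => (hf i).indicator (hs i)]
  refine Finset.prod_congr rfl fun i _ => ?_
  rw [lintegral_indicator (hs i), withDensity_apply _ (hs i)]

theorem Measure.AbsolutelyContinuous.pi [∀ i, SigmaFinite (μ i)] [∀ i, SigmaFinite (ν i)]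
    (h : ∀ i, μ i ≪ ν i) : Measure.pi μ ≪ Measure.pi ν := by
  have h1 : ∀ i, (ν i).withDensity ((μ i).rnDeriv (ν i)) = μ i := fun i =>
    Measure.withDensity_rnDeriv_eq _ _ (h i)
  have h2 : ∀ i, SigmaFinite ((ν i).withDensity ((μ i).rnDeriv (ν i))) := fun i => by
    rw [h1]; infer_instance
  have h3 := pi_withDensity (μ := ν) (f := fun i => (μ i).rnDeriv (ν i))
    fun i => Measure.measurable_rnDeriv _ _
  simp only [h1] at h3
  rw [h3]
  exact withDensity_absolutelyContinuous _ _

/-- Replacing one coordinate by an independent copy does not change a product measure. -/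
theorem measurePreserving_update [DecidableEq ι] [∀ i, IsProbabilityMeasure (μ i)] (i : ι) :
    MeasurePreserving (fun q : ((j : ι) → E j) × E i => Function.update q.1 i q.2)
      ((Measure.pi μ).prod (μ i)) (Measure.pi μ) := by
  have hm : Measurable fun q : ((j : ι) → E j) × E i => Function.update q.1 i q.2 := by
    refine measurable_pi_lambda _ fun j => ?_
    rcases eq_or_ne j i with rfl | hj
    · simpa using measurable_snd
    · simpa [hj, Function.comp_def] using (measurable_pi_apply j).comp measurable_fst
  refine ⟨hm, (Measure.pi_eq fun s hs => ?_).symm⟩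
  rw [Measure.map_apply hm (MeasurableSet.univ_pi hs)]
  have : (fun q : ((j : ι) → E j) × E i => Function.update q.1 i q.2) ⁻¹' (Set.univ.pi s) =
      (Set.univ.pi (Function.update s i Set.univ)) ×ˢ (s i) := by
    ext q
    simp only [Set.mem_preimage, Set.mem_pi, Set.mem_univ, true_implies, Set.mem_prod]
    constructor
    · intro h
      refine ⟨fun j => ?_, by simpa using h i⟩
      rcases eq_or_ne j i with rfl | hj
      · simp
      · simpa [hj] using h j
    · rintro ⟨h1, h2⟩ j
      rcases eq_or_ne j i with rfl | hj
      · simpa using h2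
      · simpa [hj] using h1 j
  rw [this, Measure.prod_prod, Measure.pi_pi, ← Finset.prod_erase_mul _ _ (Finset.mem_univ i),
    ← Finset.prod_erase_mul _ _ (Finset.mem_univ i)]
  simp only [Function.update_self, measure_univ, mul_one]
  congr 1
  refine Finset.prod_congr rfl fun j hj => ?_
  rw [Function.update_of_ne (Finset.ne_of_mem_erase hj)]

/-- Selecting different coordinates of a sequence of independent samples gives independent
samples. -/
theorem measurePreserving_comp_injective {ι κ Ω : Type*} [Fintype ι] [Fintype κ]
    {mΩ : MeasurableSpace Ω} (μ : Measure Ω) [IsProbabilityMeasure μ] {e : κ → ι}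
    (he : Function.Injective e) :
    MeasurePreserving (fun (x : ι → Ω) k => x (e k)) (Measure.pi fun _ => μ)
      (Measure.pi fun _ => μ) := by
  have hind : iIndepFun (fun (i : ι) (x : ι → Ω) => x i) (Measure.pi fun _ => μ) :=
    iIndepFun_pi (X := fun _ => id) fun _ => aemeasurable_id
  have h := (hind.precomp he).map_fun_eq_pi_map fun k => (measurable_pi_apply (e k)).aemeasurable
  refine ⟨by fun_prop, h.trans ?_⟩
  congr
  funext k
  exact (measurePreserving_eval (fun _ => μ) (e k)).map_eq

theorem map_prod_eq_of_ae_map_eq {α β γ : Type*} {mα : MeasurableSpace α} {mβ : MeasurableSpace β}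
    {mγ : MeasurableSpace γ} {μ : Measure α} {ν : Measure β} {κ : Measure γ}
    [IsProbabilityMeasure μ] [SFinite ν] {f : α × β → γ} (hf : Measurable f)
    (h : ∀ᵐ a ∂μ, ν.map (fun b => f (a, b)) = κ) : (μ.prod ν).map f = κ := by
  ext s hs
  rw [Measure.map_apply hf hs, Measure.prod_apply (hf hs)]
  have : ∀ᵐ a ∂μ, ν (Prod.mk a ⁻¹' (f ⁻¹' s)) = κ s := by
    filter_upwards [h] with a ha
    rw [← ha, Measure.map_apply (by fun_prop) hs]
    rfl
  rw [lintegral_congr_ae this]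
  simp

end MeasureTheory

/-! ### Random matrices and Cramer's rule -/

/-- For every `x`, the polynomial `det (A x + t)` in `t` has finitely many zeros. By translation
invariance, the set where `det (A x)` vanishes is therefore a null set. -/
theorem ae_det_ne_zero {p : ℕ} {J : Type*} [Fintype J] (e : Fin p → J) (he : Function.Injective e) :
    ∀ᵐ u : Fin p → J → ℝ, (Matrix.of fun r c => u r (e c)).det ≠ 0 := by
  classical
  set Z : Set (Fin p → J → ℝ) := {u | (Matrix.of fun r c => u r (e c)).det = 0} with hZ
  have hm : Measurable fun u : Fin p → J → ℝ => (Matrix.of fun r c => u r (e c)).det := by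
    simp only [Matrix.det_apply]
    fun_prop
  have hZm : MeasurableSet Z := hm (measurableSet_singleton 0)
  let E : Fin p → J → ℝ := fun r j => if j = e r then 1 else 0
  have hEm : Measurable fun q : (Fin p → J → ℝ) × ℝ => q.1 + q.2 • E := by fun_prop
  have h1 : ∀ t : ℝ, volume ((fun u : Fin p → J → ℝ => u + t • E) ⁻¹' Z) = volume Z := fun t =>
    measure_preimage_add_right _ _ _
  have h2 : ∀ u : Fin p → J → ℝ, volume {t : ℝ | u + t • E ∈ Z} = 0 := fun u => by
    set A : Matrix (Fin p) (Fin p) ℝ := Matrix.of fun r c => u r (e c)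
    refine ((-A).charpoly.roots.toFinset.finite_toSet.subset fun t ht => ?_).measure_zero _
    simp only [Finset.mem_coe, Multiset.mem_toFinset]
    rw [Polynomial.mem_roots (-A).charpoly_monic.ne_zero, Polynomial.IsRoot, Matrix.eval_charpoly]
    have : Matrix.scalar (Fin p) t - -A = Matrix.of fun r c => (u + t • E) r (e c) := by
      ext r c
      simp [A, E, he.eq_iff, Matrix.scalar_apply, Matrix.diagonal_apply, add_comm,
        eq_comm]
    rw [this]
    exact ht
  have h3 : ((volume : Measure (Fin p → J → ℝ)).prod (volume : Measure ℝ))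
      ((fun q : (Fin p → J → ℝ) × ℝ => q.1 + q.2 • E) ⁻¹' Z) = 0 := by
    rw [Measure.prod_apply (hEm hZm)]
    refine (lintegral_congr h2).trans ?_
    simp
  rw [Measure.prod_apply_symm (hEm hZm)] at h3
  have h4 : ∫⁻ _ : ℝ, (volume Z) = 0 := (lintegral_congr fun t => (h1 t).symm).trans h3
  rw [lintegral_const, mul_eq_zero] at h4
  have h5 : volume Z = 0 := h4.resolve_right (by simp)
  rw [ae_iff]
  simpa [hZ] using h5

/-- The coefficients of the expansion of a determinant along the column `c`. -/
def Matrix.colCofactor {p : ℕ} (A : Matrix (Fin p) (Fin p) ℝ) (c r : Fin p) : ℝ :=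
  (A.updateCol c (Pi.single r 1)).det

theorem Matrix.det_updateCol_eq_sum {p : ℕ} (A : Matrix (Fin p) (Fin p) ℝ) (c : Fin p)
    (b : Fin p → ℝ) : (A.updateCol c b).det = ∑ r, A.colCofactor c r * b r := by
  have h := LinearMap.pi_apply_eq_sum_univ (LinearMap.proj c ∘ₗ A.cramer) b
  simp only [LinearMap.comp_apply, LinearMap.proj_apply, Matrix.cramer_apply, smul_eq_mul] at h
  rw [h]
  refine Finset.sum_congr rfl fun r _ => ?_
  rw [mul_comm, Matrix.colCofactor]
  congr 3
  ext i
  simp [Pi.single_apply, eq_comm]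

theorem Matrix.colCofactor_updateCol {p : ℕ} (A : Matrix (Fin p) (Fin p) ℝ) (c : Fin p)
    (b : Fin p → ℝ) : (A.updateCol c b).colCofactor c = A.colCofactor c := by
  funext r
  simp [Matrix.colCofactor]

theorem Matrix.measurable_colCofactor {α : Type*} [MeasurableSpace α] {p : ℕ}
    {A : α → Matrix (Fin p) (Fin p) ℝ} (hA : ∀ r c, Measurable fun a => A a r c) (c r : Fin p) :
    Measurable fun a => (A a).colCofactor c r := by
  simp only [Matrix.colCofactor, Matrix.det_apply, Matrix.updateCol_apply]
  refine Finset.measurable_sum _ fun σ _ => Measurable.const_smul (Finset.measurable_prod _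
    fun i _ => ?_) _
  split_ifs
  · exact measurable_const
  · exact hA _ _

/-! ### The Cauchy distribution -/

theorem integral_abs_mul_exp_neg_mul_sq {b : ℝ} (hb : 0 < b) :
    ∫ y : ℝ, |y| * Real.exp (-b * y ^ 2) = b⁻¹ := by
  have h1 : ∫ y : ℝ, |y| * Real.exp (-b * y ^ 2) =
      2 * ∫ y in Set.Ioi (0 : ℝ), y * Real.exp (-b * y ^ 2) := by
    rw [← integral_comp_abs (f := fun y => y * Real.exp (-b * y ^ 2))]
    simp
  have h2 := integral_rpow_mul_exp_neg_mul_rpow (p := 2) (q := 1) (b := b) two_pos (by norm_num) hb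
  have h3 : ∫ y in Set.Ioi (0 : ℝ), y * Real.exp (-b * y ^ 2) = b⁻¹ * (1 / 2) := by
    simp only [Real.rpow_one, Real.rpow_two] at h2
    rw [h2]
    norm_num
    rw [Real.rpow_neg_one]
  rw [h1, h3]; ring

theorem gaussianPDF_mul_gaussianPDF {α β : ℝ} (hα : 0 < α) (hβ : 0 < β) (u : ℝ) {y : ℝ}
    (hy : y ≠ 0) :
    gaussianPDF 0 β.toNNReal y * gaussianPDF 0 (α.toNNReal / .mk (y ^ 2) (sq_nonneg y)) u =
      ENNReal.ofReal ((2 * Real.pi * Real.sqrt (α * β))⁻¹ *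
        (|y| * Real.exp (-((β⁻¹ + u ^ 2 / α) / 2) * y ^ 2))) := by
  rw [gaussianPDF, gaussianPDF, ← ENNReal.ofReal_mul (gaussianPDFReal_nonneg _ _ _)]
  congr 1
  simp only [gaussianPDFReal, NNReal.coe_div, NNReal.coe_mk, Real.coe_toNNReal _ hα.le,
    Real.coe_toNNReal _ hβ.le, sub_zero]
  have h1 : Real.sqrt (2 * Real.pi * (α / y ^ 2)) =
      Real.sqrt (2 * Real.pi) * Real.sqrt α / |y| := by
    rw [Real.sqrt_mul (by positivity), Real.sqrt_div hα.le, Real.sqrt_sq_eq_abs]; ring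
  have h2 : Real.sqrt (2 * Real.pi * β) = Real.sqrt (2 * Real.pi) * Real.sqrt β :=
    Real.sqrt_mul (by positivity) _
  have h3 : 2 * Real.pi = Real.sqrt (2 * Real.pi) * Real.sqrt (2 * Real.pi) :=
    (Real.mul_self_sqrt (by positivity)).symm
  have h4 : -((β⁻¹ + u ^ 2 / α) / 2) * y ^ 2 =
      -y ^ 2 / (2 * β) + -u ^ 2 / (2 * (α / y ^ 2)) := by field_simp; ring
  have h5 : (2 * Real.pi * Real.sqrt (α * β))⁻¹ =
      (Real.sqrt (2 * Real.pi) * Real.sqrt (2 * Real.pi) * (Real.sqrt α * Real.sqrt β))⁻¹ := by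
    rw [← h3, Real.sqrt_mul hα.le]
  have h6 : 0 < Real.sqrt (2 * Real.pi) := by positivity
  have h7 : 0 < Real.sqrt α := by positivity
  have h8 : 0 < Real.sqrt β := by positivity
  have h9 : 0 < |y| := by positivity
  rw [h1, h2, h4, h5, Real.exp_add]
  field_simp

/-- The quotient of independent centered Gaussian variables has a Cauchy distribution. -/
theorem map_div_gaussianReal_prod {α β : ℝ} (hα : 0 < α) (hβ : 0 < β) :
    ((gaussianReal 0 β.toNNReal).prod (gaussianReal 0 α.toNNReal)).map (fun q => q.2 / q.1) =
      cauchyMeasure 0 (Real.sqrt (α / β)).toNNReal := by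
  have hβ' : β.toNNReal ≠ 0 := by simpa using hβ
  have hα' : α.toNNReal ≠ 0 := by simpa using hα
  have hγ : (Real.sqrt (α / β)).toNNReal ≠ 0 := by simpa using div_pos hα hβ
  have hdiv : Measurable fun q : ℝ × ℝ => q.2 / q.1 := by fun_prop
  let v : ℝ → ℝ≥0 := fun y => α.toNNReal / .mk (y ^ 2) (sq_nonneg y)
  have hv : Measurable v := by
    refine Measurable.div measurable_const ?_
    exact (by fun_prop : Measurable fun y : ℝ => y ^ 2).subtype_mk
  have hne : ∀ᵐ y : ℝ, y ≠ 0 := by simp [ae_iff]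
  have hpdf : Measurable fun q : ℝ × ℝ => gaussianPDF 0 (v q.1) q.2 :=
    measurable_uncurry_gaussianPDF.comp
      (measurable_const.prodMk ((hv.comp measurable_fst).prodMk measurable_snd))
  ext B hB
  rw [Measure.map_apply hdiv hB, Measure.prod_apply (hdiv hB), gaussianReal_of_var_ne_zero _ hβ',
    lintegral_withDensity_eq_lintegral_mul _ (measurable_gaussianPDF _ _)
      (measurable_measure_prodMk_left (hdiv hB)),
    cauchyMeasure_of_scale_ne_zero _ hγ, withDensity_apply _ hB]
  have h1 : ∀ᵐ y : ℝ, (gaussianPDF 0 β.toNNReal * fun y => gaussianReal 0 α.toNNReal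
      (Prod.mk y ⁻¹' ((fun q : ℝ × ℝ => q.2 / q.1) ⁻¹' B))) y =
      ∫⁻ u in B, gaussianPDF 0 β.toNNReal y * gaussianPDF 0 (v y) u := by
    filter_upwards [hne] with y hy
    have hvy : v y ≠ 0 := by
      refine div_ne_zero hα' ?_
      rw [ne_eq, ← NNReal.coe_inj]
      simpa using hy
    rw [lintegral_const_mul _ (measurable_gaussianPDF _ _), Pi.mul_apply,
        ← gaussianReal_apply _ hvy]
    congr 1
    have := gaussianReal_map_div_const (μ := 0) (v := α.toNNReal) y
    rw [zero_div] at this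
    rw [← this, Measure.map_apply (by fun_prop) hB]
    rfl
  rw [lintegral_congr_ae h1, lintegral_lintegral_swap
    (((measurable_gaussianPDF 0 β.toNNReal).comp measurable_fst).mul hpdf).aemeasurable]
  refine lintegral_congr fun u => ?_
  have h2 : ∀ᵐ y : ℝ, gaussianPDF 0 β.toNNReal y * gaussianPDF 0 (v y) u =
      ENNReal.ofReal ((2 * Real.pi * Real.sqrt (α * β))⁻¹ *
        (|y| * Real.exp (-((β⁻¹ + u ^ 2 / α) / 2) * y ^ 2))) := by
    filter_upwards [hne] with y hy using gaussianPDF_mul_gaussianPDF hα hβ u hy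
  have hb : 0 < (β⁻¹ + u ^ 2 / α) / 2 := by positivity
  have hint : Integrable fun y : ℝ => |y| * Real.exp (-((β⁻¹ + u ^ 2 / α) / 2) * y ^ 2) := by
    refine ((integrable_mul_exp_neg_mul_sq hb).abs).congr (Filter.Eventually.of_forall fun y => ?_)
    simp only [abs_mul, Real.abs_exp]
  rw [lintegral_congr_ae h2, ← ofReal_integral_eq_lintegral_ofReal (hint.const_mul _)
    (Filter.Eventually.of_forall fun y => by positivity), integral_const_mul,
    integral_abs_mul_exp_neg_mul_sq hb, cauchyPDF, cauchyPDFReal]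
  congr 1
  rw [Real.coe_toNNReal _ (Real.sqrt_nonneg _), Real.sq_sqrt (by positivity), sub_zero,
    Real.sqrt_div hα.le, Real.sqrt_mul hα.le]
  have h7 : 0 < Real.sqrt α := by positivity
  have h8 : 0 < Real.sqrt β := by positivity
  have h9 : Real.sqrt α ^ 2 = α := Real.sq_sqrt hα.le
  have h10 : Real.sqrt β ^ 2 = β := Real.sq_sqrt hβ.le
  generalize Real.sqrt α = a at *
  generalize Real.sqrt β = b at *
  subst h9 h10
  field_simp
  ring

/-! ### The error of a batch -/

section Cauchy

variable {p : ℕ} {w : Option (Fin p) → ℝ}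

/-- The square matrix of the columns `some c`, of a matrix with an additional column `none`. -/
def someCols (u : Fin p → Option (Fin p) → ℝ) : Matrix (Fin p) (Fin p) ℝ :=
  Matrix.of fun r c => u r (some c)

/-- The `c`-th coordinate of the solution of the linear system with the right hand side in the
column `none`, by Cramer's rule. -/
def cramerSol (c : Fin p) (u : Fin p → Option (Fin p) → ℝ) : ℝ :=
  (∑ r, (someCols u).colCofactor c r * u r none) / ∑ r, (someCols u).colCofactor c r * u r (some c)

theorem cramerSol_eq (c : Fin p) (u : Fin p → Option (Fin p) → ℝ) :
    cramerSol c u = (someCols u).cramer (fun r => u r none) c / (someCols u).det := by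
  rw [cramerSol, Matrix.cramer_apply, Matrix.det_updateCol_eq_sum]
  congr 1
  rw [← Matrix.det_updateCol_eq_sum (someCols u) c fun r => u r (some c)]
  congr 1
  exact (Matrix.updateCol_eq_self (someCols u) c)

theorem measurable_cramerSol (c : Fin p) : Measurable (cramerSol (p := p) c) := by
  have h : ∀ r, Measurable fun u : Fin p → Option (Fin p) → ℝ => (someCols u).colCofactor c r :=
    fun r => Matrix.measurable_colCofactor (fun r c => by
      simp only [someCols, Matrix.of_apply]
      fun_prop) c r
  unfold cramerSol
  fun_prop

/-- The distribution of a `p × (p + 1)` matrix with independent centered Gaussian entries, where the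
variance of an entry depends on its column only. -/
def gaussianRows (p : ℕ) (w : Option (Fin p) → ℝ) : Measure (Fin p → Option (Fin p) → ℝ) :=
  Measure.pi fun _ => Measure.pi fun o => gaussianReal 0 (w o).toNNReal

instance : IsProbabilityMeasure (gaussianRows p w) := by unfold gaussianRows; infer_instance

theorem ae_det_someCols_ne_zero (hw : ∀ o, 0 < w o) :
    ∀ᵐ u ∂gaussianRows p w, (someCols u).det ≠ 0 := by
  have hac : gaussianRows p w ≪ volume :=
    Measure.AbsolutelyContinuous.pi fun _ => Measure.AbsolutelyContinuous.pi fun o =>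
      gaussianReal_absolutelyContinuous 0 (by simpa using hw o)
  exact hac.ae_le (ae_det_ne_zero some (Option.some_injective _))

/-- Replacing a column by an independent copy does not change the distribution. -/
theorem measurePreserving_update_column (o : Option (Fin p)) :
    MeasurePreserving (fun (q : (Fin p → Option (Fin p) → ℝ) × (Fin p → ℝ)) r =>
        Function.update (q.1 r) o (q.2 r))
      ((gaussianRows p w).prod (Measure.pi fun _ => gaussianReal 0 (w o).toNNReal))
      (gaussianRows p w) := by
  have h1 := (measurePreserving_arrowProdEquivProdArrow (Option (Fin p) → ℝ) ℝ (Fin p)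
    (fun _ => Measure.pi fun o => gaussianReal 0 (w o).toNNReal)
    (fun _ => gaussianReal 0 (w o).toNNReal)).symm
  have h2 := measurePreserving_pi (fun _ : Fin p => (Measure.pi fun o =>
    gaussianReal 0 (w o).toNNReal).prod (gaussianReal 0 (w o).toNNReal)) _
    (fun _ => measurePreserving_update o)
  exact h2.comp h1

/-- Two independent linear forms with the same coefficients have variances in the ratio `α / β`,
whatever the coefficients are. -/
theorem map_linearForm_pair {a : Fin p → ℝ} (ha : a ≠ 0) {α β : ℝ} (hα : 0 < α) (hβ : 0 < β) :
    ((Measure.pi fun _ : Fin p => gaussianReal 0 β.toNNReal).prod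
        (Measure.pi fun _ : Fin p => gaussianReal 0 α.toNNReal)).map
      (fun q => (∑ r, a r * q.2 r) / ∑ r, a r * q.1 r) =
      cauchyMeasure 0 (Real.sqrt (α / β)).toNNReal := by
  have hs : 0 < ∑ r, a r ^ 2 := by
    obtain ⟨r, hr⟩ := Function.ne_iff.1 ha
    exact Finset.sum_pos' (fun _ _ => sq_nonneg _) ⟨r, Finset.mem_univ r, by
      simp only [Pi.zero_apply] at hr; positivity⟩
  have hm : ∀ γ : ℝ, 0 < γ → MeasurePreserving (fun x : Fin p → ℝ => ∑ r, a r * x r)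
      (Measure.pi fun _ : Fin p => gaussianReal 0 γ.toNNReal)
      (gaussianReal 0 ((∑ r, a r ^ 2) * γ).toNNReal) := fun γ hγ => by
    refine ⟨by fun_prop, ?_⟩
    rw [map_linearForm_pi_gaussianReal, Real.coe_toNNReal _ hγ.le, Finset.sum_mul]
  have h := ((hm β hβ).prod (hm α hα)).map_eq
  have h2 := map_div_gaussianReal_prod (mul_pos hs hα) (mul_pos hs hβ)
  rw [← h, Measure.map_map (by fun_prop) (by fun_prop), mul_div_mul_left _ _ hs.ne'] at h2
  exact h2

/-- Given all other columns, the column `c` and the right hand side enter the solution through one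
linear form only, with the cofactors as its coefficients. So the solution is a quotient of two
independent centered Gaussian variables, and the ratio of their variances does not depend on the
other columns. -/
theorem map_cramerSol (hw : ∀ o, 0 < w o) (c : Fin p) :
    (gaussianRows p w).map (cramerSol c) =
      cauchyMeasure 0 (Real.sqrt (w none / w (some c))).toNNReal := by
  set νc : Measure (Fin p → ℝ) := Measure.pi fun _ => gaussianReal 0 (w (some c)).toNNReal
  set ν : Measure (Fin p → ℝ) := Measure.pi fun _ => gaussianReal 0 (w none).toNNReal
  have h1 : MeasurePreserving (fun q : ((Fin p → Option (Fin p) → ℝ) × (Fin p → ℝ)) × (Fin p → ℝ) =>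
      fun r => Function.update (Function.update (q.1.1 r) (some c) (q.1.2 r)) none (q.2 r))
      (((gaussianRows p w).prod νc).prod ν) (gaussianRows p w) :=
    (measurePreserving_update_column none).comp
      ((measurePreserving_update_column (some c)).prod (MeasurePreserving.id ν))
  have h2 := h1.comp (measurePreserving_prodAssoc (gaussianRows p w) νc ν).symm
  rw [← h2.map_eq, Measure.map_map (measurable_cramerSol c) h2.measurable]
  refine map_prod_eq_of_ae_map_eq ((measurable_cramerSol c).comp h2.measurable) ?_
  filter_upwards [ae_det_someCols_ne_zero hw] with u hu
  have hcof : (someCols u).colCofactor c ≠ 0 := fun h => hu (by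
    have := Matrix.det_updateCol_eq_sum (someCols u) c fun r => u r (some c)
    rw [h] at this
    simp only [Pi.zero_apply, zero_mul, Finset.sum_const_zero] at this
    rw [← this]
    congr 1
    exact (Matrix.updateCol_eq_self (someCols u) c).symm)
  rw [← map_linearForm_pair hcof (hw none) (hw (some c))]
  congr 1
  funext q
  have h3 : someCols (fun r => Function.update (Function.update (u r) (some c) (q.1 r)) none
      (q.2 r)) =
      (someCols u).updateCol c q.1 := by
    ext r c'
    rcases eq_or_ne c' c with rfl | hc
    · simp [someCols]
    · simp [someCols, hc]
  change cramerSol c (fun r => Function.update (Function.update (u r) (some c) (q.1 r)) none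
      (q.2 r)) = _
  rw [cramerSol, h3, Matrix.colCofactor_updateCol]
  simp

end Cauchy

namespace PolyBN

variable {n : ℕ} {G : Digraph (Fin n)} (θ : Params G)

theorem batchIdx_injective {m p : ℕ} (s : Fin (m / p)) :
    Function.Injective (batchIdx (m := m) (p := p) s) := by
  intro r r' h
  simp only [batchIdx, Fin.mk.injEq] at h
  exact Fin.ext (by omega)

theorem batchIdx_injective_prod {m p : ℕ} :
    Function.Injective fun q : Fin (m / p) × Fin p => batchIdx (m := m) q.1 q.2 := by
  rintro ⟨s, r⟩ ⟨s', r'⟩ h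
  simp only [batchIdx, Fin.mk.injEq] at h
  have hp : 0 < p := r.pos
  have h1 : ((s : ℕ) * p + r) / p = ((s' : ℕ) * p + r') / p := by rw [h]
  rw [add_comm, Nat.add_mul_div_right _ _ hp, add_comm ((s' : ℕ) * p), Nat.add_mul_div_right _ _ hp,
    Nat.div_eq_of_lt r.2, Nat.div_eq_of_lt r'.2] at h1
  have h2 : s = s' := Fin.ext (by omega)
  subst h2
  exact Prod.ext rfl (Fin.ext (by simpa using h))

/-- The noises at `y` and the values of the parents of `y` in a batch. -/
def Params.batchFamily {m : ℕ} (y : Fin n) (s : Fin (m / inDeg G y)) (x : Fin m → Fin n → ℝ) :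
    Fin (inDeg G y) → Option (Fin (inDeg G y)) → ℝ :=
  fun r => θ.family y (x (batchIdx s r))

theorem Params.measurePreserving_batchFamily (hG : IsPolytree G) (hθ : ∀ i, 0 < θ.noiseVar i)
    {m : ℕ} (y : Fin n) (s : Fin (m / inDeg G y)) :
    MeasurePreserving (θ.batchFamily y s) (Measure.pi fun _ : Fin m => θ.law)
      (gaussianRows (inDeg G y) (θ.familyVar y)) :=
  (measurePreserving_pi (fun _ => θ.law) _ fun _ =>
    ⟨θ.measurable_family y, θ.map_family_law hG hθ y⟩).comp
    (measurePreserving_comp_injective θ.law (batchIdx_injective s))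

/-- The error of a batch solves a linear system with the noises as its right hand side. -/
theorem batchEstimate_sub_eq {S : LinSolver} (hS : S.IsCorrect) {m : ℕ} (x : Fin m → Fin n → ℝ)
    (y : Fin n) (s : Fin (m / inDeg G y)) (h : (someCols (θ.batchFamily y s x)).det ≠ 0)
    (c : Fin (inDeg G y)) :
    batchEstimate S G x y s c - θ.coef y c = cramerSol c (θ.batchFamily y s x) := by
  set X := someCols (θ.batchFamily y s x) with hX
  have hu : IsUnit X.det := isUnit_iff_ne_zero.2 h
  set ζ : Fin (inDeg G y) → ℝ := fun r => θ.batchFamily y s x r none with hζ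
  have h1 : X.mulVec (batchEstimate S G x y s) = fun r => x (batchIdx s r) y :=
    hS _ X (fun r => x (batchIdx s r) y) hu
  have h2 : X.mulVec (batchEstimate S G x y s - θ.coef y) = ζ := by
    rw [Matrix.mulVec_sub, h1]
    funext r
    simp [hX, hζ, someCols, Params.batchFamily, Params.family, Matrix.mulVec, dotProduct, mul_comm]
  have h3 : X.mulVec (X.det⁻¹ • X.cramer ζ) = ζ := by
    rw [Matrix.mulVec_smul, Matrix.mulVec_cramer, smul_smul, inv_mul_cancel₀ h, one_smul]
  have h4 := Matrix.mulVec_injective_of_isUnit ((Matrix.isUnit_iff_isUnit_det _).2 hu)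
      (h2.trans h3.symm)
  have h5 := congrFun h4 c
  rw [cramerSol_eq, ← hX, ← hζ, div_eq_inv_mul]
  exact h5

/-- The batch errors agree almost everywhere with measurable functions that do not depend on the
linear solver. -/
theorem ae_batchEstimate_sub_eq (hG : IsPolytree G) (hθ : ∀ i, 0 < θ.noiseVar i) {S : LinSolver}
    (hS : S.IsCorrect) {m : ℕ} (y : Fin n) (s : Fin (m / inDeg G y)) :
    ∀ᵐ x ∂(Measure.pi fun _ : Fin m => θ.law), ∀ c,
      batchEstimate S G x y s c - θ.coef y c = cramerSol c (θ.batchFamily y s x) := by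
  filter_upwards [(θ.measurePreserving_batchFamily hG hθ y s).quasiMeasurePreserving.ae
    (ae_det_someCols_ne_zero (θ.familyVar_pos hG.1 hθ y))] with x hx c
  exact batchEstimate_sub_eq θ hS x y s hx c

theorem map_batchEstimate_sub (hG : IsPolytree G) (hθ : ∀ i, 0 < θ.noiseVar i) {S : LinSolver}
    (hS : S.IsCorrect) {m : ℕ} (y : Fin n) (s : Fin (m / inDeg G y)) (c : Fin (inDeg G y)) :
    (Measure.pi fun _ : Fin m => θ.law).map (fun x => batchEstimate S G x y s c - θ.coef y c) =
      cauchyMeasure 0 (Real.sqrt (θ.noiseVar y / θ.nodeVar (parent G y c))).toNNReal := by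
  have h := θ.measurePreserving_batchFamily hG hθ y s
  rw [Measure.map_congr ((ae_batchEstimate_sub_eq θ hG hθ hS y s).mono fun x hx => hx c)]
  have h2 := map_cramerSol (θ.familyVar_pos hG.1 hθ y) c
  rw [← h.map_eq, Measure.map_map (measurable_cramerSol c) h.measurable] at h2
  exact h2

end PolyBN

/-! ### Concentration of the median -/

namespace PolyBN

theorem measurable_sort_apply {k : ℕ} (i : Fin k) :
    Measurable fun v : Fin k → ℝ => v (Tuple.sort v i) := by
  refine measurable_of_Iic fun a => ?_
  have h1 : Measurable fun v : Fin k → ℝ => (Finset.univ.filter fun j => v j ≤ a).card := by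
    simp only [Finset.card_filter]
    refine Finset.measurable_sum _ fun j _ => ?_
    exact Measurable.ite (measurableSet_le (measurable_pi_apply j) measurable_const)
      measurable_const measurable_const
  have h2 : (fun v : Fin k → ℝ => v (Tuple.sort v i)) ⁻¹' Set.Iic a =
      {v | (i : ℕ) < (Finset.univ.filter fun j => v j ≤ a).card} := by
    ext v
    exact sort_apply_le_iff v i a
  rw [h2]
  exact measurableSet_lt measurable_const h1

theorem measurable_median (k : ℕ) : Measurable (median (k := k)) := by
  unfold median
  split_ifs
  · exact ((measurable_sort_apply _).add (measurable_sort_apply _)).div_const _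
  · exact measurable_const

theorem le_two_mul_card_of_lt_median {k : ℕ} (hk : 0 < k) {v : Fin k → ℝ} {a : ℝ}
    (h : a < median v) :
    k ≤ 2 * (Finset.univ.filter fun j => a < v j).card := by
  have hmono : v (Tuple.sort v ⟨(k - 1) / 2, by omega⟩) ≤ v (Tuple.sort v ⟨k / 2, by omega⟩) :=
    Tuple.monotone_sort v (by simp only [Fin.mk_le_mk]; omega)
  rw [median, dif_pos hk] at h
  have h1 : ¬ v (Tuple.sort v ⟨k / 2, by omega⟩) ≤ a := by linarith
  rw [sort_apply_le_iff] at h1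
  have h2 := Finset.card_filter_add_card_filter_not (s := (Finset.univ : Finset (Fin k)))
    fun j => v j ≤ a
  simp only [not_le, Finset.card_univ, Fintype.card_fin] at h2 h1
  omega

theorem le_two_mul_card_of_median_lt {k : ℕ} (hk : 0 < k) {v : Fin k → ℝ} {a : ℝ}
    (h : median v < a) :
    k ≤ 2 * (Finset.univ.filter fun j => v j < a).card := by
  have hmono : v (Tuple.sort v ⟨(k - 1) / 2, by omega⟩) ≤ v (Tuple.sort v ⟨k / 2, by omega⟩) :=
    Tuple.monotone_sort v (by simp only [Fin.mk_le_mk]; omega)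
  rw [median, dif_pos hk] at h
  have h1 : v (Tuple.sort v ⟨(k - 1) / 2, by omega⟩) < a := by linarith
  rw [sort_apply_lt_iff] at h1
  simp only at h1
  omega

end PolyBN

open Classical in
/-- Hoeffding's inequality: at least half of the samples fall into a set of probability at most
`1 / 2 - q` with exponentially small probability only. -/
theorem measure_half_le_card_le {Ω : Type*} [MeasurableSpace Ω] {κ : Measure Ω}
    [IsProbabilityMeasure κ] {B : Set Ω} (hB : MeasurableSet B) {q : ℝ} (hq : 0 ≤ q)
    (hBq : κ.real B ≤ 1 / 2 - q) (k : ℕ) :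
    (Measure.pi fun _ : Fin k => κ).real {z | k ≤ 2 * (Finset.univ.filter fun j => z j ∈ B).card} ≤
      Real.exp (-2 * k * q ^ 2) := by
  rcases Nat.eq_zero_or_pos k with rfl | hk
  · simp
  have hk' : (0 : ℝ) < k := by exact_mod_cast hk
  let f : Ω → ℝ := fun z => B.indicator 1 z - κ.real B
  have hfm : Measurable f := (measurable_one.indicator hB).sub_const _
  have hind : iIndepFun (fun (j : Fin k) (z : Fin k → Ω) => f (z j))
      (Measure.pi fun _ : Fin k => κ) :=
    iIndepFun_pi (X := fun _ => f) fun _ => hfm.aemeasurable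
  have hsub : ∀ j : Fin k, HasSubgaussianMGF (fun z : Fin k → Ω => f (z j)) ((1 / 2) ^ 2)
      (Measure.pi fun _ : Fin k => κ) := fun j => by
    have h1 : HasSubgaussianMGF f ((1 / 2) ^ 2) κ := by
      have h2 := hasSubgaussianMGF_of_mem_Icc (μ := κ) (X := B.indicator 1) (a := 0) (b := 1)
        (measurable_one.indicator hB).aemeasurable (Filter.Eventually.of_forall fun z => by
          by_cases hz : z ∈ B <;> simp [hz])
      rw [integral_indicator_one hB] at h2
      simpa [f] using h2
    rw [← (measurePreserving_eval (fun _ : Fin k => κ) j).map_eq] at h1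
    have h3 : HasSubgaussianMGF f ((1 / 2) ^ 2)
        (Measure.map (fun z : Fin k → Ω => z j) (Measure.pi fun _ : Fin k => κ)) := h1
    have h4 : Measurable fun z : Fin k → Ω => z j := measurable_pi_apply j
    exact h3.of_map h4.aemeasurable
  have h := HasSubgaussianMGF.measure_sum_ge_le_of_iIndepFun hind (s := Finset.univ)
      (fun j _ => hsub j)
    (ε := k * q) (by positivity)
  refine (measureReal_mono fun z hz => ?_).trans (h.trans (le_of_eq ?_))
  · simp only [Set.mem_ofPred_eq] at hz ⊢
    have h3 : ∑ j, f (z j) = (Finset.univ.filter fun j => z j ∈ B).card - k * κ.real B := by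
      simp only [f, Finset.sum_sub_distrib, Finset.sum_const, Finset.card_univ, Fintype.card_fin,
        nsmul_eq_mul, Set.indicator_apply, Pi.one_apply, Finset.sum_ite, mul_one,
            mul_zero, add_zero]
    have h4 : (k : ℝ) ≤ 2 * (Finset.univ.filter fun j => z j ∈ B).card := by exact_mod_cast hz
    rw [h3]
    nlinarith
  · congr 1
    simp only [Finset.sum_const, Finset.card_univ, Fintype.card_fin, nsmul_eq_mul]
    push_cast
    field_simp

theorem cauchyMeasure_map_neg (γ : ℝ≥0) :
    (cauchyMeasure 0 γ).map (fun x => -x) = cauchyMeasure 0 γ := by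
  rcases eq_or_ne γ 0 with rfl | hγ
  · simp [cauchyMeasure_zero_scale, Measure.map_dirac' measurable_neg]
  rw [cauchyMeasure_of_scale_ne_zero _ hγ]
  ext s hs
  rw [Measure.map_apply measurable_neg hs, withDensity_apply _ (measurable_neg hs),
    withDensity_apply _ hs]
  rw [← (Measure.measurePreserving_neg (volume : Measure ℝ)).setLIntegral_comp_preimage hs
    (measurable_cauchyPDF 0 γ)]
  refine lintegral_congr fun x => ?_
  simp [cauchyPDF, cauchyPDFReal]

/-- On the interval, the density is at least half of its maximum `1 / (π γ)`, and `π ≤ 4`. -/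
theorem cauchyMeasure_Icc_ge {γ : ℝ≥0} (hγ : γ ≠ 0) {t : ℝ} (ht : 0 ≤ t) (ht1 : t ≤ 1) :
    t / 4 ≤ (cauchyMeasure 0 γ).real (Set.Icc (-(γ * t)) (γ * t)) := by
  have hγ' : (0 : ℝ) < γ := by exact_mod_cast pos_iff_ne_zero.2 hγ
  have hpi := Real.pi_pos
  have h1 : ENNReal.ofReal (t / 4) ≤ cauchyMeasure 0 γ (Set.Icc (-(γ * t)) (γ * t)) := by
    rw [cauchyMeasure_of_scale_ne_zero _ hγ, withDensity_apply _ measurableSet_Icc]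
    calc ENNReal.ofReal (t / 4)
        ≤ ENNReal.ofReal ((Real.pi * (2 * γ))⁻¹ * (2 * (γ * t))) := by
          refine ENNReal.ofReal_le_ofReal ?_
          rw [inv_mul_eq_div, le_div_iff₀ (by positivity)]
          have := Real.pi_le_four
          have : 0 ≤ γ * t := by positivity
          nlinarith
      _ = ∫⁻ _ in Set.Icc (-(γ * t)) (γ * t), ENNReal.ofReal ((Real.pi * (2 * γ))⁻¹) := by
          rw [setLIntegral_const, Real.volume_Icc, ← ENNReal.ofReal_mul (by positivity)]
          congr 1; ring
      _ ≤ _ := by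
          refine setLIntegral_mono' measurableSet_Icc fun x hx => ?_
          refine ENNReal.ofReal_le_ofReal ?_
          rw [cauchyPDFReal, mul_inv, mul_assoc]
          refine mul_le_mul_of_nonneg_left ?_ (by positivity)
          have hx2 : x ^ 2 ≤ γ ^ 2 := by
            have : |x| ≤ γ := (abs_le.2 hx).trans (by nlinarith)
            rw [← sq_abs]
            gcongr
          rw [sub_zero, inv_le_comm₀ (by positivity) (by positivity), mul_inv, inv_inv,
            inv_mul_le_iff₀ hγ']
          nlinarith
  rw [measureReal_def]
  exact (ENNReal.ofReal_le_iff_le_toReal (measure_ne_top _ _)).1 h1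

theorem cauchyMeasure_tail_le {γ : ℝ≥0} (hγ : γ ≠ 0) {t : ℝ} (ht : 0 ≤ t) (ht1 : t ≤ 1) :
    (cauchyMeasure 0 γ).real (Set.Ioi (γ * t)) ≤ 1 / 2 - t / 8 ∧
      (cauchyMeasure 0 γ).real (Set.Iio (-(γ * t))) ≤ 1 / 2 - t / 8 := by
  have h0 : (0 : ℝ) ≤ γ * t := by positivity
  have hs : (cauchyMeasure 0 γ).real (Set.Iio (-(γ * t))) =
      (cauchyMeasure 0 γ).real (Set.Ioi (γ * t)) := by
    conv_lhs => rw [← cauchyMeasure_map_neg, measureReal_def, Measure.map_apply measurable_neg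
      measurableSet_Iio]
    rw [measureReal_def]
    congr 2
    ext x
    simp
  have h1 : (cauchyMeasure 0 γ).real (Set.Iio (-(γ * t))) +
      (cauchyMeasure 0 γ).real (Set.Icc (-(γ * t)) (γ * t)) +
      (cauchyMeasure 0 γ).real (Set.Ioi (γ * t)) = 1 := by
    rw [← measureReal_union _ measurableSet_Icc, ← measureReal_union _ measurableSet_Ioi]
    · have : Set.Iio (-(γ * t)) ∪ Set.Icc (-(γ * t)) (γ * t) ∪ Set.Ioi (γ * t) = Set.univ := by
        rw [Set.Iio_union_Icc_eq_Iic (by linarith), Set.Iic_union_Ioi]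
      rw [this]
      simp
    · rw [Set.Iio_union_Icc_eq_Iic (by linarith)]
      exact Set.Iic_disjoint_Ioi le_rfl
    · exact Set.disjoint_left.2 fun x hx hx' => (not_le.2 hx) hx'.1
  have h2 := cauchyMeasure_Icc_ge hγ ht ht1
  constructor <;> linarith

/-- The median of independent samples of `a + γ · Cauchy(0, 1)` is within `γ t` of `a`, except with
exponentially small probability. -/
theorem measure_median_cauchy_le {γ : ℝ≥0} (hγ : γ ≠ 0) {t : ℝ} (ht : 0 ≤ t) (ht1 : t ≤ 1) (a : ℝ)
    {k : ℕ} (hk : 0 < k) :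
    (Measure.pi fun _ : Fin k => cauchyMeasure 0 γ).real
      {z | γ * t < |PolyBN.median (fun s => a + z s) - a|} ≤ 2 * Real.exp (-(k * t ^ 2 / 32)) := by
  classical
  obtain ⟨h1, h2⟩ := cauchyMeasure_tail_le hγ ht ht1
  have h3 := measure_half_le_card_le measurableSet_Ioi (by positivity) h1 k
  have h4 := measure_half_le_card_le measurableSet_Iio (by positivity) h2 k
  have he : -2 * (k : ℝ) * (t / 8) ^ 2 = -(k * t ^ 2 / 32) := by ring
  rw [he] at h3 h4
  rw [two_mul]
  refine (measureReal_mono (fun z hz => ?_)).trans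
    ((measureReal_union_le _ _).trans (add_le_add h3 h4))
  simp only [Set.mem_ofPred_eq, Set.mem_union, Set.mem_Ioi, Set.mem_Iio] at hz ⊢
  rcases lt_abs.1 hz with hz | hz
  · left
    have := PolyBN.le_two_mul_card_of_lt_median hk (v := fun s => a + z s) (a := a + γ * t)
        (by linarith)
    simpa using this
  · right
    have := PolyBN.le_two_mul_card_of_median_lt hk (v := fun s => a + z s) (a := a + -(γ * t))
        (by linarith)
    simpa only [add_lt_add_iff_left] using this

/-! ### Concentration of the coefficient estimates -/

theorem MeasureTheory.measurePreserving_curry (ι κ : Type*) {Ω : Type*} [Fintype ι] [Fintype κ]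
    {mΩ : MeasurableSpace Ω} (μ : Measure Ω) [IsProbabilityMeasure μ] :
    MeasurePreserving (MeasurableEquiv.curry ι κ Ω) (Measure.pi fun _ => μ)
      (Measure.pi fun _ => Measure.pi fun _ => μ) := by
  refine ⟨MeasurableEquiv.measurable _, ?_⟩
  have h := Measure.infinitePi_map_curry (ι := ι) (κ := κ) (X := Ω) (μ := fun _ _ => μ)
  simpa only [Measure.infinitePi_eq_pi] using h

namespace PolyBN

variable {n : ℕ} {G : Digraph (Fin n)} (θ : Params G)

/-- The matrices of different batches are independent. -/
theorem Params.measurePreserving_batchFamilies (hG : IsPolytree G) (hθ : ∀ i, 0 < θ.noiseVar i)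
    (m : ℕ) (y : Fin n) :
    MeasurePreserving (fun x (s : Fin (m / inDeg G y)) => θ.batchFamily y s x)
      (Measure.pi fun _ : Fin m => θ.law)
      (Measure.pi fun _ => gaussianRows (inDeg G y) (θ.familyVar y)) := by
  have h1 := measurePreserving_comp_injective θ.law
      (batchIdx_injective_prod (m := m) (p := inDeg G y))
  have h2 := measurePreserving_curry (Fin (m / inDeg G y)) (Fin (inDeg G y)) θ.law
  have h3 := measurePreserving_pi (ι := Fin (m / inDeg G y)) (fun _ => Measure.pi fun _ => θ.law)
    (fun _ => gaussianRows (inDeg G y) (θ.familyVar y)) fun _ =>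
      measurePreserving_pi (ι := Fin (inDeg G y)) (fun _ => θ.law) _ fun _ =>
        ⟨θ.measurable_family y, θ.map_family_law hG hθ y⟩
  exact h3.comp (h2.comp h1)

/-- The estimate of a coefficient by `CauchyEstTree`, with Cramer's rule in place of the given
linear solver. It agrees with `cauchyEstTree` almost everywhere, and it is measurable. -/
def Params.medianEst {m : ℕ} (x : Fin m → Fin n → ℝ) (y : Fin n) (c : Fin (inDeg G y)) : ℝ :=
  median fun s : Fin (m / inDeg G y) => θ.coef y c + cramerSol c (θ.batchFamily y s x)

theorem Params.measurable_medianEst {m : ℕ} (y : Fin n) (c : Fin (inDeg G y)) :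
    Measurable fun x : Fin m → Fin n → ℝ => θ.medianEst x y c := by
  refine (measurable_median _).comp (measurable_pi_lambda _ fun s => ?_)
  refine measurable_const.add ((measurable_cramerSol c).comp ?_)
  exact measurable_pi_lambda _ fun r => (θ.measurable_family y).comp (measurable_pi_apply _)

theorem Params.ae_cauchyEstTree_eq (hG : IsPolytree G) (hθ : ∀ i, 0 < θ.noiseVar i) {S : LinSolver}
    (hS : S.IsCorrect) (m : ℕ) :
    ∀ᵐ x ∂(Measure.pi fun _ : Fin m => θ.law), cauchyEstTree S G x = θ.medianEst x := by
  have h := ae_all_iff.2 fun y : Fin n => ae_all_iff.2 fun s : Fin (m / inDeg G y) =>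
    ae_batchEstimate_sub_eq θ hG hθ hS y s
  filter_upwards [h] with x hx
  funext y c
  simp only [cauchyEstTree, Params.medianEst, ← hx, add_sub_cancel]

theorem Params.measure_medianEst_le (hG : IsPolytree G) (hθ : ∀ i, 0 < θ.noiseVar i) {m : ℕ}
    (y : Fin n) (c : Fin (inDeg G y)) (hm : 0 < m / inDeg G y) {t : ℝ} (ht : 0 ≤ t) (ht1 : t ≤ 1) :
    (Measure.pi fun _ : Fin m => θ.law).real
        {x | t ^ 2 * θ.noiseVar y <
          (θ.coef y c - θ.medianEst x y c) ^ 2 * θ.nodeVar (parent G y c)} ≤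
      2 * Real.exp (-((m / inDeg G y : ℕ) * t ^ 2 / 32)) := by
  have hv := hθ y
  have hw := θ.nodeVar_pos hG.1 hθ (parent G y c)
  set γ : ℝ≥0 := (Real.sqrt (θ.noiseVar y / θ.nodeVar (parent G y c))).toNNReal with hγ
  have hγ0 : γ ≠ 0 := by
    rw [hγ, ne_eq, Real.toNNReal_eq_zero, not_le]
    positivity
  have hmp : MeasurePreserving (fun x (s : Fin (m / inDeg G y)) =>
      cramerSol c (θ.batchFamily y s x))
      (Measure.pi fun _ : Fin m => θ.law) (Measure.pi fun _ => cauchyMeasure 0 γ) :=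
    (measurePreserving_pi (fun _ => gaussianRows (inDeg G y) (θ.familyVar y)) _ fun _ =>
      ⟨measurable_cramerSol c, map_cramerSol (θ.familyVar_pos hG.1 hθ y) c⟩).comp
      (θ.measurePreserving_batchFamilies hG hθ m y)
  refine le_trans (le_of_eq ?_) (measure_median_cauchy_le hγ0 ht ht1 (θ.coef y c) hm)
  have hmeas : MeasurableSet {z : Fin (m / inDeg G y) → ℝ |
      γ * t < |median (fun s => θ.coef y c + z s) - θ.coef y c|} := by
    have : Measurable fun z : Fin (m / inDeg G y) → ℝ => median (fun s => θ.coef y c + z s) :=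
      (measurable_median _).comp (by fun_prop)
    exact measurableSet_lt measurable_const (by fun_prop)
  rw [← hmp.measureReal_preimage hmeas.nullMeasurableSet]
  congr 1
  ext x
  simp only [Set.mem_ofPred_eq, Set.preimage_ofPred_eq]
  rw [← Params.medianEst, ← abs_of_nonneg (by positivity : 0 ≤ (γ : ℝ) * t), ← sq_lt_sq,
      mul_pow, hγ,
    Real.coe_toNNReal _ (Real.sqrt_nonneg _), Real.sq_sqrt (by positivity), div_mul_eq_mul_div,
    div_lt_iff₀ hw, mul_comm (t ^ 2), sub_sq_comm]

end PolyBN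

/-! ### Concentration of the empirical variance -/

theorem one_le_one_sub_mul_exp {x : ℝ} (h2 : x ≤ 1 / 2) :
    1 ≤ (1 - x) * Real.exp (x + x ^ 2) := by
  rcases le_total 0 x with hx | hx
  · have h := Real.quadratic_le_exp_of_nonneg (x := x + x ^ 2) (by positivity)
    refine le_trans ?_ (mul_le_mul_of_nonneg_left h (by linarith))
    have h3 : x ≤ (1 - x) * (1 + x) ^ 2 / 2 := by nlinarith [mul_nonneg hx (sub_nonneg.2 h2)]
    nlinarith [mul_le_mul_of_nonneg_left h3 (sq_nonneg x)]
  · have h := Real.add_one_le_exp (x + x ^ 2)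
    refine le_trans ?_ (mul_le_mul_of_nonneg_left h (by linarith))
    nlinarith [mul_nonneg (neg_nonneg.2 hx) (sq_nonneg x)]

section ChiSquare

variable {v : ℝ}

theorem gaussianPDFReal_mul_exp_sq (hv : 0 < v) (s : ℝ) :
    (fun x => gaussianPDFReal 0 v.toNNReal x * Real.exp (s * x ^ 2)) =
      fun x => (Real.sqrt (2 * Real.pi * v))⁻¹ *
        Real.exp (-((1 - 2 * v * s) / (2 * v)) * x ^ 2) := by
  funext x
  rw [gaussianPDFReal, Real.coe_toNNReal _ hv.le, mul_assoc, ← Real.exp_add]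
  congr 2
  field_simp
  ring

theorem integrable_exp_mul_sq_gaussianReal (hv : 0 < v) {s : ℝ} (hs : 2 * v * s < 1) :
    Integrable (fun x => Real.exp (s * x ^ 2)) (gaussianReal 0 v.toNNReal) := by
  have hv' : v.toNNReal ≠ 0 := by simpa using hv
  have hb : 0 < (1 - 2 * v * s) / (2 * v) := by
    have := sub_pos.2 hs
    positivity
  rw [gaussianReal_of_var_ne_zero _ hv',
    integrable_withDensity_iff_integrable_smul' (measurable_gaussianPDF _ _)
      (Filter.Eventually.of_forall fun _ => gaussianPDF_lt_top)]
  simp only [toReal_gaussianPDF, smul_eq_mul]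
  rw [gaussianPDFReal_mul_exp_sq hv]
  exact (integrable_exp_neg_mul_sq hb).const_mul _

theorem mgf_sq_gaussianReal (hv : 0 < v) {s : ℝ} (hs : 2 * v * s < 1) :
    mgf (fun x => x ^ 2) (gaussianReal 0 v.toNNReal) s = (Real.sqrt (1 - 2 * v * s))⁻¹ := by
  have hv' : v.toNNReal ≠ 0 := by simpa using hv
  have h1 := sub_pos.2 hs
  rw [mgf, integral_gaussianReal_eq_integral_smul hv']
  simp only [smul_eq_mul]
  rw [gaussianPDFReal_mul_exp_sq hv, integral_const_mul, integral_gaussian, ← Real.sqrt_inv,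
    ← Real.sqrt_inv, ← Real.sqrt_mul (by positivity)]
  congr 1
  have := Real.pi_pos
  field_simp

theorem mgf_sq_gaussianReal_le (hv : 0 < v) {x : ℝ} (h2 : x ≤ 1 / 2) :
    mgf (fun z => z ^ 2) (gaussianReal 0 v.toNNReal) (x / (2 * v)) ≤
        Real.exp ((x + x ^ 2) / 2) := by
  have h3 : 2 * v * (x / (2 * v)) = x := by field_simp
  have h4 : 0 < 1 - x := by linarith
  rw [mgf_sq_gaussianReal hv (by rw [h3]; linarith), h3, inv_le_iff_one_le_mul₀ (by positivity),
    Real.exp_half, ← Real.sqrt_mul (Real.exp_nonneg _), Real.one_le_sqrt, mul_comm]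
  exact one_le_one_sub_mul_exp h2

/-- Chernoff's bound for both tails of a chi-square distribution. -/
theorem measure_mean_sq_gaussianReal_le (hv : 0 < v) {u : ℝ} (hu : 0 ≤ u) (hu1 : u ≤ 1) {m : ℕ}
    (hm : 0 < m) :
    (Measure.pi fun _ : Fin m => gaussianReal 0 v.toNNReal).real
      {z | u * v < |(∑ s, z s ^ 2) / m - v|} ≤ 2 * Real.exp (-(m * u ^ 2 / 8)) := by
  set μ := Measure.pi fun _ : Fin m => gaussianReal 0 v.toNNReal with hμ
  have hm' : (0 : ℝ) < m := by exact_mod_cast hm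
  let X : Fin m → (Fin m → ℝ) → ℝ := fun s z => z s ^ 2
  have hXm : ∀ s, Measurable (X s) := fun s => (measurable_pi_apply s).pow_const 2
  have hind : iIndepFun X μ :=
    iIndepFun_pi (X := fun _ (z : ℝ) => z ^ 2) fun _ => (measurable_id.pow_const 2).aemeasurable
  have hev : ∀ s : Fin m, MeasurePreserving (fun z : Fin m → ℝ => z s) μ
      (gaussianReal 0 v.toNNReal) :=
    fun s => measurePreserving_eval (fun _ => gaussianReal 0 v.toNNReal) s
  -- the same exponent `x / (2 v)` with `x = ± u / 2` serves both tails
  have hmgf : ∀ x : ℝ, x ≤ 1 / 2 → mgf (∑ s, X s) μ (x / (2 * v)) ≤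
      Real.exp (m * ((x + x ^ 2) / 2)) := fun x h2 => by
    rw [hind.mgf_sum hXm]
    have : ∀ s ∈ Finset.univ, mgf (X s) μ (x / (2 * v)) ≤ Real.exp ((x + x ^ 2) / 2) :=
        fun s _ => by
      refine le_trans (le_of_eq ?_) (mgf_sq_gaussianReal_le hv h2)
      rw [← (hev s).map_eq, mgf_map (hev s).measurable.aemeasurable
          (Measurable.aestronglyMeasurable (by fun_prop))]
      rfl
    refine (Finset.prod_le_prod (fun _ _ => mgf_nonneg) this).trans (le_of_eq ?_)
    rw [Finset.prod_const, Finset.card_univ, Fintype.card_fin, ← Real.exp_nat_mul]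
  have hint : ∀ x : ℝ, x ≤ 1 / 2 →
      Integrable (fun z => Real.exp (x / (2 * v) * (∑ s, X s) z)) μ := fun x h2 => by
    refine hind.integrable_exp_mul_sum hXm fun s _ => ?_
    have h3 : 2 * v * (x / (2 * v)) = x := by field_simp
    exact (hev s).integrable_comp_of_integrable
      (integrable_exp_mul_sq_gaussianReal hv (s := x / (2 * v)) (by rw [h3]; linarith))
  have hup := measure_ge_le_exp_mul_mgf (μ := μ) (X := ∑ s, X s) (m * v * (1 + u))
    (t := (u / 2) / (2 * v)) (by positivity) (hint _ (by linarith))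
  have hlo := measure_le_le_exp_mul_mgf (μ := μ) (X := ∑ s, X s) (m * v * (1 - u))
    (t := (-(u / 2)) / (2 * v)) (div_nonpos_of_nonpos_of_nonneg (by linarith) (by positivity))
    (hint _ (by linarith))
  have hup' : μ.real {z | m * v * (1 + u) ≤ (∑ s, X s) z} ≤ Real.exp (-(m * u ^ 2 / 8)) := by
    refine hup.trans ((mul_le_mul_of_nonneg_left (hmgf _ (by linarith))
      (Real.exp_nonneg _)).trans (le_of_eq ?_))
    rw [← Real.exp_add]
    congr 1
    field_simp
    ring
  have hlo' : μ.real {z | (∑ s, X s) z ≤ m * v * (1 - u)} ≤ Real.exp (-(m * u ^ 2 / 8)) := by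
    refine hlo.trans ((mul_le_mul_of_nonneg_left (hmgf _ (by linarith))
      (Real.exp_nonneg _)).trans (le_of_eq ?_))
    rw [← Real.exp_add]
    congr 1
    field_simp
    ring
  rw [two_mul]
  refine (measureReal_mono (fun z hz => ?_)).trans
    ((measureReal_union_le _ _).trans (add_le_add hup' hlo'))
  simp only [Set.mem_ofPred_eq, Set.mem_union, Finset.sum_apply, X] at hz ⊢
  rcases lt_abs.1 hz with hz | hz
  · left
    have h5 : v * (1 + u) < (∑ s, z s ^ 2) / m := by linarith
    rw [lt_div_iff₀ hm'] at h5
    linarith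
  · right
    have h5 : (∑ s, z s ^ 2) / m < v * (1 - u) := by linarith
    rw [div_lt_iff₀ hm'] at h5
    linarith

end ChiSquare

/-! ### Errors of the learned parameters -/

/-- The first `m₁` and the last `m₂` of `m₁ + m₂` independent samples are independent. -/
theorem MeasureTheory.measurePreserving_split {Ω : Type*} {mΩ : MeasurableSpace Ω} (μ : Measure Ω)
    [IsProbabilityMeasure μ] (m₁ m₂ : ℕ) :
    MeasurePreserving (fun x : Fin (m₁ + m₂) → Ω =>
        ((fun s => x (Fin.castAdd m₂ s) : Fin m₁ → Ω), (fun s => x (Fin.natAdd m₁ s) : Fin m₂ → Ω)))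
      (Measure.pi fun _ => μ) ((Measure.pi fun _ => μ).prod (Measure.pi fun _ => μ)) :=
  (measurePreserving_sumPiEquivProdPi (X := fun _ : Fin m₁ ⊕ Fin m₂ => Ω) fun _ => μ).comp
    (measurePreserving_comp_injective μ (finSumFinEquiv (m := m₁) (n := m₂)).injective)

namespace PolyBN

variable {n : ℕ} {G : Digraph (Fin n)} (θ : Params G)

theorem Params.residualVar_pos (hθ : ∀ i, 0 < θ.noiseVar i) (y : Fin n) (a : Fin (inDeg G y) → ℝ) :
    0 < θ.residualVar y a :=
  add_pos_of_pos_of_nonneg (hθ y)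
    (Finset.sum_nonneg fun _ _ => mul_nonneg (sq_nonneg _) (θ.nodeVar_nonneg _))

/-- For fixed coefficients `a`, the residuals of the samples are independent centered Gaussian
variables. -/
theorem Params.measure_varianceRecovery_le (hG : IsPolytree G) (hθ : ∀ i, 0 < θ.noiseVar i)
    (a : (i : Fin n) → Fin (inDeg G i) → ℝ) (y : Fin n) {u : ℝ} (hu : 0 ≤ u) (hu1 : u ≤ 1) {m : ℕ}
    (hm : 0 < m) :
    (Measure.pi fun _ : Fin m => θ.law).real {x | u * θ.residualVar y (a y) <
        |varianceRecovery G a x y - θ.residualVar y (a y)|} ≤ 2 * Real.exp (-(m * u ^ 2 / 8)) := by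
  have hmp := measurePreserving_pi (ι := Fin m) (fun _ => θ.law)
    (fun _ => gaussianReal 0 (θ.residualVar y (a y)).toNNReal) fun _ =>
      ⟨by fun_prop, θ.map_residual_law hG hθ y (a y)⟩
  refine le_trans (le_of_eq ?_)
    (measure_mean_sq_gaussianReal_le (θ.residualVar_pos hθ y (a y)) hu hu1 hm)
  have hmeas : MeasurableSet {z : Fin m → ℝ | u * θ.residualVar y (a y) <
      |(∑ s, z s ^ 2) / m - θ.residualVar y (a y)|} :=
    measurableSet_lt measurable_const (by fun_prop)
  rw [← hmp.measureReal_preimage hmeas.nullMeasurableSet]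
  rfl

/-- The errors of the parameters `θ'` are at most `t` for the coefficients, in the unit
`σ_y / sqrt (Var X_j)` of the batch errors, and at most `u` for the variances, relative to the
variances of the residuals that belong to the coefficients of `θ'`. -/
def Params.IsAccurate (θ' : Params G) (t u : ℝ) : Prop :=
  (∀ y c, (θ.coef y c - θ'.coef y c) ^ 2 * θ.nodeVar (parent G y c) ≤ t ^ 2 * θ.noiseVar y) ∧
    ∀ y, |θ'.noiseVar y - θ.residualVar y (θ'.coef y)| ≤ u * θ.residualVar y (θ'.coef y)

/-- The coefficients come from the first samples, which are independent of the last samples. So they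
can be treated as fixed when the variances are estimated. -/
theorem Params.measure_prod_varianceRecovery_le (hG : IsPolytree G) (hθ : ∀ i, 0 < θ.noiseVar i)
    (y : Fin n) {u : ℝ} (hu : 0 ≤ u) (hu1 : u ≤ 1) (m₁ : ℕ) {m₂ : ℕ} (hm : 0 < m₂) :
    MeasurableSet {q : (Fin m₁ → Fin n → ℝ) × (Fin m₂ → Fin n → ℝ) |
        u * θ.residualVar y (θ.medianEst q.1 y) <
          |varianceRecovery G (θ.medianEst q.1) q.2 y - θ.residualVar y (θ.medianEst q.1 y)|} ∧
    ((Measure.pi fun _ : Fin m₁ => θ.law).prod (Measure.pi fun _ : Fin m₂ => θ.law))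
      {q | u * θ.residualVar y (θ.medianEst q.1 y) <
        |varianceRecovery G (θ.medianEst q.1) q.2 y - θ.residualVar y (θ.medianEst q.1 y)|} ≤
      ENNReal.ofReal (2 * Real.exp (-(m₂ * u ^ 2 / 8))) := by
  have hA : ∀ c, Measurable fun q : (Fin m₁ → Fin n → ℝ) × (Fin m₂ → Fin n → ℝ) =>
      θ.medianEst q.1 y c := fun c => (θ.measurable_medianEst y c).comp measurable_fst
  have hR : Measurable fun q : (Fin m₁ → Fin n → ℝ) × (Fin m₂ → Fin n → ℝ) =>
      θ.residualVar y (θ.medianEst q.1 y) := by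
    unfold Params.residualVar
    fun_prop
  have hV : Measurable fun q : (Fin m₁ → Fin n → ℝ) × (Fin m₂ → Fin n → ℝ) =>
      varianceRecovery G (θ.medianEst q.1) q.2 y := by
    unfold varianceRecovery
    fun_prop
  have hmeas := measurableSet_lt (hR.const_mul u) (hV.sub hR).abs
  refine ⟨hmeas, ?_⟩
  refine (Measure.prod_apply hmeas).trans_le ?_
  refine (lintegral_mono (g := fun _ => ENNReal.ofReal (2 * Real.exp (-(m₂ * u ^ 2 / 8))))
      fun x => ?_).trans
    (by simp)
  rw [← ofReal_measureReal]
  exact ENNReal.ofReal_le_ofReal (θ.measure_varianceRecovery_le hG hθ (θ.medianEst x) y hu hu1 hm)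

/-- The union bound over all coefficients and variances. The linear solver is arbitrary, so that the
set on the left need not be measurable; up to a null set, it lies in a measurable set that does not
involve the solver. -/
theorem Params.measure_not_isAccurate_le (hG : IsPolytree G) (hθ : ∀ i, 0 < θ.noiseVar i)
    {S : LinSolver} (hS : S.IsCorrect) {t u : ℝ} (ht : 0 ≤ t) (ht1 : t ≤ 1) (hu : 0 ≤ u)
        (hu1 : u ≤ 1)
    {k m₁ m₂ : ℕ} (hk : 0 < k) (hm₁ : ∀ i, k * inDeg G i ≤ m₁) (hm₂ : 0 < m₂) :
    (Measure.pi fun _ : Fin (m₁ + m₂) => θ.law) {x | ¬ θ.IsAccurate (twoPhase S G x) t u} ≤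
      ENNReal.ofReal (n ^ 2 * (2 * Real.exp (-(k * t ^ 2 / 32))) +
        n * (2 * Real.exp (-(m₂ * u ^ 2 / 8)))) := by
  set P := Measure.pi fun _ : Fin (m₁ + m₂) => θ.law with hP
  have hfst : MeasurePreserving (fun (x : Fin (m₁ + m₂) → Fin n → ℝ) s => x (Fin.castAdd m₂ s)) P
      (Measure.pi fun _ : Fin m₁ => θ.law) :=
    measurePreserving_comp_injective θ.law (Fin.castAdd_injective m₁ m₂)
  have hsplit := measurePreserving_split θ.law m₁ m₂
  have h0 := hfst.quasiMeasurePreserving.ae (θ.ae_cauchyEstTree_eq hG hθ hS m₁)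
  let A : (Σ y, Fin (inDeg G y)) → Set (Fin (m₁ + m₂) → Fin n → ℝ) := fun e =>
    {x | t ^ 2 * θ.noiseVar e.1 < (θ.coef e.1 e.2 -
      θ.medianEst (fun s => x (Fin.castAdd m₂ s)) e.1 e.2) ^ 2 * θ.nodeVar (parent G e.1 e.2)}
  let B : Fin n → Set (Fin (m₁ + m₂) → Fin n → ℝ) := fun y =>
    {x | u * θ.residualVar y (θ.medianEst (fun s => x (Fin.castAdd m₂ s)) y) <
      |varianceRecovery G (θ.medianEst fun s => x (Fin.castAdd m₂ s))
          (fun s => x (Fin.natAdd m₁ s)) y -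
        θ.residualVar y (θ.medianEst (fun s => x (Fin.castAdd m₂ s)) y)|}
  have hA : ∀ e, P (A e) ≤ ENNReal.ofReal (2 * Real.exp (-(k * t ^ 2 / 32))) := fun e => by
    have hp : 0 < inDeg G e.1 := e.2.pos
    have hk' : k ≤ m₁ / inDeg G e.1 := (Nat.le_div_iff_mul_le hp).2 (hm₁ e.1)
    have hmeas : MeasurableSet {x : Fin m₁ → Fin n → ℝ | t ^ 2 * θ.noiseVar e.1 <
        (θ.coef e.1 e.2 - θ.medianEst x e.1 e.2) ^ 2 * θ.nodeVar (parent G e.1 e.2)} := by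
      have := θ.measurable_medianEst (m := m₁) e.1 e.2
      exact measurableSet_lt measurable_const (by fun_prop)
    have h1 := θ.measure_medianEst_le hG hθ (m := m₁) e.1 e.2 (hk.trans_le hk') ht ht1
    rw [← hfst.measureReal_preimage hmeas.nullMeasurableSet] at h1
    rw [← ofReal_measureReal]
    refine ENNReal.ofReal_le_ofReal (h1.trans ?_)
    have hk'' : (k : ℝ) ≤ (m₁ / inDeg G e.1 : ℕ) := by exact_mod_cast hk'
    gcongr
  have hB : ∀ y, P (B y) ≤ ENNReal.ofReal (2 * Real.exp (-(m₂ * u ^ 2 / 8))) := fun y => by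
    obtain ⟨hmeas, h1⟩ := θ.measure_prod_varianceRecovery_le hG hθ y hu hu1 m₁ hm₂
    rwa [← hsplit.measure_preimage hmeas.nullMeasurableSet] at h1
  have hsub : ({x | ¬ θ.IsAccurate (twoPhase S G x) t u} : Set _) ≤ᵐ[P]
      ((⋃ e, A e) ∪ ⋃ y, B y : Set _) := by
    filter_upwards [h0] with x hx hbad
    change ¬ _ at hbad
    by_contra hcon
    change ¬ (x ∈ (⋃ e, A e) ∪ ⋃ y, B y) at hcon
    simp only [Set.mem_union, Set.mem_iUnion, not_or, not_exists, A, B, Set.mem_ofPred_eq,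
        not_lt] at hcon
    refine hbad ⟨fun y c => ?_, fun y => ?_⟩
    · simp only [twoPhase, hx]
      exact hcon.1 ⟨y, c⟩
    · simp only [twoPhase, hx]
      exact hcon.2 y
  have hcard : (Fintype.card (Σ y, Fin (inDeg G y)) : ℝ) ≤ n ^ 2 := by
    rw [Fintype.card_sigma]
    simp only [Fintype.card_fin]
    have : ∑ y, inDeg G y ≤ ∑ _y : Fin n, n := Finset.sum_le_sum fun y _ =>
      (Finset.card_le_univ _).trans_eq (Fintype.card_fin n)
    rw [Finset.sum_const, Finset.card_univ, Fintype.card_fin, smul_eq_mul, ← sq] at this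
    exact_mod_cast this
  calc P {x | ¬ θ.IsAccurate (twoPhase S G x) t u}
      ≤ P (⋃ e, A e) + P (⋃ y, B y) := (measure_mono_ae hsub).trans (measure_union_le _ _)
    _ ≤ ∑ e, P (A e) + ∑ y, P (B y) :=
        add_le_add (measure_iUnion_fintype_le P A) (measure_iUnion_fintype_le P B)
    _ ≤ ∑ _e : (Σ y, Fin (inDeg G y)), ENNReal.ofReal (2 * Real.exp (-(k * t ^ 2 / 32))) +
          ∑ _y : Fin n, ENNReal.ofReal (2 * Real.exp (-(m₂ * u ^ 2 / 8))) :=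
        add_le_add (Finset.sum_le_sum fun e _ => hA e) (Finset.sum_le_sum fun y _ => hB y)
    _ = ENNReal.ofReal (Fintype.card (Σ y, Fin (inDeg G y)) * (2 * Real.exp (-(k * t ^ 2 / 32))) +
          n * (2 * Real.exp (-(m₂ * u ^ 2 / 8)))) := by
        rw [ENNReal.ofReal_add (by positivity) (by positivity),
            ENNReal.ofReal_mul (Nat.cast_nonneg _),
          ENNReal.ofReal_mul (Nat.cast_nonneg n)]
        simp only [Finset.sum_const, Finset.card_univ, Fintype.card_fin, nsmul_eq_mul,
          ENNReal.ofReal_natCast]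
    _ ≤ _ := ENNReal.ofReal_le_ofReal (by gcongr)

end PolyBN

/-! ### Pinsker's inequality -/

/-- Pinsker's inequality, for the distribution with density `exp (-Z)` with respect to `P`. Jensen's
inequality bounds the exponential moments of an indicator function under this distribution from
below, and Hoeffding's lemma bounds them from above. -/
theorem sq_measureReal_sub_le_integral {Ω : Type*} [MeasurableSpace Ω] {P : Measure Ω}
    [IsProbabilityMeasure P] {Z : Ω → ℝ} (hZm : Measurable Z) (hZ : Integrable Z P)
    [IsProbabilityMeasure (P.withDensity fun x => ENNReal.ofReal (Real.exp (-Z x)))]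
    {A : Set Ω} (hA : MeasurableSet A) :
    (P.real A - (P.withDensity fun x => ENNReal.ofReal (Real.exp (-Z x))).real A) ^ 2 ≤
      (∫ x, Z x ∂P) / 2 := by
  set f : Ω → ℝ≥0∞ := fun x => ENNReal.ofReal (Real.exp (-Z x)) with hf
  have hfm : Measurable f := by fun_prop
  have hft : ∀ᵐ x ∂P, f x < ∞ := Filter.Eventually.of_forall fun x => ENNReal.ofReal_lt_top
  set Q := P.withDensity f with hQ
  set s : ℝ := 4 * (P.real A - Q.real A) with hs
  have hA1 : Integrable (A.indicator (1 : Ω → ℝ)) P := (integrable_const 1).indicator hA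
  have h1 := hasSubgaussianMGF_of_mem_Icc (μ := Q) (X := A.indicator 1) (a := 0) (b := 1)
    (measurable_one.indicator hA).aemeasurable (Filter.Eventually.of_forall fun z => by
      by_cases hz : z ∈ A <;> simp [hz])
  rw [integral_indicator_one hA] at h1
  have h2 := h1.mgf_le s
  have h3 := h1.integrable_exp_mul s
  rw [hQ, integrable_withDensity_iff_integrable_smul' hfm hft, ← hQ] at h3
  rw [mgf, hQ, integral_withDensity_eq_integral_toReal_smul hfm hft, ← hQ] at h2
  set W : Ω → ℝ := fun x => s * (A.indicator 1 x - Q.real A) - Z x with hW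
  have hexp : (fun x => (f x).toReal • Real.exp (s * (A.indicator 1 x - Q.real A))) =
      fun x => Real.exp (W x) := by
    funext x
    rw [hf, ENNReal.toReal_ofReal (Real.exp_nonneg _), smul_eq_mul, ← Real.exp_add, hW]
    congr 1
    ring
  rw [hexp] at h2 h3
  have hAs : Integrable (fun x => s * (A.indicator 1 x - Q.real A)) P :=
    (hA1.sub (integrable_const _)).const_mul s
  have hWi : Integrable W P := hAs.sub hZ
  set κ := ∫ x, W x ∂P with hκ
  have hκ' : κ = s * (P.real A - Q.real A) - ∫ x, Z x ∂P := by
    rw [hκ, hW, integral_sub hAs hZ, integral_const_mul,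
      integral_sub hA1 (integrable_const _), integral_indicator_one hA]
    simp
  have h4 : Real.exp κ ≤ ∫ x, Real.exp (W x) ∂P := by
    have hWκ : Integrable (fun x => W x - κ) P := hWi.sub (integrable_const _)
    have h5 : ∫ x, Real.exp κ * (1 + (W x - κ)) ∂P = Real.exp κ := by
      rw [integral_const_mul, integral_add (integrable_const _) hWκ,
        integral_sub hWi (integrable_const _)]
      simp [hκ]
    rw [← h5]
    refine integral_mono (((integrable_const _).add hWκ).const_mul _) h3
      fun x => ?_
    have h6 := Real.add_one_le_exp (W x - κ)
    calc Real.exp κ * (1 + (W x - κ)) ≤ Real.exp κ * Real.exp (W x - κ) :=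
          mul_le_mul_of_nonneg_left (by linarith) (Real.exp_nonneg _)
      _ = Real.exp (W x) := by rw [← Real.exp_add]; congr 1; ring
  have h7 := Real.exp_le_exp.1 (h4.trans h2)
  have h8 : (((‖(1 : ℝ) - 0‖₊ / 2) ^ 2 : ℝ≥0) : ℝ) = 1 / 4 := by norm_num
  rw [hκ', h8, hs] at h7
  nlinarith

/-! ### The density of a Gaussian Bayesian network -/

namespace PolyBN

variable {n : ℕ} {G : Digraph (Fin n)}

namespace Params

variable (θ : Params G)

/-- In a suitable order of the nodes, the matrix is triangular with ones on its diagonal. -/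
theorem det_one_sub_coefMatrix (hG : IsDAG G) : (1 - θ.coefMatrix).det = 1 := by
  classical
  -- nodes are sorted by the number of their ancestors
  let b : Fin n → ℕ := fun i => (Finset.univ.filter fun j => Relation.TransGen G.Adj j i).card
  have hb : ∀ i j, G.Adj i j → b i < b j := fun i j hij => by
    refine Finset.card_lt_card ⟨fun k hk => ?_, fun h => ?_⟩
    · simp only [Finset.mem_filter, Finset.mem_univ, true_and] at hk ⊢
      exact hk.tail hij
    · have := h (Finset.mem_filter.2 ⟨Finset.mem_univ i, Relation.TransGen.single hij⟩)
      exact hG i (Finset.mem_filter.1 this).2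
  have h0 : ∀ i j, b i ≤ b j → θ.coefMatrix i j = 0 := fun i j hij => by
    simp only [coefMatrix, Matrix.of_apply]
    refine Finset.sum_eq_zero fun r _ => if_neg fun h => ?_
    have := hb _ _ (adj_parent G i r)
    rw [h] at this
    omega
  have htri : (1 - θ.coefMatrix).BlockTriangular (OrderDual.toDual ∘ b) := fun i j hij => by
    have hij' : b i < b j := hij
    rw [Matrix.sub_apply, h0 i j hij'.le, Matrix.one_apply_ne (by rintro rfl; omega), sub_zero]
  rw [htri.det]
  refine Finset.prod_eq_one fun a _ => ?_
  have : (1 - θ.coefMatrix).toSquareBlock (OrderDual.toDual ∘ b) a = 1 := by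
    ext i j
    have hij : b i = b j := i.2.trans j.2.symm
    simp only [Matrix.toSquareBlock_def, Matrix.of_apply, Matrix.sub_apply, h0 _ _ hij.le, sub_zero,
      Matrix.one_apply, Subtype.ext_iff]
  rw [this, Matrix.det_one]

theorem measurePreserving_solution (hG : IsDAG G) : MeasurePreserving θ.solution volume volume := by
  have hdet : (θ.solMatrix).det = 1 := by
    rw [solMatrix, Matrix.det_nonsing_inv, θ.det_one_sub_coefMatrix hG, Ring.inverse_one]
  have h := Real.map_matrix_volume_pi_eq_smul_volume_pi (M := θ.solMatrix) (by rw [hdet]; norm_num)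
  refine ⟨θ.measurable_solution, ?_⟩
  rw [hdet, inv_one, abs_one, ENNReal.ofReal_one, one_smul] at h
  exact h

/-- The values of the noises, as functions of the values of the variables. -/
def residual (x : Fin n → ℝ) (y : Fin n) : ℝ := x y - ∑ c, x (parent G y c) * θ.coef y c

theorem measurable_residual (y : Fin n) : Measurable fun x => θ.residual x y := by
  unfold residual
  fun_prop

theorem residual_solution (hG : IsDAG G) (η : Fin n → ℝ) : θ.residual (θ.solution η) = η := by
  funext y
  rw [residual, θ.structural_equation hG]
  simp only [mul_comm (θ.solution η _), add_sub_cancel_right]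

/-- The density of `law`. -/
def density (x : Fin n → ℝ) : ℝ≥0∞ :=
  ∏ y, gaussianPDF 0 (θ.noiseVar y).toNNReal (θ.residual x y)

theorem measurable_density : Measurable θ.density :=
  Finset.measurable_prod _ fun y _ => (measurable_gaussianPDF _ _).comp (θ.measurable_residual y)

theorem law_eq_withDensity (hG : IsDAG G) (hθ : ∀ i, 0 < θ.noiseVar i) :
    θ.law = volume.withDensity θ.density := by
  have hv : ∀ i, (θ.noiseVar i).toNNReal ≠ 0 := fun i => by simpa using hθ i
  have hpi : (Measure.pi fun i => gaussianReal 0 (θ.noiseVar i).toNNReal) =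
      volume.withDensity fun η : Fin n → ℝ => ∏ i, gaussianPDF 0 (θ.noiseVar i).toNNReal (η i) := by
    have hinst : ∀ i, SigmaFinite
        ((volume : Measure ℝ).withDensity (gaussianPDF 0 (θ.noiseVar i).toNNReal)) := fun i => by
      rw [← gaussianReal_of_var_ne_zero _ (hv i)]
      infer_instance
    have h := pi_withDensity (μ := fun _ : Fin n => (volume : Measure ℝ))
      fun i => measurable_gaussianPDF 0 (θ.noiseVar i).toNNReal
    simp only [← gaussianReal_of_var_ne_zero _ (hv _)] at h
    exact h
  ext s hs
  rw [law, Measure.map_apply θ.measurable_solution hs, hpi,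
    withDensity_apply _ (θ.measurable_solution hs), withDensity_apply _ hs,
    ← (θ.measurePreserving_solution hG).setLIntegral_comp_preimage hs θ.measurable_density]
  simp only [density, θ.residual_solution hG]

variable (θ' : Params G)

/-- The logarithm of the quotient of the densities of two networks over the same graph. -/
def logRatio (x : Fin n → ℝ) : ℝ :=
  ∑ y, (Real.log (θ'.noiseVar y / θ.noiseVar y) / 2 - θ.residual x y ^ 2 / (2 * θ.noiseVar y) +
    θ'.residual x y ^ 2 / (2 * θ'.noiseVar y))

theorem measurable_logRatio : Measurable (θ.logRatio θ') := by
  have h1 := θ.measurable_residual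
  have h2 := θ'.measurable_residual
  unfold logRatio
  fun_prop

theorem gaussianPDF_mul_exp {v v' : ℝ} (hv : 0 < v) (hv' : 0 < v') (r r' : ℝ) :
    gaussianPDF 0 v.toNNReal r * ENNReal.ofReal (Real.exp (-(Real.log (v' / v) / 2 -
      r ^ 2 / (2 * v) + r' ^ 2 / (2 * v')))) = gaussianPDF 0 v'.toNNReal r' := by
  rw [gaussianPDF, gaussianPDF, ← ENNReal.ofReal_mul (gaussianPDFReal_nonneg _ _ _)]
  congr 1
  have h1 : Real.exp (-(Real.log (v' / v) / 2)) = Real.sqrt v / Real.sqrt v' := by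
    rw [Real.exp_neg, Real.exp_half, Real.exp_log (by positivity), Real.sqrt_div hv'.le, inv_div]
  have h2 : -(Real.log (v' / v) / 2 - r ^ 2 / (2 * v) + r' ^ 2 / (2 * v')) =
      -(Real.log (v' / v) / 2) + (r ^ 2 / (2 * v) + -(r' ^ 2 / (2 * v'))) := by ring
  rw [h2, Real.exp_add, Real.exp_add, h1, gaussianPDFReal, gaussianPDFReal,
      Real.coe_toNNReal _ hv.le,
    Real.coe_toNNReal _ hv'.le, sub_zero, sub_zero, Real.sqrt_mul (by positivity),
    Real.sqrt_mul (by positivity) v', neg_div, neg_div, Real.exp_neg]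
  have := Real.sqrt_pos.2 hv
  have := Real.sqrt_pos.2 hv'
  have := Real.pi_pos
  field_simp

theorem law_eq_law_withDensity (hG : IsDAG G) (hθ : ∀ i, 0 < θ.noiseVar i)
    (hθ' : ∀ i, 0 < θ'.noiseVar i) :
    θ'.law = θ.law.withDensity fun x => ENNReal.ofReal (Real.exp (-θ.logRatio θ' x)) := by
  have hm := θ.measurable_logRatio θ'
  rw [θ.law_eq_withDensity hG hθ, θ'.law_eq_withDensity hG hθ',
    ← withDensity_mul _ θ.measurable_density (by fun_prop)]
  congr 1
  funext x
  rw [Pi.mul_apply, logRatio, ← Finset.sum_neg_distrib, Real.exp_sum,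
    ENNReal.ofReal_prod_of_nonneg fun _ _ => Real.exp_nonneg _, density, density,
    ← Finset.prod_mul_distrib]
  exact Finset.prod_congr rfl fun y _ => (gaussianPDF_mul_exp (hθ y) (hθ' y) _ _).symm

/-! ### The Kullback-Leibler divergence between two networks over the same polytree -/

theorem integrable_residual_sq (hG : IsPolytree G) (hθ : ∀ i, 0 < θ.noiseVar i) (y : Fin n) :
    Integrable (fun x => θ'.residual x y ^ 2) θ.law ∧
      ∫ x, θ'.residual x y ^ 2 ∂θ.law = θ.residualVar y (θ'.coef y) := by
  have hmp : MeasurePreserving (fun x => θ'.residual x y) θ.law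
      (gaussianReal 0 (θ.residualVar y (θ'.coef y)).toNNReal) :=
    ⟨θ'.measurable_residual y, θ.map_residual_law hG hθ y (θ'.coef y)⟩
  have hint := (memLp_id_gaussianReal (μ := 0)
      (v := (θ.residualVar y (θ'.coef y)).toNNReal) 2).integrable_sq
  have hvar := variance_id_gaussianReal (μ := 0) (v := (θ.residualVar y (θ'.coef y)).toNNReal)
  rw [variance_of_integral_eq_zero aemeasurable_id (by simp),
    Real.coe_toNNReal _ (θ.residualVar_pos hθ y _).le, ← hmp.map_eq,
    integral_map hmp.measurable.aemeasurable (Measurable.aestronglyMeasurable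
        (by fun_prop))] at hvar
  exact ⟨hmp.integrable_comp_of_integrable hint, hvar⟩

theorem integral_logRatio (hG : IsPolytree G) (hθ : ∀ i, 0 < θ.noiseVar i) :
    Integrable (θ.logRatio θ') θ.law ∧ ∫ x, θ.logRatio θ' x ∂θ.law =
      ∑ y, (Real.log (θ'.noiseVar y / θ.noiseVar y) / 2 - 1 / 2 +
        θ.residualVar y (θ'.coef y) / (2 * θ'.noiseVar y)) := by
  have h1 := θ.integrable_residual_sq θ hG hθ
  have h2 := θ.integrable_residual_sq θ' hG hθ
  have hself : ∀ y, θ.residualVar y (θ.coef y) = θ.noiseVar y := fun y => by simp [residualVar]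
  have hint : ∀ y, Integrable (fun x => Real.log (θ'.noiseVar y / θ.noiseVar y) / 2 -
      θ.residual x y ^ 2 / (2 * θ.noiseVar y)) θ.law := fun y =>
    (integrable_const _).sub ((h1 y).1.div_const _)
  have hint' : ∀ y, Integrable (fun x => Real.log (θ'.noiseVar y / θ.noiseVar y) / 2 -
      θ.residual x y ^ 2 / (2 * θ.noiseVar y) + θ'.residual x y ^ 2 / (2 * θ'.noiseVar y)) θ.law :=
    fun y => (hint y).add ((h2 y).1.div_const _)
  refine ⟨integrable_finsetSum _ fun y _ => hint' y, ?_⟩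
  simp only [logRatio]
  rw [integral_finsetSum _ fun y _ => hint' y]
  refine Finset.sum_congr rfl fun y _ => ?_
  rw [integral_add (hint y) ((h2 y).1.div_const _),
    integral_sub (integrable_const _) ((h1 y).1.div_const _), integral_div, integral_div,
        integral_div, (h1 y).2,
    (h2 y).2, hself]
  have := (hθ y).ne'
  simp only [integral_const, probReal_univ, one_smul]
  field_simp

/-- The divergence of accurate parameters is small: at every node, the relative error of the
variance enters quadratically, and so do the errors of the coefficients. -/
theorem IsAccurate.integral_logRatio_le {θ θ' : Params G} {t u : ℝ} (h : θ.IsAccurate θ' t u)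
    (hG : IsPolytree G) (hθ : ∀ i, 0 < θ.noiseVar i) (hu1 : u ≤ 1 / 2) :
    (∀ i, 0 < θ'.noiseVar i) ∧
      ∫ x, θ.logRatio θ' x ∂θ.law ≤ n * u ^ 2 + (∑ y, (inDeg G y : ℝ)) * t ^ 2 / 2 := by
  have hτ := fun y => θ.residualVar_pos hθ y (θ'.coef y)
  have hlow : ∀ y, θ.residualVar y (θ'.coef y) ≤ 2 * θ'.noiseVar y := fun y => by
    nlinarith [(abs_le.1 (h.2 y)).1, hτ y]
  have hθ' : ∀ y, 0 < θ'.noiseVar y := fun y => by linarith [hlow y, hτ y]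
  refine ⟨hθ', ?_⟩
  rw [(θ.integral_logRatio θ' hG hθ).2, Finset.sum_mul, Finset.sum_div]
  have hn : (n : ℝ) * u ^ 2 = ∑ _y : Fin n, u ^ 2 := by simp
  rw [hn, ← Finset.sum_add_distrib]
  refine Finset.sum_le_sum fun y _ => ?_
  set v := θ.noiseVar y
  set v' := θ'.noiseVar y
  set τ := θ.residualVar y (θ'.coef y) with hτdef
  have hv : 0 < v := hθ y
  have hv' : 0 < v' := hθ' y
  have hτ0 : 0 < τ := hτ y
  have h1 : τ / v - 1 ≤ inDeg G y * t ^ 2 := by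
    rw [div_sub_one hv.ne', div_le_iff₀ hv, hτdef, residualVar, add_sub_cancel_left]
    refine (Finset.sum_le_sum fun c _ => h.1 y c).trans ?_
    simp [mul_assoc, v]
  have h2 : Real.log (τ / v) ≤ τ / v - 1 := Real.log_le_sub_one_of_pos (by positivity)
  have h3 : Real.log (v' / τ) ≤ v' / τ - 1 := Real.log_le_sub_one_of_pos (by positivity)
  have h4 : Real.log (v' / v) = Real.log (v' / τ) + Real.log (τ / v) := by
    rw [← Real.log_mul (by positivity) (by positivity)]
    congr 1
    field_simp
  have h5 : v' / τ - 1 + τ / v' - 1 ≤ 2 * u ^ 2 := by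
    have : v' / τ - 1 + τ / v' - 1 = (v' - τ) ^ 2 / (τ * v') := by
      field_simp
      ring
    rw [this, div_le_iff₀ (by positivity), ← sq_abs]
    calc |v' - τ| ^ 2 ≤ (u * τ) ^ 2 := by
          gcongr
          exact h.2 y
      _ = u ^ 2 * τ * τ := by ring
      _ ≤ u ^ 2 * τ * (2 * v') := by
          gcongr
          exact hlow y
      _ = _ := by ring
  have h6 : τ / (2 * v') = τ / v' / 2 := by rw [div_div, mul_comm]
  rw [h6, h4]
  linarith

theorem IsAccurate.tvDist_le {θ θ' : Params G} {t u : ℝ} (h : θ.IsAccurate θ' t u)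
    (hG : IsPolytree G) (hθ : ∀ i, 0 < θ.noiseVar i) (hu1 : u ≤ 1 / 2) {ε : ℝ} (hε : 0 ≤ ε)
    (hs : n * u ^ 2 + (∑ y, (inDeg G y : ℝ)) * t ^ 2 / 2 ≤ 2 * ε ^ 2) :
    tvDist θ.law θ'.law ≤ ε := by
  obtain ⟨hθ', hKL⟩ := h.integral_logRatio_le hG hθ hu1
  have hQ := θ.law_eq_law_withDensity θ' hG.1 hθ hθ'
  have hprob : IsProbabilityMeasure
      (θ.law.withDensity fun x => ENNReal.ofReal (Real.exp (-θ.logRatio θ' x))) := by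
    rw [← hQ]
    infer_instance
  have : Nonempty {A : Set (Fin n → ℝ) // MeasurableSet A} := ⟨⟨∅, MeasurableSet.empty⟩⟩
  refine ciSup_le fun A => ?_
  have hP := sq_measureReal_sub_le_integral (θ.measurable_logRatio θ')
      (θ.integral_logRatio θ' hG hθ).1 A.2
  rw [← hQ] at hP
  exact abs_le_of_sq_le_sq (by linarith) hε

end Params

end PolyBN

/-! ### Sample sizes -/

namespace PolyBN

variable {n : ℕ} {G : Digraph (Fin n)}

/-- The bound for `n ^ r` events that have a probability of at most `2 exp (-b)` each. -/
theorem exp_neg_le_of_log_le {n : ℕ} (hn : 2 ≤ n) {δ : ℝ} (hδ : 0 < δ) (hδ1 : δ < 1) {b : ℝ} {r : ℕ}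
    (hb : (r + 2) * Real.log (n / δ) ≤ b) : (n : ℝ) ^ r * (2 * Real.exp (-b)) ≤ δ / 2 := by
  have hn' : (2 : ℝ) ≤ n := by exact_mod_cast hn
  have h1 : 0 < n / δ := by positivity
  have h2 : Real.exp (-b) ≤ (δ / n) ^ (r + 2) := by
    refine (Real.exp_le_exp.2 (neg_le_neg hb)).trans (le_of_eq ?_)
    rw [← mul_neg, ← Real.log_inv, inv_div]
    have h3 : ((r : ℝ) + 2) = ((r + 2 : ℕ) : ℝ) := by push_cast; ring
    rw [h3, ← Real.log_pow, Real.exp_log (by positivity)]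
  have h3 : δ ^ (r + 2) ≤ δ := pow_le_of_le_one hδ.le hδ1.le (by omega)
  calc (n : ℝ) ^ r * (2 * Real.exp (-b)) ≤ (n : ℝ) ^ r * (2 * (δ / n) ^ (r + 2)) := by gcongr
    _ = 2 * δ ^ (r + 2) / n ^ 2 := by
        rw [div_pow, pow_add (n : ℝ)]
        field_simp
    _ ≤ 2 * δ / 2 ^ 2 := by gcongr
    _ = δ / 2 := by ring

/-- The guarantee for the learned distribution. The coefficients are learned up to relative errors
`t = ε / sqrt (n D)` and the variances up to relative errors `u = ε / (2 sqrt n)`. -/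
theorem measure_tvDist_le {d : ℕ} {ε δ : ℝ} (hn : 2 ≤ n) (hG : IsPolytree G)
    (hd : ∀ i, inDeg G i ≤ d) (hε : 0 < ε) (hε1 : ε < 1) (hδ : 0 < δ) (hδ1 : δ < 1) {k M₁ M₂ : ℕ}
    (hk : 128 * (n * avgInDegOne G / ε ^ 2 * Real.log (n / δ)) ≤ k) (hM₁ : d * k ≤ M₁)
    (hM₂ : 96 * (n / ε ^ 2 * Real.log (n / δ)) ≤ M₂) {S : LinSolver} (hS : S.IsCorrect)
    (θ : Params G) (hθ : ∀ i, 0 < θ.noiseVar i) :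
    (Measure.pi fun _ : Fin (M₁ + M₂) => θ.law)
        {x | ¬ tvDist θ.law (twoPhase S G x).law ≤ ε} ≤ ENNReal.ofReal δ := by
  have hn' : (2 : ℝ) ≤ n := by exact_mod_cast hn
  have hD : 1 ≤ avgInDegOne G := one_le_avgInDegOne G
  have hL : 0 < Real.log (n / δ) := Real.log_pos (by rw [lt_div_iff₀ hδ]; linarith)
  have hε2 : ε ^ 2 ≤ 1 := pow_le_one₀ hε.le hε1.le
  set t : ℝ := Real.sqrt (ε ^ 2 / (n * avgInDegOne G)) with ht
  set u : ℝ := Real.sqrt (ε ^ 2 / (4 * n)) with hu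
  have ht2 : t ^ 2 = ε ^ 2 / (n * avgInDegOne G) := Real.sq_sqrt (by positivity)
  have hu2 : u ^ 2 = ε ^ 2 / (4 * n) := Real.sq_sqrt (by positivity)
  have ht1 : t ≤ 1 := by
    rw [ht, Real.sqrt_le_one, div_le_one (by positivity)]
    nlinarith
  have hu1 : u ≤ 1 / 2 := by
    refine abs_le_of_sq_le_sq' ?_ (by norm_num) |>.2
    rw [hu2, div_le_iff₀ (by positivity)]
    nlinarith
  have hk0 : 0 < k := by
    have : (0 : ℝ) < k := lt_of_lt_of_le (by positivity) hk
    exact_mod_cast this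
  have hM₂0 : 0 < M₂ := by
    have : (0 : ℝ) < M₂ := lt_of_lt_of_le (by positivity) hM₂
    exact_mod_cast this
  have hkp : ∀ i, k * inDeg G i ≤ M₁ := fun i =>
    ((Nat.mul_le_mul_left k (hd i)).trans_eq (mul_comm _ _)).trans hM₁
  have hsum := sum_inDeg_le G
  have hacc := θ.measure_not_isAccurate_le hG hθ hS (Real.sqrt_nonneg _) ht1 (Real.sqrt_nonneg _)
    (hu1.trans (by norm_num)) hk0 hkp hM₂0
  have hsub : {x : Fin (M₁ + M₂) → Fin n → ℝ | ¬ tvDist θ.law (twoPhase S G x).law ≤ ε} ⊆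
      {x | ¬ θ.IsAccurate (twoPhase S G x) t u} := by
    refine Set.ofPred_subset_ofPred.2 fun x hx h => hx ?_
    refine h.tvDist_le hG hθ hu1 hε.le ?_
    have h1 : (n : ℝ) * u ^ 2 = ε ^ 2 / 4 := by rw [hu2]; field_simp
    have h2 : (∑ y, (inDeg G y : ℝ)) * t ^ 2 ≤ ε ^ 2 := by
      rw [ht2, mul_div_assoc', div_le_iff₀ (by positivity), mul_comm (ε ^ 2)]
      gcongr
    nlinarith [sq_nonneg ε]
  refine (measure_mono hsub).trans (hacc.trans (ENNReal.ofReal_le_ofReal ?_))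
  -- there are at most `n ^ 2` coefficients, which explains `128 = 32 * (2 + 2)`, and `n` variances,
  -- which explains `96 = 8 * 4 * (1 + 2)`
  · have h1 : (n : ℝ) ^ 2 * (2 * Real.exp (-(k * t ^ 2 / 32))) ≤ δ / 2 := by
      refine exp_neg_le_of_log_le hn hδ hδ1 ?_
      rw [ht2]
      calc (((2 : ℕ) : ℝ) + 2) * Real.log (n / δ)
          = 128 * (n * avgInDegOne G / ε ^ 2 * Real.log (n / δ)) *
              (ε ^ 2 / (n * avgInDegOne G)) / 32 := by
            push_cast
            field_simp
            ring
        _ ≤ _ := by gcongr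
    have h2 : (n : ℝ) ^ 1 * (2 * Real.exp (-(M₂ * u ^ 2 / 8))) ≤ δ / 2 := by
      refine exp_neg_le_of_log_le hn hδ hδ1 ?_
      rw [hu2]
      calc (((1 : ℕ) : ℝ) + 2) * Real.log (n / δ)
          = 96 * (n / ε ^ 2 * Real.log (n / δ)) * (ε ^ 2 / (4 * n)) / 8 := by
            push_cast
            field_simp
            ring
        _ ≤ _ := by gcongr
    rw [pow_one] at h2
    linarith

end PolyBN

open Classical in
/-- The constant in the bound for the running time, if matrices can be multiplied in `O(p ^ ω)`
steps: `exists_solver` provides a constant for the linear systems. -/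
def timeConst (ω : ℝ) : ℝ :=
  if h : 2 ≤ ω ∧ MatMulInTime ω then 129 * ((exists_solver h.1 h.2).choose + 168) + 976 else 0

end

theorem mainTheorem3 :
    ∃ C : ℝ, ∃ K : ℝ → ℝ,
      ∀ (n d : ℕ) (G : Digraph (Fin n)) (ε δ : ℝ),
        2 ≤ n → 1 ≤ d → PolyBN.IsPolytree G → (∀ i, PolyBN.inDeg G i ≤ d) →
        0 < ε → ε < 1 → 0 < δ → δ < 1 →
        ∃ m₁ m₂ : ℕ,
          -- the number of samples
          ((m₁ + m₂ : ℕ) : ℝ) ≤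
            C * (n * PolyBN.avgInDegOne G * d / ε ^ 2) * Real.log (n / (ε * δ)) ∧
          -- the guarantee, for these and for all larger sample sizes
          (∀ M₁ M₂ : ℕ, m₁ ≤ M₁ → m₂ ≤ M₂ →
            ∀ S : PolyBN.LinSolver, S.IsCorrect →
            ∀ θ : PolyBN.Params G, (∀ i, 0 < θ.noiseVar i) →
              -- every coordinate of every batch error has a scaled Cauchy distribution
              (∀ (y : Fin n) (s : Fin (M₁ / PolyBN.inDeg G y)) (c : Fin (PolyBN.inDeg G y)),
                (MeasureTheory.Measure.pi fun _ : Fin M₁ => θ.law).map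
                    (fun x => PolyBN.batchEstimate S G x y s c - θ.coef y c) =
                  ProbabilityTheory.cauchyMeasure 0
                    (Real.sqrt (θ.noiseVar y /
                      ProbabilityTheory.variance (fun x => x (PolyBN.parent G y c)) θ.law)).toNNReal) ∧
              -- with probability at least `1 - δ` the learned distribution is `ε`-close
              (MeasureTheory.Measure.pi fun _ : Fin (M₁ + M₂) => θ.law)
                  {x | ¬ PolyBN.tvDist θ.law (PolyBN.twoPhase S G x).law ≤ ε} ≤
                ENNReal.ofReal δ) ∧
          -- the running time
          (∀ ω : ℝ, 2 ≤ ω → MatMulInTime ω →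
            ∃ S : PolyBN.LinSolver, S.IsCorrect ∧
              ∃ t : CompTree ((Σ i : Fin n, Fin (PolyBN.inDeg G i)) ⊕ Fin n)
                  (Fin (m₁ + m₂) × Fin n),
                ComputesTwoPhase S G t ∧
                (t.cost : ℝ) ≤
                  K ω * (n ^ 2 * PolyBN.avgInDegOne G ^ 2 * (d : ℝ) ^ (ω - 1) / ε ^ 2) *
                    Real.log (n / δ)) := by
  refine ⟨226, timeConst, fun n d G ε δ hn hd hG hGd hε hε1 hδ hδ1 => ?_⟩
  have hn' : (2 : ℝ) ≤ n := by exact_mod_cast hn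
  have hd' : (1 : ℝ) ≤ d := by exact_mod_cast hd
  have hD : 1 ≤ PolyBN.avgInDegOne G := PolyBN.one_le_avgInDegOne G
  have hε2 : ε ^ 2 ≤ 1 := pow_le_one₀ hε.le hε1.le
  set D := PolyBN.avgInDegOne G
  set L := Real.log (n / δ) with hL
  have hL2 : 1 / 2 ≤ L := by
    have h1 : Real.log 2 ≤ L := Real.log_le_log (by norm_num) (by rw [le_div_iff₀ hδ]; nlinarith)
    linarith [Real.log_two_gt_d9]
  set a := n * D / ε ^ 2 * L with ha
  have ha0 : n / ε ^ 2 * L ≤ a := by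
    have : (n : ℝ) ≤ n * D := by nlinarith
    rw [ha]
    gcongr
  have ha1 : 1 ≤ a := by
    have h1 : 2 ≤ n * D / ε ^ 2 := by
      rw [le_div_iff₀ (by positivity)]
      nlinarith
    nlinarith
  -- rounding up costs at most `a`, as `a ≥ 1`; the constant `226` is `129 + 97`
  set k := ⌈128 * a⌉₊
  set m₂ := ⌈96 * (n / ε ^ 2 * L)⌉₊
  have hk : (k : ℝ) ≤ 129 * a := by linarith [Nat.ceil_lt_add_one (show 0 ≤ 128 * a by positivity)]
  have hm₂ : (m₂ : ℝ) ≤ 97 * a := by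
    linarith [Nat.ceil_lt_add_one (show 0 ≤ 96 * (n / ε ^ 2 * L) by positivity)]
  refine ⟨d * k, m₂, ?_, fun M₁ M₂ hM₁ hM₂ S hS θ hθ => ⟨fun y s c => ?_, ?_⟩, fun ω hω hmul => ?_⟩
  · have h1 : L ≤ Real.log (n / (ε * δ)) := by
      refine Real.log_le_log (by positivity) ?_
      gcongr
      nlinarith
    calc ((d * k + m₂ : ℕ) : ℝ) = d * k + m₂ := by push_cast; ring
      _ ≤ d * (129 * a) + d * (97 * a) := by
          gcongr
          nlinarith
      _ = 226 * (n * D * d / ε ^ 2) * L := by rw [ha]; ring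
      _ ≤ _ := by gcongr
  · rw [θ.variance_law]
    exact PolyBN.map_batchEstimate_sub θ hG hθ hS y s c
  · exact PolyBN.measure_tvDist_le hn hG hGd hε hε1 hδ hδ1 (Nat.le_ceil _) hM₁
      ((Nat.le_ceil _).trans (by exact_mod_cast hM₂)) hS θ hθ
  · obtain ⟨hK, S, hS, hcost⟩ := (exists_solver hω hmul).choose_spec
    obtain ⟨T, hT, hTcost⟩ := PolyBN.exists_tree_twoPhase_cost_le hω hK hcost G hd hGd (d * k) m₂
    refine ⟨S, hS, T, hT, hTcost.trans ?_⟩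
    rw [timeConst, dif_pos ⟨hω, hmul⟩]
    set K := (exists_solver hω hmul).choose
    have hpow : (d : ℝ) ^ (ω - 1) = (d : ℝ) ^ (ω - 2) * d := by
      rw [← Real.rpow_add_one (by positivity)]
      congr 1
      ring
    have hpow1 : (1 : ℝ) ≤ (d : ℝ) ^ (ω - 1) := Real.one_le_rpow hd' (by linarith)
    calc n * D * ((K + 168) * (d : ℝ) ^ (ω - 2) * ((d * k : ℕ) : ℝ) + 10 * m₂ + 6)
        ≤ n * D * ((K + 168) * (d : ℝ) ^ (ω - 2) * (d * (129 * a)) + 10 * (97 * a) + 6 * a) := by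
          push_cast
          gcongr
          linarith
      _ = n * D * (129 * (K + 168) * (d : ℝ) ^ (ω - 1) * a + 976 * a * 1) := by rw [hpow]; ring
      _ ≤ n * D * (129 * (K + 168) * (d : ℝ) ^ (ω - 1) * a + 976 * a * (d : ℝ) ^ (ω - 1)) := by
          gcongr
      _ = (129 * (K + 168) + 976) * (n ^ 2 * D ^ 2 * (d : ℝ) ^ (ω - 1) / ε ^ 2) * L := by
          rw [ha]
          ring
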